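/- **Theorem (initial loading estimator).** Fix $K\ge 1$, factor numbers $r_1,\dots,r_K$ and constants $\epsilon\in(0,1)$, $\omega>0$. For each sample size $n$ and dimensions $p_1,\dots,p_K$ write $p=\prod_k p_k$, $p_{-k}=p/p_k$, and let $$\mathcal X_t=\mathcal F_t\times_1\mathbf\Lambda_1\times_2\cdots\times_K\mathbf\Lambda_K+\boldsymbol\xi_t\in\mathbb R^{p_1\times\cdots\times p_K},\qquad 1\le t\le n,$$ with deterministic $\mathcal F_t\in\mathbb R^{r_1\times\cdots\times r_K}$ and $\mathbf\Lambda_k\in\mathbb R^{p_k\times r_k}$, and a centred random field $\boldsymbol\xi=\{\xi_{\mathbf i,t}\}_{(\mathbf i,t)\in\mathbb N^K\times\mathbb Z}$. The model ($n$, $p_k$, $\mathbf\Lambda_k$, $\mathcal F_t$, $\boldsymbol\xi$, $M_n$) may vary along the asymptotic regime $\min(n,p_1,\dots,p_K)\to\infty$; $K$, $r_k$, $\epsilon$, $\omega$ and all constants below do not. Let $|\cdot|_2$ be the Euclidean norm of a tensor, $\|\cdot\|$ the spectral norm, $\|\cdot\|_\nu$ the $L^\nu$ norm of a random variable, and $\mathsf{mat}_k$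 the mode-$k$ unfolding. Assume, along the regime: 1. (Loadings) $p_k^{-1}\mathbf\Lambda_k^\top\mathbf\Lambda_k=\mathbf I_{r_k}$, and the entries of all $\mathbf\Lambda_k$ are bounded by a constant. 2. (Factors) $n^{-1}\sum_{t\le n}\mathsf{mat}_k(\mathcal F_t)\mathsf{mat}_k(\mathcal F_t)^\top$ is diagonal, and its $j$-th diagonal entry lies in $[\alpha^{(k)}_j,\beta^{(k)}_j]$, for constants $\alpha_j^{(k)}>0$, $\beta_j^{(k)}$ with $\alpha^{(k)}_j>\beta^{(k)}_{j+1}$. 3. (Tails) $\|\xi_{\mathbf i,t}\|_{2+2\epsilon}\le\omega$ for all $\mathbf i\in\prod_k\{1,\dots,p_k\}$ and $t\in\mathbb Z$; $n^{-1}\sum_{t\le n}|\mathcal F_t|_2^\nu\le\omega^\nu$ for $\nu\in\{1+\epsilon,2,2+2\epsilon\}$; and $\max(\max_{t\le n}|\mathcal F_t|_2,\omega)\le M_n$, where $M_n$ may diverge. For $\sigma$-algebras let $\alpha(\mathcal A,\mathcal B)=\sup_{A\in\mathcal A,B\in\mathcal B}|\mathsf P(A\cap B)-\mathsf P(A)\mathsf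 P(B)|$, and for $c>0$ put $S(c)=n^{-1}\sum_{t,u\le n}|\mathcal F_t|_2^{1+\epsilon}|\mathcal F_u|_2^{1+\epsilon}e^{-c|t-u|}$. Consider two dependence settings, with constants $c_0,c_\epsilon>0$: (I) *Cross-sectional independence.* The time series $\{\xi_{\mathbf i,t}\}_{t\in\mathbb Z}$, $\mathbf i\in\prod_k\{1,\dots,p_k\}$, are mutually independent; $\sup_{t\in\mathbb Z}\alpha(\sigma\{\xi_{\mathbf i,u}:u\le t\},\sigma\{\xi_{\mathbf i,v}:v\ge t+m\})\le e^{-c_0m}$ for all such $\mathbf i$ and all $m\ge 0$; and for every $k$, $S\big(\tfrac{c_0\epsilon}{1+\epsilon}\big)\le\omega^{2+2\epsilon}c_\epsilon$ and $S\big(\tfrac{c_0}{3\log(np_{-k})}\big)\le\omega^{2+2\epsilon}c_\epsilon\log(np_{-k})$. Set $$\tau^{(k)}_{n,p}=\omega\Big(\frac{np_{-k}}{\log(np_{-k})}\Big)^{\frac1{2+2\epsilon}},\qquad\psi^{(k)}_{n,p}=\omega^2\Big(\frac{\log(np_{-k})}{np_{-k}}\Big)^{\frac{\epsilon}{1+\epsilon}}.$$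 (II) *Mixing random field.* For all $m\ge0$ and all $\mathcal E_1,\mathcal E_2\subset\mathbb N^K\times\mathbb Z$ whose (minimum) distance in the maximum metric is at least $m$, the $\sigma$-algebras generated by $\boldsymbol\xi$ on $\mathcal E_1$ and on $\mathcal E_2$ have $\alpha$-mixing coefficient at most $e^{-c_0m}$; $S\big(\tfrac{c_0\epsilon}{K(1+\epsilon)}\big)\le\omega^{2+2\epsilon}c_\epsilon K$ and $S\big(\tfrac{c_0}{3K\log(np)}\big)\le\omega^{2+2\epsilon}c_\epsilon K\log(np)$. Set $$\tau^{(k)}_{n,p}=\omega\Big(\frac{np_{-k}}{\log^K(np)}\Big)^{\frac1{2+2\epsilon}},\qquad\psi^{(k)}_{n,p}=\omega^2\Big(\frac{\log^K(np)}{np_{-k}}\Big)^{\frac{\epsilon}{1+\epsilon}}.$$ In either setting assume $M_n\max_{k}\,(\tau^{(k)}_{n,p})^{-1}\log^{1/(2\epsilon)}(np_{-k})=o(1)$. Fix $k$ and let $\tau>0$ with $\tau\asymp\tau^{(k)}_{n,p}$. Let $\mathcal X_t^{\tau}$ be $\mathcal X_t$ with every entry $x$ replaced by $\mathrm{sign}(x)\min(|x|,\tau)$,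 and let $\widehat{\mathbf\Lambda}_k(\tau)=\sqrt{p_k}\,[\widehat{\mathbf e}_1,\dots,\widehat{\mathbf e}_{r_k}]$, where $\widehat{\mathbf e}_1,\widehat{\mathbf e}_2,\dots$ are orthonormal eigenvectors (any choice) of $(np_{-k})^{-1}\sum_{t\le n}\mathsf{mat}_k(\mathcal X^\tau_t)\mathsf{mat}_k(\mathcal X^\tau_t)^\top$ in decreasing order of the eigenvalues. Then there are random matrices $\widehat{\mathbf H}_k\in\mathbb R^{r_k\times r_k}$ (measurable whenever $\widehat{\mathbf\Lambda}_k(\tau)$ is) with $\widehat{\mathbf H}_k^\top\widehat{\mathbf H}_k=\mathbf I_{r_k}+o_P(1)$ entrywise, such that as $\min(n,p_1,\dots,p_K)\to\infty$ $$\frac1{\sqrt{p_k}}\big\|\widehat{\mathbf\Lambda}_k(\tau)-\mathbf\Lambda_k\widehat{\mathbf H}_k\big\|=\begin{cases}O_P\Big(\dfrac{M_n^{1-\epsilon}}{\sqrt{np_{-k}}}\vee\dfrac1{p_k}\vee\dfrac{\psi^{(k)}_{n,p}}{\sqrt{p_k}}\Big)&\text{in setting (I)},\\[2mm]O_P\Big(\psi^{(k)}_{n,p}\vee\dfrac1{p_k}\Big)&\text{in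 setting (II)}.\end{cases}$$ -/

import Mathlib

open MeasureTheory ProbabilityTheory Filter Topology Asymptotics

namespace TensorFactor

noncomputable section

/-! ### Tensors -/

/-- Real tensors of order `K` with dimensions `d 0, …, d (K - 1)`. -/
abbrev Tensor {K : ℕ} (d : Fin K → ℕ) : Type := (∀ k, Fin (d k)) → ℝ

/-- The mode-`k` unfolding: rows are indexed by the `k`-th index, columns (the mode-`k` fibres) by
the tuple of the remaining indices. Only `mat k X * (mat k X)ᵀ` is ever used, and it does not depend
on how the columns are enumerated. -/
def mat {K : ℕ} {d : Fin K → ℕ} (k : Fin K) (X : Tensor d) :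
    Matrix (Fin (d k)) (∀ j : {j : Fin K // j ≠ k}, Fin (d j)) ℝ :=
  Matrix.of fun i c => X ((Equiv.piSplitAt k fun j => Fin (d j)).symm (i, c))

/-- The Tucker product `F ×₁ Λ₁ ×₂ … ×_K Λ_K`. -/
def tucker {K : ℕ} {r p : Fin K → ℕ} (F : Tensor r)
    (Λ : ∀ k, Matrix (Fin (p k)) (Fin (r k)) ℝ) : Tensor p :=
  fun i => ∑ j : (∀ k, Fin (r k)), F j * ∏ k, Λ k (i k) (j k)

/-- The Euclidean norm of a tensor. -/
def tnorm {K : ℕ} {d : Fin K → ℕ} (X : Tensor d) : ℝ := √(∑ i, X i ^ 2)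

/-- `p = ∏ p_k`. -/
def dimAll {K : ℕ} (p : Fin K → ℕ) : ℕ := ∏ j, p j

/-- `p_{-k} = ∏_{j ≠ k} p_j`. -/
def dimExcept {K : ℕ} (p : Fin K → ℕ) (k : Fin K) : ℕ := ∏ j ∈ Finset.univ.erase k, p j

/-- The position in `ℕ^K` of an entry of a `p_1 × ⋯ × p_K` tensor. -/
def pos {K : ℕ} {p : Fin K → ℕ} (i : ∀ k, Fin (p k)) : Fin K → ℕ := fun k => (i k : ℕ)

/-- The spectral norm of a real matrix. -/
def specNorm {m n : ℕ} (A : Matrix (Fin m) (Fin n) ℝ) : ℝ :=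
  ‖LinearMap.toContinuousLinearMap (Matrix.toEuclideanLin A)‖

/-! ### Data, truncation and the estimator -/

/-- Truncation of a number at level `τ`. -/
def trunc (τ x : ℝ) : ℝ := (SignType.sign x : ℝ) * min |x| τ

/-- The observation `X_t = F_t ×₁ Λ₁ ⋯ ×_K Λ_K + ξ_t`, where `Ft = F_t` and `ξt = ξ_{·, t}`. -/
def obs {K : ℕ} {r p : Fin K → ℕ} (Ft : Tensor r) (Λ : ∀ k, Matrix (Fin (p k)) (Fin (r k)) ℝ)
    (ξt : (Fin K → ℕ) → ℝ) : Tensor p :=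
  fun i => tucker Ft Λ i + ξt (pos i)

/-- The mode-`k` sample second moment matrix
`(n p_{-k})⁻¹ ∑_{t ≤ n} mat_k(X_t^τ) mat_k(X_t^τ)ᵀ` of the data `X` truncated at `τ`. -/
def truncGram {K : ℕ} {p : Fin K → ℕ} (n : ℕ) (X : ℕ → Tensor p) (τ : ℝ) (k : Fin K) :
    Matrix (Fin (p k)) (Fin (p k)) ℝ :=
  ((n : ℝ) * dimExcept p k)⁻¹ • ∑ t ∈ Finset.Icc 1 n,
    mat k (fun i => trunc τ (X t i)) * (mat k (fun i => trunc τ (X t i))).transpose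

/-- `Λhat = √m [e_1, …, e_s]`, where `e_1, …, e_m` is an orthonormal basis of eigenvectors of the
symmetric matrix `Γ`, ordered by decreasing eigenvalue. -/
def IsPCLoading {m s : ℕ} (Γ : Matrix (Fin m) (Fin m) ℝ) (Λhat : Matrix (Fin m) (Fin s) ℝ) : Prop :=
  ∃ (E : Matrix (Fin m) (Fin m) ℝ) (μ : Fin m → ℝ),
    E.transpose * E = 1 ∧ Antitone μ ∧ Γ * E = E * Matrix.diagonal μ ∧
    ∀ (i : Fin m) (j : Fin s) (h : (j : ℕ) < m), Λhat i j = √(m : ℝ) * E i ⟨j, h⟩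

/-- `n⁻¹ ∑_{t ≤ n} mat_k(F_t) mat_k(F_t)ᵀ`. -/
def factorGram {K : ℕ} {r : Fin K → ℕ} (n : ℕ) (F : ℕ → Tensor r) (k : Fin K) :
    Matrix (Fin (r k)) (Fin (r k)) ℝ :=
  (n : ℝ)⁻¹ • ∑ t ∈ Finset.Icc 1 n, mat k (F t) * (mat k (F t)).transpose

/-! ### Strong mixing -/

/-- The `α`-mixing coefficient of two `σ`-algebras. -/
def alphaMix {Ω : Type*} [MeasurableSpace Ω] (P : Measure Ω) (𝒜 ℬ : MeasurableSpace Ω) : ℝ :=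
  sSup {x : ℝ | ∃ A B : Set Ω, MeasurableSet[𝒜] A ∧ MeasurableSet[ℬ] B ∧
    x = |P.real (A ∩ B) - P.real A * P.real B|}

/-- The strong mixing coefficient `α(m)` of a time series. -/
def seriesAlpha {Ω : Type*} [MeasurableSpace Ω] (P : Measure Ω) (Y : ℤ → Ω → ℝ) (m : ℕ) : ℝ :=
  ⨆ t : ℤ, alphaMix P
    (⨆ u : {u : ℤ // u ≤ t}, MeasurableSpace.comap (Y u) inferInstance)
    (⨆ v : {v : ℤ // t + m ≤ v}, MeasurableSpace.comap (Y v) inferInstance)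

/-- The maximum distance on `ℕ^K × ℤ`. -/
def siteDist {K : ℕ} (a b : (Fin K → ℕ) × ℤ) : ℕ :=
  max (Finset.univ.sup fun k => ((a.1 k : ℤ) - (b.1 k : ℤ)).natAbs) (a.2 - b.2).natAbs

/-- The distance between two sets of sites (`⊤` if one of them is empty). -/
def setDist {K : ℕ} (E₁ E₂ : Set ((Fin K → ℕ) × ℤ)) : ℕ∞ :=
  ⨅ a ∈ E₁, ⨅ b ∈ E₂, (siteDist a b : ℕ∞)

/-- The `σ`-algebra generated by a random field on a set of sites. -/
abbrev fieldSigma {Ω : Type*} {K : ℕ} (ξ : (Fin K → ℕ) → ℤ → Ω → ℝ) (E : Set ((Fin K → ℕ) × ℤ)) :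
    MeasurableSpace Ω :=
  ⨆ a : E, MeasurableSpace.comap (ξ a.1.1 a.1.2) inferInstance

/-- The strong mixing coefficient `α(m, ℓ₁, ℓ₂)` of a random field on `ℕ^K × ℤ`. -/
def fieldAlpha {Ω : Type*} [MeasurableSpace Ω] (P : Measure Ω) {K : ℕ}
    (ξ : (Fin K → ℕ) → ℤ → Ω → ℝ) (m : ℕ) (ℓ₁ ℓ₂ : ℕ∞) : ℝ :=
  sSup {x : ℝ | ∃ E₁ E₂ : Set ((Fin K → ℕ) × ℤ), E₁.encard ≤ ℓ₁ ∧ E₂.encard ≤ ℓ₂ ∧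
    (m : ℕ∞) ≤ setDist E₁ E₂ ∧ x = alphaMix P (fieldSigma ξ E₁) (fieldSigma ξ E₂)}

/-! ### Assumptions

A family of models is indexed by `ν : ι`: sample size `n ν`, dimensions `p ν`, loadings `Λ ν`,
factors `F ν t` for `1 ≤ t ≤ n ν` and noise `ξ ν i t`. The factor numbers `r`, and all constants,
do not depend on `ν`. -/

/-- Conditions on the loadings. -/
structure LoadingAssumption {K : ℕ} {ι : Type*} {r : Fin K → ℕ} {p : ι → Fin K → ℕ}
    (Λ : ∀ ν k, Matrix (Fin (p ν k)) (Fin (r k)) ℝ) : Prop where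
  orthonormal : ∀ ν k, (p ν k : ℝ)⁻¹ • ((Λ ν k).transpose * Λ ν k) = 1
  bounded : ∃ lam : ℝ, ∀ ν k i j, |Λ ν k i j| ≤ lam

/-- Conditions on the factors: the second moment matrices are diagonal, with diagonal entries in
fixed, disjoint, decreasing intervals `[a k j, b k j]` of positive numbers. -/
def FactorAssumption {K : ℕ} {ι : Type*} {r : Fin K → ℕ} (n : ι → ℕ)
    (F : ι → ℕ → Tensor r) : Prop :=
  ∃ a b : ∀ k, Fin (r k) → ℝ,
    (∀ k j, 0 < a k j) ∧ (∀ k j j', j < j' → b k j' < a k j) ∧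
    ∀ ν k, (factorGram (n ν) (F ν) k).IsDiag ∧
      ∀ j, a k j ≤ factorGram (n ν) (F ν) k j j ∧ factorGram (n ν) (F ν) k j j ≤ b k j

/-- The noise is a centred, measurable random field. -/
structure NoiseAssumption {Ω : Type*} [MeasurableSpace Ω] (P : Measure Ω) {K : ℕ} {ι : Type*}
    (p : ι → Fin K → ℕ) (ξ : ι → (Fin K → ℕ) → ℤ → Ω → ℝ) : Prop where
  measurable : ∀ ν i t, Measurable (ξ ν i t)
  centred : ∀ ν (i : ∀ k, Fin (p ν k)) t, ∫ ω, ξ ν (pos i) t ω ∂P = 0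

/-- Conditions on the tails of the noise and on the size of the factors. -/
structure TailAssumption {Ω : Type*} [MeasurableSpace Ω] (P : Measure Ω) {K : ℕ} {ι : Type*}
    {r : Fin K → ℕ} (n : ι → ℕ) (p : ι → Fin K → ℕ) (F : ι → ℕ → Tensor r)
    (ξ : ι → (Fin K → ℕ) → ℤ → Ω → ℝ) (ε w : ℝ) (M : ι → ℝ) : Prop where
  eps_pos : 0 < ε
  eps_lt_one : ε < 1
  w_pos : 0 < w
  noise : ∀ ν (i : ∀ k, Fin (p ν k)) t,
    eLpNorm (ξ ν (pos i) t) (ENNReal.ofReal (2 + 2 * ε)) P ≤ ENNReal.ofReal w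
  factor : ∀ ν, ∀ s ∈ ({1 + ε, 2, 2 + 2 * ε} : Set ℝ),
    (n ν : ℝ)⁻¹ * ∑ t ∈ Finset.Icc 1 (n ν), tnorm (F ν t) ^ s ≤ w ^ s
  M_pos : ∀ ν, 0 < M ν
  w_le_M : ∀ ν, w ≤ M ν
  factor_le_M : ∀ ν, ∀ t ∈ Finset.Icc 1 (n ν), tnorm (F ν t) ≤ M ν

/-- `n⁻¹ ∑_{t, u ≤ n} |F_t|^{1+ε} |F_u|^{1+ε} exp(-c |t - u|)`. -/
def factorDep {K : ℕ} {r : Fin K → ℕ} (n : ℕ) (F : ℕ → Tensor r) (ε c : ℝ) : ℝ :=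
  (n : ℝ)⁻¹ * ∑ t ∈ Finset.Icc 1 n, ∑ u ∈ Finset.Icc 1 n,
    tnorm (F t) ^ (1 + ε) * tnorm (F u) ^ (1 + ε) * Real.exp (-(c * |(t : ℝ) - (u : ℝ)|))

/-- Cross-sectional independence with exponentially `α`-mixing time series. -/
def IndepAssumption {Ω : Type*} [MeasurableSpace Ω] (P : Measure Ω) {K : ℕ} {ι : Type*}
    {r : Fin K → ℕ} (n : ι → ℕ) (p : ι → Fin K → ℕ) (F : ι → ℕ → Tensor r)
    (ξ : ι → (Fin K → ℕ) → ℤ → Ω → ℝ) (ε w : ℝ) : Prop :=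
  ∃ c₀ cε : ℝ, 0 < c₀ ∧ 0 < cε ∧ ∀ ν,
    iIndepFun (fun (i : ∀ k, Fin (p ν k)) (ω : Ω) (t : ℤ) => ξ ν (pos i) t ω) P ∧
    (∀ (i : ∀ k, Fin (p ν k)) (m : ℕ), seriesAlpha P (ξ ν (pos i)) m ≤ Real.exp (-(c₀ * m))) ∧
    ∀ k : Fin K,
      factorDep (n ν) (F ν) ε (c₀ * ε / (1 + ε)) ≤ w ^ (2 + 2 * ε) * cε ∧
      factorDep (n ν) (F ν) ε (c₀ / (3 * Real.log ((n ν : ℝ) * dimExcept (p ν) k))) ≤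
        w ^ (2 + 2 * ε) * cε * Real.log ((n ν : ℝ) * dimExcept (p ν) k)

/-- Exponentially `α`-mixing random field. -/
def FieldAssumption {Ω : Type*} [MeasurableSpace Ω] (P : Measure Ω) {K : ℕ} {ι : Type*}
    {r : Fin K → ℕ} (n : ι → ℕ) (p : ι → Fin K → ℕ) (F : ι → ℕ → Tensor r)
    (ξ : ι → (Fin K → ℕ) → ℤ → Ω → ℝ) (ε w : ℝ) : Prop :=
  ∃ c₀ cε : ℝ, 0 < c₀ ∧ 0 < cε ∧ ∀ ν,
    (∀ m : ℕ, fieldAlpha P (ξ ν) m ⊤ ⊤ ≤ Real.exp (-(c₀ * m))) ∧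
    factorDep (n ν) (F ν) ε (c₀ * ε / (K * (1 + ε))) ≤ w ^ (2 + 2 * ε) * cε * K ∧
    factorDep (n ν) (F ν) ε (c₀ / (3 * K * Real.log ((n ν : ℝ) * dimAll (p ν)))) ≤
      w ^ (2 + 2 * ε) * cε * K * Real.log ((n ν : ℝ) * dimAll (p ν))

/-! ### Truncation levels and rates -/

/-- Truncation level under cross-sectional independence. -/
def tauIndep {K : ℕ} (n : ℕ) (p : Fin K → ℕ) (ε w : ℝ) (k : Fin K) : ℝ :=
  w * (((n : ℝ) * dimExcept p k) / Real.log ((n : ℝ) * dimExcept p k)) ^ (1 / (2 + 2 * ε))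

/-- Truncation level for mixing random fields. -/
def tauField {K : ℕ} (n : ℕ) (p : Fin K → ℕ) (ε w : ℝ) (k : Fin K) : ℝ :=
  w * (((n : ℝ) * dimExcept p k) / Real.log ((n : ℝ) * dimAll p) ^ K) ^ (1 / (2 + 2 * ε))

/-- `ψ` under cross-sectional independence. -/
def psiIndep {K : ℕ} (n : ℕ) (p : Fin K → ℕ) (ε w : ℝ) (k : Fin K) : ℝ :=
  w ^ 2 * (Real.log ((n : ℝ) * dimExcept p k) / ((n : ℝ) * dimExcept p k)) ^ (ε / (1 + ε))

/-- `ψ` for mixing random fields. -/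
def psiField {K : ℕ} (n : ℕ) (p : Fin K → ℕ) (ε w : ℝ) (k : Fin K) : ℝ :=
  w ^ 2 * (Real.log ((n : ℝ) * dimAll p) ^ K / ((n : ℝ) * dimExcept p k)) ^ (ε / (1 + ε))

/-- `M max_k (τ^{(k)})⁻¹ log^{1/(2ε)}(n p_{-k}) = o(1)`, for given levels `τlev ν k`. -/
def GrowthCondition {K : ℕ} {ι : Type*} (l : Filter ι) (n : ι → ℕ) (p : ι → Fin K → ℕ) (ε : ℝ)
    (M : ι → ℝ) (τlev : ι → Fin K → ℝ) : Prop :=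
  Tendsto (fun ν => M ν * ⨆ k : Fin K,
    (τlev ν k)⁻¹ * Real.log ((n ν : ℝ) * dimExcept (p ν) k) ^ (1 / (2 * ε))) l (𝓝 0)

/-- `Z = O_P(a)` along `l`. For events that are not measurable, `P` is the outer measure. -/
def IsBigOP {Ω : Type*} [MeasurableSpace Ω] (P : Measure Ω) {ι : Type*} (l : Filter ι)
    (Z : ι → Ω → ℝ) (a : ι → ℝ) : Prop :=
  ∀ δ : ℝ, 0 < δ → ∃ C : ℝ, 0 < C ∧
    ∀ᶠ ν in l, P {ω | C * a ν < |Z ν ω|} ≤ ENNReal.ofReal δ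

end

end TensorFactor

open TensorFactor

namespace TensorFactor

/-! Let χ be the common component, e = trunc_τ(χ + ξ) - χ, and N = n p_{-k}. Because all loading
matrices have orthogonal columns of squared length p_j, the truncated second moment matrix is
exactly Λ_k G Λ_kᵀ + R, where G is the factor second moment matrix and R averages eχ + χe + ee over
the N columns (`truncGram_obs_eq`).

The algebraic part takes H = p_k⁻¹ Λ_kᵀ Λhat, so that Z = Λhat - Λ_k H is the component of Λhat
orthogonal to the columns of Λ_k. Writing Λhat x as Γ applied to a vector of length O(p_k^{-1/2}
|x|), which needs only a lower bound on the leading eigenvalues, the signal part of Γ is annihilated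
by pairing with Zx and only R survives. Hence p_k^{-1/2} ‖Z‖ ≤ (2/a) ρ whenever the form R is
bounded by p_k ρ, and HᵀH = 1 - p_k⁻¹ ZᵀZ is close to the identity (`pcLoading_error`).

The probabilistic part bounds R. The growth condition forces |χ| ≤ τ/2 eventually. Then |e| ≤ |ξ|
and |e| ≤ 2τ, the fourth moment of e is at most U, of order τ^{2-2ε}, and the bias of e is of order
τ^{-(1+2ε)} (`truncErr_moments`). R is split into the mean of the ee term, a deterministic matrix
controlled by its row sums, and a remainder controlled in mean square through its Frobenius norm
(`exists_bilinBound_perturbation`). The bounded part of the row sums yields the rate 1/p_k, and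
Markov's inequality treats the remainder.

The variances rest on three covariance inequalities under strong mixing: for bounded variables, for
variables with 2 + 2ε moments, and for products. A covariance of products is at most U up to a lag
of order log N and decays exponentially afterwards. Summed over a K-dimensional box of columns and
times, this gives variance of order U log^K(np) / N for each entry, which is of order ψ² for the
stated τ (`exists_bilinBound_field`). Under cross-sectional independence only the time direction
contributes. The p_k diagonal entries have variance of order U log N / N, while an off-diagonal
covariance factorises into covariances of single errors and the entry has variance O(1/N). Averaging
over p_k² entries produces ψ/√p_k and 1/√N (`exists_bilinBound_indep`). -/

/-! ### Bilinear form bounds and perturbation of principal component loadings. -/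

theorem dotProduct_self_real_nonneg {m : ℕ} (x : Fin m → ℝ) : 0 ≤ x ⬝ᵥ x :=
  Finset.sum_nonneg fun _ _ => mul_self_nonneg _

/-- The bilinear form of `R` is bounded by `ρ`. -/
def BilinBound {m : ℕ} (R : Matrix (Fin m) (Fin m) ℝ) (ρ : ℝ) : Prop :=
  ∀ x y : Fin m → ℝ, |x ⬝ᵥ R.mulVec y| ≤ ρ * (√(x ⬝ᵥ x) * √(y ⬝ᵥ y))

theorem BilinBound.add {m : ℕ} {R S : Matrix (Fin m) (Fin m) ℝ} {ρ σ : ℝ}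
    (hR : BilinBound R ρ) (hS : BilinBound S σ) : BilinBound (R + S) (ρ + σ) := by
  intro x y
  rw [Matrix.add_mulVec, dotProduct_add, add_mul]
  exact (abs_add_le _ _).trans (add_le_add (hR x y) (hS x y))

theorem BilinBound.mono {m : ℕ} {R : Matrix (Fin m) (Fin m) ℝ} {ρ σ : ℝ}
    (hR : BilinBound R ρ) (h : ρ ≤ σ) : BilinBound R σ := fun x y =>
  (hR x y).trans (mul_le_mul_of_nonneg_right h (by positivity))

theorem dotProduct_mulVec_eq_sum_prod {m : ℕ} (R : Matrix (Fin m) (Fin m) ℝ) (x y : Fin m → ℝ) :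
    x ⬝ᵥ R.mulVec y = ∑ z : Fin m × Fin m, R z.1 z.2 * (x z.1 * y z.2) := by
  rw [Fintype.sum_prod_type]
  simp only [dotProduct, Matrix.mulVec, Finset.mul_sum]
  exact Finset.sum_congr rfl fun i _ => Finset.sum_congr rfl fun j _ => by ring

/-- The Frobenius norm dominates the spectral norm, by Cauchy–Schwarz over pairs of indices. This
serves the random part of the perturbation, whose entries are controlled in mean square. -/
theorem bilinBound_of_sum_sq {m : ℕ} (R : Matrix (Fin m) (Fin m) ℝ) :
    BilinBound R (√(∑ i, ∑ j, R i j ^ 2)) := by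
  intro x y
  rw [dotProduct_mulVec_eq_sum_prod]
  have h := Finset.sum_mul_sq_le_sq_mul_sq Finset.univ
    (fun z : Fin m × Fin m => R z.1 z.2) (fun z => x z.1 * y z.2)
  have h2 : ∑ z : Fin m × Fin m, (x z.1 * y z.2) ^ 2 = (x ⬝ᵥ x) * (y ⬝ᵥ y) := by
    rw [Fintype.sum_prod_type]
    simp only [dotProduct, Finset.sum_mul_sum]
    exact Finset.sum_congr rfl fun i _ => Finset.sum_congr rfl fun j _ => by ring
  have h3 : ∑ z : Fin m × Fin m, R z.1 z.2 ^ 2 = ∑ i, ∑ j, R i j ^ 2 := by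
    rw [Fintype.sum_prod_type]
  rw [h2, h3] at h
  have h4 := Real.abs_le_sqrt h
  rw [Real.sqrt_mul (by positivity), Real.sqrt_mul (dotProduct_self_real_nonneg _)] at h4
  exact h4

/-- Schur's test: write |R i j| as √|R i j| · √|R i j|, attach one factor to x and the other to y,
and apply Cauchy–Schwarz. This serves the deterministic mean matrix, for which the Frobenius norm
would cost a factor of the square root of the dimension. -/
theorem bilinBound_of_row_col_sums {m : ℕ} (R : Matrix (Fin m) (Fin m) ℝ) {C : ℝ} (hC : 0 ≤ C)
    (hrow : ∀ i, ∑ j, |R i j| ≤ C) (hcol : ∀ j, ∑ i, |R i j| ≤ C) : BilinBound R C := by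
  intro x y
  rw [dotProduct_mulVec_eq_sum_prod]
  have h := Finset.sum_mul_sq_le_sq_mul_sq Finset.univ
    (fun z : Fin m × Fin m => √|R z.1 z.2| * |x z.1|) (fun z => √|R z.1 z.2| * |y z.2|)
  have e1 : ∑ z : Fin m × Fin m, (√|R z.1 z.2| * |x z.1|) ^ 2 ≤ C * (x ⬝ᵥ x) := by
    rw [Fintype.sum_prod_type, dotProduct, Finset.mul_sum]
    refine Finset.sum_le_sum fun i _ => ?_
    calc ∑ j, (√|R i j| * |x i|) ^ 2 = (∑ j, |R i j|) * (x i * x i) := by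
          rw [Finset.sum_mul]
          refine Finset.sum_congr rfl fun j _ => ?_
          rw [mul_pow, Real.sq_sqrt (abs_nonneg _), sq_abs, sq]
      _ ≤ C * (x i * x i) := mul_le_mul_of_nonneg_right (hrow i) (mul_self_nonneg _)
  have e2 : ∑ z : Fin m × Fin m, (√|R z.1 z.2| * |y z.2|) ^ 2 ≤ C * (y ⬝ᵥ y) := by
    rw [Fintype.sum_prod_type_right, dotProduct, Finset.mul_sum]
    refine Finset.sum_le_sum fun j _ => ?_
    calc ∑ i, (√|R i j| * |y j|) ^ 2 = (∑ i, |R i j|) * (y j * y j) := by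
          rw [Finset.sum_mul]
          refine Finset.sum_congr rfl fun i _ => ?_
          rw [mul_pow, Real.sq_sqrt (abs_nonneg _), sq_abs, sq]
      _ ≤ C * (y j * y j) := mul_le_mul_of_nonneg_right (hcol j) (mul_self_nonneg _)
  have e3 : |∑ z : Fin m × Fin m, R z.1 z.2 * (x z.1 * y z.2)| ≤
      ∑ z : Fin m × Fin m, √|R z.1 z.2| * |x z.1| * (√|R z.1 z.2| * |y z.2|) := by
    refine (Finset.abs_sum_le_sum_abs _ _).trans (Finset.sum_le_sum fun z _ => ?_)
    refine le_of_eq ?_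
    rw [abs_mul, abs_mul, mul_mul_mul_comm, Real.mul_self_sqrt (abs_nonneg (R z.1 z.2))]
  refine e3.trans ?_
  have h5 := Real.le_sqrt_of_sq_le (h.trans (mul_le_mul e1 e2 (by positivity)
    (mul_nonneg hC (dotProduct_self_real_nonneg _))))
  refine h5.trans (le_of_eq ?_)
  have : C * (x ⬝ᵥ x) * (C * (y ⬝ᵥ y)) = C ^ 2 * ((x ⬝ᵥ x) * (y ⬝ᵥ y)) := by ring
  rw [this, Real.sqrt_mul (by positivity), Real.sqrt_sq hC,
    Real.sqrt_mul (dotProduct_self_real_nonneg _)]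

theorem mulVec_dotProduct_mulVec_self {m s : ℕ} (A : Matrix (Fin m) (Fin s) ℝ) {c : ℝ}
    (hA : A.transpose * A = c • (1 : Matrix (Fin s) (Fin s) ℝ)) (x : Fin s → ℝ) :
    A.mulVec x ⬝ᵥ A.mulVec x = c * (x ⬝ᵥ x) := by
  rw [Matrix.dotProduct_mulVec, ← Matrix.mulVec_transpose, Matrix.mulVec_mulVec, hA,
    Matrix.smul_mulVec, Matrix.one_mulVec, smul_dotProduct, smul_eq_mul]

theorem abs_dotProduct_le_sqrt {m : ℕ} (x y : Fin m → ℝ) :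
    |x ⬝ᵥ y| ≤ √(x ⬝ᵥ x) * √(y ⬝ᵥ y) := by
  have h := Finset.sum_mul_sq_le_sq_mul_sq Finset.univ x y
  rw [← Real.sqrt_mul (dotProduct_self_real_nonneg _)]
  refine Real.abs_le_sqrt (h.trans (le_of_eq ?_))
  simp [dotProduct, sq]

/-- Min-max argument: the s-dimensional column space of Λ contains a vector orthogonal to the j < s
eigenvectors preceding the given one. On it the form Γ is at most the eigenvalue, and at least the
signal minus the perturbation. -/
theorem eigenvalue_lower_bound {q s : ℕ} (hs : s ≤ q) {Γ R E : Matrix (Fin q) (Fin q) ℝ}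
    {Λ : Matrix (Fin q) (Fin s) ℝ} {G : Matrix (Fin s) (Fin s) ℝ} {μ : Fin q → ℝ} {a ρ : ℝ}
    (hq : 0 < q)
    (hΛ : Λ.transpose * Λ = (q : ℝ) • (1 : Matrix (Fin s) (Fin s) ℝ))
    (hG : G.IsDiag) (ha : ∀ j, a ≤ G j j) (hΓ : Γ = Λ * G * Λ.transpose + R)
    (hR : BilinBound R (q * ρ)) (hE : E.transpose * E = 1) (hμ : Antitone μ)
    (hΓE : Γ * E = E * Matrix.diagonal μ) (j : Fin s) :
    q * (a - ρ) ≤ μ (Fin.castLE hs j) := by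
  have hq' : (0 : ℝ) < q := by exact_mod_cast hq
  have hE' : E * E.transpose = 1 := mul_eq_one_comm.mp hE
  obtain ⟨x, hx0, hx⟩ : ∃ x : Fin s → ℝ, x ≠ 0 ∧ ∀ i : Fin q, (i : ℕ) < j →
      (E.transpose.mulVec (Λ.mulVec x)) i = 0 := by
    -- Coefficients of Λx along the eigenvectors before j. Since j < s the map has a nontrivial
    -- kernel.
    let L : (Fin s → ℝ) →ₗ[ℝ] (Fin (j : ℕ) → ℝ) :=
      (LinearMap.funLeft ℝ ℝ (Fin.castLE (j.2.le.trans hs))).comp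
        (Matrix.toLin' (E.transpose * Λ))
    have hL : LinearMap.ker L ≠ ⊥ := LinearMap.ker_ne_bot_of_finrank_lt (by simp)
    obtain ⟨x, hxk, hx0⟩ := (Submodule.ne_bot_iff _).mp hL
    refine ⟨x, hx0, fun i hi => ?_⟩
    have := congrFun (LinearMap.mem_ker.mp hxk) ⟨i, hi⟩
    simpa [L, LinearMap.funLeft_apply, ← Matrix.mulVec_mulVec] using this
  set v := Λ.mulVec x with hv
  set c := E.transpose.mulVec v with hc
  have hxx : 0 < x ⬝ᵥ x := by
    rcases (dotProduct_self_real_nonneg x).lt_or_eq with h | h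
    · exact h
    · exact absurd (dotProduct_self_eq_zero.mp h.symm) hx0
  have hvv : v ⬝ᵥ v = q * (x ⬝ᵥ x) := mulVec_dotProduct_mulVec_self Λ hΛ x
  have hvpos : 0 < v ⬝ᵥ v := by rw [hvv]; positivity
  have hcc : c ⬝ᵥ c = v ⬝ᵥ v := by
    rw [hc, mulVec_dotProduct_mulVec_self (c := 1), one_mul]
    simpa using hE'
  have hΓ' : Γ = E * Matrix.diagonal μ * E.transpose := by
    rw [← hΓE, Matrix.mul_assoc, hE', Matrix.mul_one]
  have hup : v ⬝ᵥ Γ.mulVec v ≤ μ (Fin.castLE hs j) * (v ⬝ᵥ v) := by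
    have : v ⬝ᵥ Γ.mulVec v = ∑ i, μ i * (c i * c i) := by
      rw [hΓ', ← Matrix.mulVec_mulVec, ← Matrix.mulVec_mulVec, Matrix.dotProduct_mulVec,
        ← Matrix.mulVec_transpose, ← hc]
      simp only [dotProduct, Matrix.mulVec_diagonal]
      exact Finset.sum_congr rfl fun i _ => by ring
    rw [this, ← hcc, dotProduct, Finset.mul_sum]
    refine Finset.sum_le_sum fun i _ => ?_
    by_cases hi : (i : ℕ) < j
    · rw [hx i hi]; simp
    · exact mul_le_mul_of_nonneg_right (hμ (by
        rw [Fin.le_def]; simpa using hi)) (mul_self_nonneg _)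
  have hΛv : Λ.transpose.mulVec v = (q : ℝ) • x := by
    rw [hv, Matrix.mulVec_mulVec, hΛ, Matrix.smul_mulVec, Matrix.one_mulVec]
  have hlow : q ^ 2 * (a * (x ⬝ᵥ x)) - q * ρ * (v ⬝ᵥ v) ≤ v ⬝ᵥ Γ.mulVec v := by
    rw [hΓ, Matrix.add_mulVec, dotProduct_add]
    have h1 := (abs_le.mp (hR v v)).1
    rw [Real.mul_self_sqrt (dotProduct_self_real_nonneg _)] at h1
    have h2 : v ⬝ᵥ (Λ * G * Λ.transpose).mulVec v = q ^ 2 * ∑ i, G i i * (x i * x i) := by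
      rw [← Matrix.mulVec_mulVec, ← Matrix.mulVec_mulVec, Matrix.dotProduct_mulVec,
        ← Matrix.mulVec_transpose, hΛv, Matrix.mulVec_smul, smul_dotProduct, dotProduct_smul]
      have : G = Matrix.diagonal (fun i => G i i) := hG.diagonal_diag.symm
      rw [this]
      simp only [dotProduct, Matrix.mulVec_diagonal, Matrix.diagonal_apply_eq, smul_eq_mul]
      rw [← mul_assoc, sq]
      congr 1
      exact Finset.sum_congr rfl fun i _ => by ring
    have h3 : a * (x ⬝ᵥ x) ≤ ∑ i, G i i * (x i * x i) := by
      rw [dotProduct, Finset.mul_sum]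
      exact Finset.sum_le_sum fun i _ => mul_le_mul_of_nonneg_right (ha i) (mul_self_nonneg _)
    rw [h2]
    have := mul_le_mul_of_nonneg_left h3 (sq_nonneg (q : ℝ))
    linarith
  have : q * (a - ρ) * (v ⬝ᵥ v) ≤ μ (Fin.castLE hs j) * (v ⬝ᵥ v) := by
    refine le_trans (le_of_eq ?_) (hlow.trans hup)
    rw [hvv]; ring
  exact le_of_mul_le_mul_right this hvpos

/-- The vector z is the component of Λhat x orthogonal to the columns of Λ. The first bound is that
of a projection. For the second, Λhat x lies in the range of Γ on the leading eigenvectors, and the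
pairing of z with Γ sees only R. -/
theorem pcLoading_residual_bound {q s : ℕ} (hs : s ≤ q) {Γ R : Matrix (Fin q) (Fin q) ℝ}
    {Λ Λhat : Matrix (Fin q) (Fin s) ℝ} {G : Matrix (Fin s) (Fin s) ℝ} {a ρ : ℝ}
    (hq : 0 < q) (hρ : 0 ≤ ρ) (ha0 : 0 < a)
    (hΛ : Λ.transpose * Λ = (q : ℝ) • (1 : Matrix (Fin s) (Fin s) ℝ))
    (hG : G.IsDiag) (ha : ∀ j, a ≤ G j j) (hΓ : Γ = Λ * G * Λ.transpose + R)
    (hR : BilinBound R (q * ρ)) (hhat : IsPCLoading Γ Λhat) :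
    Λhat.transpose * Λhat = (q : ℝ) • (1 : Matrix (Fin s) (Fin s) ℝ) ∧
    ∀ x : Fin s → ℝ,
      let z := (Λhat - Λ * ((q : ℝ)⁻¹ • (Λ.transpose * Λhat))).mulVec x
      √(z ⬝ᵥ z) ≤ √q * √(x ⬝ᵥ x) ∧ √(z ⬝ᵥ z) ≤ √q * (2 / a * ρ) * √(x ⬝ᵥ x) := by
  have hq' : (0 : ℝ) < q := by exact_mod_cast hq
  obtain ⟨E, μ, hE, hμ, hΓE, hEΛ⟩ := hhat
  set E0 : Matrix (Fin q) (Fin s) ℝ := E.submatrix id (Fin.castLE hs) with hE0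
  have hhatE : Λhat = √(q : ℝ) • E0 := by
    ext i j
    simp only [hE0, Matrix.smul_apply, Matrix.submatrix_apply, id, smul_eq_mul]
    exact hEΛ i j (j.2.trans_le hs)
  have hE0E0 : E0.transpose * E0 = 1 := by
    ext i j
    have := congrFun (congrFun hE (Fin.castLE hs i)) (Fin.castLE hs j)
    simp only [Matrix.mul_apply, Matrix.transpose_apply, Matrix.one_apply, hE0,
      Matrix.submatrix_apply, id] at this ⊢
    rw [this]
    simp
  have hΓE0 : Γ * E0 = E0 * Matrix.diagonal (fun j => μ (Fin.castLE hs j)) := by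
    ext i j
    have := congrFun (congrFun hΓE i) (Fin.castLE hs j)
    rw [Matrix.mul_diagonal] at this ⊢
    simpa [Matrix.mul_apply, hE0] using this
  have hhat2 : Λhat.transpose * Λhat = (q : ℝ) • (1 : Matrix (Fin s) (Fin s) ℝ) := by
    rw [hhatE, Matrix.transpose_smul, Matrix.smul_mul, Matrix.mul_smul, hE0E0, smul_smul,
      Real.mul_self_sqrt hq'.le]
  refine ⟨hhat2, fun x => ?_⟩
  intro z
  have hΛz : Λ.transpose.mulVec z = 0 := by
    simp only [z]
    rw [Matrix.mulVec_mulVec, Matrix.mul_sub, ← Matrix.mul_assoc, hΛ, Matrix.smul_mul,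
      Matrix.one_mul, smul_smul, mul_inv_cancel₀ hq'.ne', one_smul, sub_self, Matrix.zero_mulVec]
  have hzΛ : ∀ y, z ⬝ᵥ Λ.mulVec y = 0 := fun y => by
    rw [Matrix.dotProduct_mulVec, ← Matrix.mulVec_transpose, hΛz, zero_dotProduct]
  have hzz : z ⬝ᵥ z = z ⬝ᵥ Λhat.mulVec x := by
    have : z = Λhat.mulVec x - Λ.mulVec (((q : ℝ)⁻¹ • (Λ.transpose * Λhat)).mulVec x) := by
      simp only [z]; rw [Matrix.sub_mulVec, Matrix.mulVec_mulVec]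
    nth_rewrite 2 [this]
    rw [dotProduct_sub, hzΛ, sub_zero]
  have hcancel : ∀ B : ℝ, 0 ≤ B → z ⬝ᵥ z ≤ √(z ⬝ᵥ z) * B → √(z ⬝ᵥ z) ≤ B := by
    intro B hB h
    rcases (Real.sqrt_nonneg (z ⬝ᵥ z)).eq_or_lt with h0 | h0
    · rw [← h0]; exact hB
    · refine le_of_mul_le_mul_left ?_ h0
      rwa [Real.mul_self_sqrt (dotProduct_self_real_nonneg _)]
  have hfirst : √(z ⬝ᵥ z) ≤ √q * √(x ⬝ᵥ x) := by
    refine hcancel _ (by positivity) ?_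
    have h := (le_abs_self _).trans (abs_dotProduct_le_sqrt z (Λhat.mulVec x))
    rw [← hzz, mulVec_dotProduct_mulVec_self Λhat hhat2, Real.sqrt_mul hq'.le] at h
    exact h
  refine ⟨hfirst, ?_⟩
  -- If the perturbation is not small compared with a, then 2ρ/a ≥ 1 and the trivial bound suffices.
  -- Otherwise the leading eigenvalues are at least qa/2.
  by_cases hc : a ≤ 2 * ρ
  · refine hfirst.trans (mul_le_mul_of_nonneg_right ?_ (Real.sqrt_nonneg _))
    have : 1 ≤ 2 / a * ρ := by rw [div_mul_eq_mul_div, le_div_iff₀ ha0]; linarith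
    nlinarith [Real.sqrt_nonneg (q : ℝ)]
  push Not at hc
  have hμlow : ∀ j : Fin s, q * (a / 2) ≤ μ (Fin.castLE hs j) := fun j =>
    (mul_le_mul_of_nonneg_left (by linarith) hq'.le).trans
      (eigenvalue_lower_bound hs hq hΛ hG ha hΓ hR hE hμ hΓE j)
  have hμpos : ∀ j : Fin s, 0 < μ (Fin.castLE hs j) := fun j =>
    lt_of_lt_of_le (by positivity) (hμlow j)
  -- Dividing the coefficients by the eigenvalues gives Γ E₀ x' = E₀ x, where E₀ x' has length at
  -- most 2/(qa) times that of x.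
  set x' : Fin s → ℝ := fun j => (μ (Fin.castLE hs j))⁻¹ * x j with hx'
  have hΓy : Γ.mulVec (E0.mulVec x') = E0.mulVec x := by
    rw [Matrix.mulVec_mulVec, hΓE0, ← Matrix.mulVec_mulVec]
    congr 1
    ext j
    rw [Matrix.mulVec_diagonal, hx']
    simp only
    rw [← mul_assoc, mul_inv_cancel₀ (hμpos j).ne', one_mul]
  have hyy : E0.mulVec x' ⬝ᵥ E0.mulVec x' ≤ (2 / (q * a)) ^ 2 * (x ⬝ᵥ x) := by
    rw [mulVec_dotProduct_mulVec_self (c := 1) E0 (by simpa using hE0E0), one_mul, dotProduct,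
      dotProduct, Finset.mul_sum]
    refine Finset.sum_le_sum fun j _ => ?_
    have h1 : (μ (Fin.castLE hs j))⁻¹ ≤ 2 / (q * a) := by
      rw [inv_le_comm₀ (hμpos j) (by positivity), inv_div]
      rw [mul_div_assoc]; exact hμlow j
    have h2 : 0 ≤ (μ (Fin.castLE hs j))⁻¹ := (inv_pos.mpr (hμpos j)).le
    have h3 := pow_le_pow_left₀ h2 h1 2
    calc x' j * x' j = (μ (Fin.castLE hs j))⁻¹ ^ 2 * (x j * x j) := by rw [hx']; ring
      _ ≤ _ := mul_le_mul_of_nonneg_right h3 (mul_self_nonneg _)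
  have hsy : √(E0.mulVec x' ⬝ᵥ E0.mulVec x') ≤ 2 / (q * a) * √(x ⬝ᵥ x) := by
    refine (Real.sqrt_le_sqrt hyy).trans (le_of_eq ?_)
    rw [Real.sqrt_mul (by positivity), Real.sqrt_sq (by positivity)]
  refine hcancel _ (by positivity) ?_
  -- The signal part ΛGΛᵀ of Γ maps into the column space of Λ, to which z is orthogonal.
  have hz1 : z ⬝ᵥ z = √q * (z ⬝ᵥ R.mulVec (E0.mulVec x')) := by
    rw [hzz, hhatE, Matrix.smul_mulVec, dotProduct_smul, ← hΓy, hΓ, Matrix.add_mulVec,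
      dotProduct_add, ← Matrix.mulVec_mulVec, ← Matrix.mulVec_mulVec, hzΛ, zero_add, smul_eq_mul]
  have hz2 := (le_abs_self _).trans (hR z (E0.mulVec x'))
  calc z ⬝ᵥ z = √q * (z ⬝ᵥ R.mulVec (E0.mulVec x')) := hz1
    _ ≤ √q * (q * ρ * (√(z ⬝ᵥ z) * (2 / (q * a) * √(x ⬝ᵥ x)))) := by
        refine mul_le_mul_of_nonneg_left (hz2.trans ?_) (Real.sqrt_nonneg _)
        exact mul_le_mul_of_nonneg_left
          (mul_le_mul_of_nonneg_left hsy (Real.sqrt_nonneg _)) (by positivity)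
    _ = √(z ⬝ᵥ z) * (√q * (2 / a * ρ) * √(x ⬝ᵥ x)) := by field_simp

theorem specNorm_le_of_sqrt {m s : ℕ} (A : Matrix (Fin m) (Fin s) ℝ) {C : ℝ} (hC : 0 ≤ C)
    (h : ∀ x, √(A.mulVec x ⬝ᵥ A.mulVec x) ≤ C * √(x ⬝ᵥ x)) : specNorm A ≤ C := by
  refine ContinuousLinearMap.opNorm_le_bound _ hC fun x => ?_
  have := h x.ofLp
  simpa [EuclideanSpace.norm_eq, dotProduct, sq] using this

/-- Perturbation bound for principal component loadings, with the rotation given by projection. -/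
theorem pcLoading_error {q s : ℕ} (hs : s ≤ q) {Γ R : Matrix (Fin q) (Fin q) ℝ}
    {Λ Λhat : Matrix (Fin q) (Fin s) ℝ} {G : Matrix (Fin s) (Fin s) ℝ} {a ρ : ℝ}
    (hq : 0 < q) (hρ : 0 ≤ ρ) (ha0 : 0 < a)
    (hΛ : Λ.transpose * Λ = (q : ℝ) • (1 : Matrix (Fin s) (Fin s) ℝ))
    (hG : G.IsDiag) (ha : ∀ j, a ≤ G j j) (hΓ : Γ = Λ * G * Λ.transpose + R)
    (hR : BilinBound R (q * ρ)) (hhat : IsPCLoading Γ Λhat) :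
    let H := (q : ℝ)⁻¹ • (Λ.transpose * Λhat)
    1 / √(q : ℝ) * specNorm (Λhat - Λ * H) ≤ 2 / a * ρ ∧
    ∀ i j, |(H.transpose * H) i j - (1 : Matrix (Fin s) (Fin s) ℝ) i j| ≤ 2 / a * ρ := by
  have hq' : (0 : ℝ) < q := by exact_mod_cast hq
  obtain ⟨h1, h2⟩ := pcLoading_residual_bound hs hq hρ ha0 hΛ hG ha hΓ hR hhat
  intro H
  set Z := Λhat - Λ * H with hZ
  have hsq : 0 < √(q : ℝ) := Real.sqrt_pos.mpr hq'
  constructor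
  · have := specNorm_le_of_sqrt Z (C := √q * (2 / a * ρ)) (by positivity) fun x => (h2 x).2
    rw [one_div, inv_mul_le_iff₀ hsq]
    exact this
  -- Pythagoras: q·1 = ΛhatᵀΛhat splits into the projected part q·HᵀH and the residual part ZᵀZ.
  · have hZZ : Z.transpose * Z = (q : ℝ) • (1 - H.transpose * H) := by
      have e1 : Λ.transpose * Λhat = (q : ℝ) • H := by
        simp only [H]; rw [smul_smul, mul_inv_cancel₀ hq'.ne', one_smul]
      have e2 : Λhat.transpose * Λ = (q : ℝ) • H.transpose := by
        have := congrArg Matrix.transpose e1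
        rwa [Matrix.transpose_mul, Matrix.transpose_transpose, Matrix.transpose_smul] at this
      have e3 : Λhat.transpose * (Λ * H) = (q : ℝ) • (H.transpose * H) := by
        rw [← Matrix.mul_assoc, e2, Matrix.smul_mul]
      have e4 : H.transpose * Λ.transpose * (Λ * H) = (q : ℝ) • (H.transpose * H) := by
        rw [Matrix.mul_assoc, ← Matrix.mul_assoc Λ.transpose, hΛ, Matrix.smul_mul,
          Matrix.one_mul, Matrix.mul_smul]
      have e5 : H.transpose * Λ.transpose * Λhat = (q : ℝ) • (H.transpose * H) := by
        rw [Matrix.mul_assoc, e1, Matrix.mul_smul]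
      rw [hZ, Matrix.transpose_sub, Matrix.transpose_mul, Matrix.sub_mul, Matrix.mul_sub,
        Matrix.mul_sub, h1, e3, e4, e5, smul_sub]
      abel
    intro i j
    have hcol : ∀ j, √((fun i => Z i j) ⬝ᵥ fun i => Z i j) ≤ √q ∧
        √((fun i => Z i j) ⬝ᵥ fun i => Z i j) ≤ √q * (2 / a * ρ) := fun j => by
      have := h2 (Pi.single j 1)
      have e : Z.mulVec (Pi.single j 1) = fun i => Z i j := by
        rw [Matrix.mulVec_single_one]; rfl
      have e2 : (Pi.single j 1 : Fin s → ℝ) ⬝ᵥ Pi.single j 1 = 1 := by simp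
      simp only [e, e2, Real.sqrt_one, mul_one] at this
      exact this
    have hent : (q : ℝ) * ((1 : Matrix (Fin s) (Fin s) ℝ) i j - (H.transpose * H) i j) =
        (fun a => Z a i) ⬝ᵥ fun a => Z a j := by
      have := congrFun (congrFun hZZ i) j
      simp only [Matrix.smul_apply, Matrix.sub_apply, smul_eq_mul] at this
      rw [← this, Matrix.mul_apply]; rfl
    -- One column of Z is estimated by the trivial bound and the other by the small one, so that the
    -- result is linear in ρ.
    have hle : (q : ℝ) * |(1 : Matrix (Fin s) (Fin s) ℝ) i j - (H.transpose * H) i j| ≤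
        q * (2 / a * ρ) := by
      rw [← abs_of_pos hq', ← abs_mul, abs_of_pos hq', hent]
      refine (abs_dotProduct_le_sqrt _ _).trans ?_
      calc _ ≤ √q * (√q * (2 / a * ρ)) :=
            mul_le_mul (hcol i).1 (hcol j).2 (Real.sqrt_nonneg _) hsq.le
        _ = q * (2 / a * ρ) := by rw [← mul_assoc, Real.mul_self_sqrt hq'.le]
    rw [abs_sub_comm]
    exact le_of_mul_le_mul_left hle hq'

/-! ### Covariance inequalities under strong mixing. -/

section

variable {Ω : Type*} {𝒜 ℬ : MeasurableSpace Ω} [m0 : MeasurableSpace Ω] {P : Measure Ω} [IsProbabilityMeasure P]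

theorem memLp_of_abs_le {X : Ω → ℝ} {A : ℝ} (hX : Measurable X) (hA : ∀ ω, |X ω| ≤ A)
    (p : ENNReal) : MemLp X p P :=
  MemLp.of_bound hX.aestronglyMeasurable A (ae_of_all _ hA)

theorem integrable_of_abs_le {X : Ω → ℝ} {A : ℝ} (hX : Measurable X) (hA : ∀ ω, |X ω| ≤ A) :
    Integrable X P :=
  (memLp_of_abs_le hX hA 1).integrable le_rfl

/-- Let g be the conditional expectation of Y - E Y given 𝒜. Then cov(X, Y) = E[Xg] is at most A
E|g|, and since g has mean zero, E|g| is twice the integral of g over S = {g > 0}, which is the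
covariance of the indicator of S with Y. Applied once in each variable, this reduces covariances of
bounded variables to those of events. -/
theorem exists_indicator_covariance_bound (h𝒜 : 𝒜 ≤ m0) {X Y : Ω → ℝ}
    {A B : ℝ} (hX : Measurable[𝒜] X) (hXA : ∀ ω, |X ω| ≤ A) (hY : Measurable Y)
    (hYB : ∀ ω, |Y ω| ≤ B) :
    ∃ S, MeasurableSet[𝒜] S ∧
      |cov[X, Y; P]| ≤ 2 * A * |cov[S.indicator (fun _ => (1 : ℝ)), Y; P]| := by
  have hXm : Measurable X := hX.mono h𝒜 le_rfl
  have hYi := integrable_of_abs_le (P := P) hY hYB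
  obtain ⟨ω₀⟩ : Nonempty Ω := nonempty_of_isProbabilityMeasure P
  have hA0 : 0 ≤ A := (abs_nonneg _).trans (hXA ω₀)
  set Z : Ω → ℝ := fun ω => Y ω - P[Y] with hZ
  have hZi : Integrable Z P := hYi.sub (integrable_const _)
  have hZ0 : ∫ ω, Z ω ∂P = 0 := by
    simp only [hZ]; rw [integral_sub hYi (integrable_const _)]; simp
  have hcov : ∀ {W : Ω → ℝ} {C : ℝ}, Measurable W → (∀ ω, |W ω| ≤ C) →
      cov[W, Y; P] = ∫ ω, W ω * Z ω ∂P := by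
    intro W C hW hWC
    rw [covariance]
    have : ∀ ω, (W ω - P[W]) * (Y ω - P[Y]) = W ω * Z ω - P[W] * Z ω := fun ω => by
      simp only [hZ]; ring
    simp_rw [this]
    rw [integral_sub, integral_const_mul, hZ0, mul_zero, sub_zero]
    · exact hZi.bdd_mul hW.aestronglyMeasurable (ae_of_all _ hWC)
    · exact hZi.const_mul _
  set g : Ω → ℝ := P[Z | 𝒜] with hg
  have hgm : StronglyMeasurable[𝒜] g := stronglyMeasurable_condExp
  have hgi : Integrable g P := integrable_condExp
  have hg0 : ∫ ω, g ω ∂P = 0 := by rw [hg, integral_condExp h𝒜, hZ0]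
  set S : Set Ω := {ω | 0 < g ω} with hS
  have hSm : MeasurableSet[𝒜] S := hgm.measurable measurableSet_Ioi
  refine ⟨S, hSm, ?_⟩
  have hXZ : Integrable (X * Z) P := hZi.bdd_mul hXm.aestronglyMeasurable (ae_of_all _ hXA)
  have h1 : cov[X, Y; P] = ∫ ω, X ω * g ω ∂P := by
    rw [hcov hXm hXA]
    have := condExp_mul_of_stronglyMeasurable_left (m := 𝒜) hX.stronglyMeasurable hXZ hZi
    rw [← integral_condExp (f := fun ω => X ω * Z ω) h𝒜]
    exact integral_congr_ae this
  have h2 : cov[S.indicator (fun _ => (1 : ℝ)), Y; P] = ∫ ω in S, g ω ∂P := by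
    rw [hcov (C := 1) (measurable_const.indicator (h𝒜 _ hSm))
      (fun ω => by by_cases h : ω ∈ S <;> simp [h]), hg, setIntegral_condExp h𝒜 hZi hSm,
      ← integral_indicator (h𝒜 _ hSm)]
    refine integral_congr_ae (ae_of_all _ fun ω => ?_)
    by_cases h : ω ∈ S <;> simp [h]
  have h3 : ∫ ω, |g ω| ∂P = 2 * ∫ ω in S, g ω ∂P := by
    rw [← integral_indicator (h𝒜 _ hSm)]
    have : ∀ ω, |g ω| = 2 * S.indicator g ω - g ω := fun ω => by
      by_cases h : ω ∈ S
      · rw [Set.indicator_of_mem h, abs_of_pos h]; ring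
      · rw [Set.indicator_of_notMem h, abs_of_nonpos (not_lt.mp h)]; ring
    simp_rw [this]
    rw [integral_sub ((hgi.indicator (h𝒜 _ hSm)).const_mul _) hgi, integral_const_mul, hg0,
      sub_zero]
  rw [h1, h2]
  calc |∫ ω, X ω * g ω ∂P| ≤ ∫ ω, |X ω * g ω| ∂P := abs_integral_le_integral_abs
    _ ≤ ∫ ω, A * |g ω| ∂P := by
        refine integral_mono ((hgi.bdd_mul hXm.aestronglyMeasurable (ae_of_all _ hXA)).abs)
          (hgi.abs.const_mul _) fun ω => ?_
        simp only [abs_mul]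
        exact mul_le_mul_of_nonneg_right (hXA ω) (abs_nonneg _)
    _ = 2 * A * ∫ ω in S, g ω ∂P := by rw [integral_const_mul, h3]; ring
    _ ≤ _ := mul_le_mul_of_nonneg_left (le_abs_self _) (by positivity)

theorem covariance_indicator_indicator {S T : Set Ω} (hS : MeasurableSet S)
    (hT : MeasurableSet T) :
    cov[S.indicator (fun _ => (1 : ℝ)), T.indicator (fun _ => (1 : ℝ)); P] =
      P.real (S ∩ T) - P.real S * P.real T := by
  have hb : ∀ U : Set Ω, ∀ ω, |U.indicator (fun _ => (1 : ℝ)) ω| ≤ 1 := fun U ω => by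
    by_cases h : ω ∈ U <;> simp [h]
  rw [covariance_eq_sub (memLp_of_abs_le (measurable_const.indicator hS) (hb S) 2)
    (memLp_of_abs_le (measurable_const.indicator hT) (hb T) 2)]
  have e : (S.indicator (fun _ => (1 : ℝ))) * (T.indicator (fun _ => (1 : ℝ))) =
      (S ∩ T).indicator (fun _ => (1 : ℝ)) := by
    ext ω
    by_cases h : ω ∈ S <;> by_cases h' : ω ∈ T <;> simp [h, h']
  rw [e, integral_indicator (hS.inter hT), integral_indicator hS, integral_indicator hT]
  simp

/-- Covariance inequality for bounded random variables under strong mixing. -/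
theorem abs_covariance_le_of_bounded (h𝒜 : 𝒜 ≤ m0) (hℬ : ℬ ≤ m0)
    {α : ℝ} (hα : ∀ S T, MeasurableSet[𝒜] S → MeasurableSet[ℬ] T →
      |P.real (S ∩ T) - P.real S * P.real T| ≤ α)
    {X Y : Ω → ℝ} {A B : ℝ} (hX : Measurable[𝒜] X) (hXA : ∀ ω, |X ω| ≤ A) (hY : Measurable[ℬ] Y)
    (hYB : ∀ ω, |Y ω| ≤ B) : |cov[X, Y; P]| ≤ 4 * A * B * α := by
  obtain ⟨ω₀⟩ : Nonempty Ω := nonempty_of_isProbabilityMeasure P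
  have hA0 : 0 ≤ A := (abs_nonneg _).trans (hXA ω₀)
  have hB0 : 0 ≤ B := (abs_nonneg _).trans (hYB ω₀)
  obtain ⟨S, hS, h1⟩ := exists_indicator_covariance_bound (P := P) h𝒜 hX hXA
    (hY.mono hℬ le_rfl) hYB
  obtain ⟨T, hT, h2⟩ := exists_indicator_covariance_bound (P := P) hℬ hY hYB
    (measurable_const.indicator (h𝒜 _ hS)) (B := 1) (Y := S.indicator (fun _ => (1 : ℝ)))
    (fun ω => by by_cases h : ω ∈ S <;> simp [h])
  rw [covariance_comm Y, covariance_comm (T.indicator _),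
    covariance_indicator_indicator (h𝒜 _ hS) (hℬ _ hT)] at h2
  calc _ ≤ _ := h1
    _ ≤ 2 * A * (2 * B * α) := mul_le_mul_of_nonneg_left
        (h2.trans (mul_le_mul_of_nonneg_left (hα S T hS hT) (by positivity))) (by positivity)
    _ = _ := by ring

/-- Young's inequality with a free weight s, used in place of Cauchy–Schwarz. The weight is later
chosen to balance a small second moment against one of order w². -/
theorem abs_covariance_le_weighted {X Y : Ω → ℝ} (hX : MemLp X 2 P) (hY : MemLp Y 2 P) {s : ℝ}
    (hs : 0 < s) : |cov[X, Y; P]| ≤ (s * ∫ ω, X ω ^ 2 ∂P + s⁻¹ * ∫ ω, Y ω ^ 2 ∂P) / 2 := by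
  have hX' : MemLp (fun ω => X ω - P[X]) 2 P := hX.sub (memLp_const _)
  have hY' : MemLp (fun ω => Y ω - P[Y]) 2 P := hY.sub (memLp_const _)
  have h1 : |cov[X, Y; P]| ≤ (s * Var[X; P] + s⁻¹ * Var[Y; P]) / 2 := by
    rw [variance_eq_integral hX.aemeasurable, variance_eq_integral hY.aemeasurable,
      covariance, ← integral_const_mul, ← integral_const_mul,
      ← integral_add (hX'.integrable_sq.const_mul _) (hY'.integrable_sq.const_mul _),
      ← integral_div]
    refine abs_integral_le_integral_abs.trans (integral_mono ?_ ?_ fun ω => ?_)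
    · exact (hX'.integrable_mul hY').abs
    · exact ((hX'.integrable_sq.const_mul _).add (hY'.integrable_sq.const_mul _)).div_const _
    · simp only [abs_mul]
      set u := |X ω - P[X]| with hu
      set v := |Y ω - P[Y]| with hv
      rw [← sq_abs (X ω - P[X]), ← sq_abs (Y ω - P[Y]), ← hu, ← hv]
      have : s * u ^ 2 + s⁻¹ * v ^ 2 - 2 * (u * v) = s⁻¹ * (s * u - v) ^ 2 := by
        field_simp; ring
      have h2 : 0 ≤ s⁻¹ * (s * u - v) ^ 2 := by positivity
      linarith
  have hs' : 0 < s⁻¹ := inv_pos.mpr hs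
  have hvX := variance_le_expectation_sq (μ := P) hX.aestronglyMeasurable
  have hvY := variance_le_expectation_sq (μ := P) hY.aestronglyMeasurable
  have h3 := mul_le_mul_of_nonneg_left hvX hs.le
  have h4 := mul_le_mul_of_nonneg_left hvY hs'.le
  simp only [Pi.pow_apply] at h3 h4
  linarith

theorem sq_le_of_lt_abs {x T ε : ℝ} (hT : 0 < T) (hε : 0 ≤ ε) (h : T < |x|) :
    x ^ 2 ≤ (T ^ (2 * ε))⁻¹ * |x| ^ (2 + 2 * ε) := by
  have hx : 0 < |x| := hT.trans h
  rw [Real.rpow_add hx, ← sq_abs, show (2 : ℝ) = ((2 : ℕ) : ℝ) by norm_num, Real.rpow_natCast,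
    inv_mul_eq_div, le_div_iff₀ (by positivity)]
  exact mul_le_mul_of_nonneg_left (Real.rpow_le_rpow hT.le h.le (by positivity)) (by positivity)

/-- Splitting at |X| = w gives X² ≤ w² + w^{-2ε} |X|^{2+2ε} pointwise. The factor 2 is the price of
avoiding Hölder's inequality. -/
theorem integral_sq_le_of_moment {X : Ω → ℝ} {B w ε : ℝ} (hX : Measurable X)
    (hB : ∀ ω, |X ω| ≤ B) (hw : 0 < w) (hε : 0 < ε)
    (hm : ∫ ω, |X ω| ^ (2 + 2 * ε) ∂P ≤ w ^ (2 + 2 * ε)) : ∫ ω, X ω ^ 2 ∂P ≤ 2 * w ^ 2 := by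
  have hmi : Integrable (fun ω => |X ω| ^ (2 + 2 * ε)) P :=
    integrable_of_abs_le (A := B ^ (2 + 2 * ε)) (by fun_prop) fun ω => by
      rw [abs_of_nonneg (by positivity)]
      exact Real.rpow_le_rpow (abs_nonneg _) (hB ω) (by positivity)
  have hsi : Integrable (fun ω => X ω ^ 2) P := (memLp_of_abs_le hX hB 2).integrable_sq
  calc ∫ ω, X ω ^ 2 ∂P ≤ ∫ ω, (w ^ 2 + (w ^ (2 * ε))⁻¹ * |X ω| ^ (2 + 2 * ε)) ∂P := by
        refine integral_mono hsi ((integrable_const _).add (hmi.const_mul _)) fun ω => ?_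
        rcases le_or_gt |X ω| w with h | h
        · have : X ω ^ 2 ≤ w ^ 2 := by rw [← sq_abs]; exact pow_le_pow_left₀ (abs_nonneg _) h 2
          have h2 : 0 ≤ (w ^ (2 * ε))⁻¹ * |X ω| ^ (2 + 2 * ε) := by positivity
          simp only; linarith
        · have := sq_le_of_lt_abs hw hε.le h
          simp only; nlinarith
    _ = w ^ 2 + (w ^ (2 * ε))⁻¹ * ∫ ω, |X ω| ^ (2 + 2 * ε) ∂P := by
        rw [integral_add (integrable_const _) (hmi.const_mul _), integral_const_mul]; simp
    _ ≤ w ^ 2 + (w ^ (2 * ε))⁻¹ * w ^ (2 + 2 * ε) := by gcongr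
    _ = 2 * w ^ 2 := by
        rw [Real.rpow_add hw, show (2 : ℝ) = ((2 : ℕ) : ℝ) by norm_num, Real.rpow_natCast]
        field_simp; norm_num

/-- Covariance inequality under strong mixing for bounded random variables in terms of their
`L^{2 + 2ε}` norms. -/
theorem abs_covariance_le_of_moment (h𝒜 : 𝒜 ≤ m0) (hℬ : ℬ ≤ m0)
    {c₀ m : ℝ} (hc : 0 ≤ c₀) (hm : 0 ≤ m)
    (hα : ∀ S T, MeasurableSet[𝒜] S → MeasurableSet[ℬ] T →
      |P.real (S ∩ T) - P.real S * P.real T| ≤ Real.exp (-(c₀ * m)))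
    {X Y : Ω → ℝ} {B w ε : ℝ} (hX : Measurable[𝒜] X) (hXB : ∀ ω, |X ω| ≤ B)
    (hY : Measurable[ℬ] Y) (hYB : ∀ ω, |Y ω| ≤ B) (hw : 0 < w) (hε : 0 < ε) (hε1 : ε < 1)
    (hXm : ∫ ω, |X ω| ^ (2 + 2 * ε) ∂P ≤ w ^ (2 + 2 * ε))
    (hYm : ∫ ω, |Y ω| ^ (2 + 2 * ε) ∂P ≤ w ^ (2 + 2 * ε)) :
    |cov[X, Y; P]| ≤ 7 * w ^ 2 * Real.exp (-(ε * c₀ / 4 * m)) := by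
  -- Cutting X and Y at T makes the bounded covariance 4T² exp(-c₀m) equal to 4w² exp(-c₀m/2). The
  -- parts above T have second moment at most w² (w/T)^{2ε} = w² s⁻², so weight s in Young's
  -- inequality leaves errors of order w² s⁻¹.
  set T : ℝ := w * Real.exp (c₀ / 4 * m) with hT
  set s : ℝ := Real.exp (ε * c₀ / 4 * m) with hs
  have hTpos : 0 < T := by positivity
  have hspos : 0 < s := Real.exp_pos _
  set lo : ℝ → ℝ := fun x => if |x| ≤ T then x else 0 with hlo
  have hlom : Measurable lo :=
    Measurable.ite (measurableSet_le measurable_norm measurable_const) measurable_id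
      measurable_const
  have hloT : ∀ x, |lo x| ≤ T := fun x => by
    simp only [hlo]; split_ifs with h
    · exact h
    · simpa using hTpos.le
  have hlox : ∀ x, |lo x| ≤ |x| := fun x => by
    simp only [hlo]; split_ifs <;> simp
  have hhix : ∀ x, |x - lo x| ≤ |x| := fun x => by
    simp only [hlo]; split_ifs <;> simp
  have hsq : s ^ 2 = T ^ (2 * ε) * (w ^ (2 * ε))⁻¹ := by
    rw [hT, Real.mul_rpow hw.le (Real.exp_pos _).le, mul_comm (w ^ (2 * ε)), mul_assoc,
      mul_inv_cancel₀ (by positivity), mul_one, ← Real.exp_mul, hs, ← Real.exp_nat_mul]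
    congr 1; push_cast; ring
  have key : ∀ Z : Ω → ℝ, Measurable Z → (∀ ω, |Z ω| ≤ B) →
      ∫ ω, |Z ω| ^ (2 + 2 * ε) ∂P ≤ w ^ (2 + 2 * ε) →
      MemLp Z 2 P ∧ MemLp (fun ω => lo (Z ω)) 2 P ∧ MemLp (fun ω => Z ω - lo (Z ω)) 2 P ∧
      ∫ ω, Z ω ^ 2 ∂P ≤ 2 * w ^ 2 ∧ ∫ ω, lo (Z ω) ^ 2 ∂P ≤ 2 * w ^ 2 ∧
      ∫ ω, (Z ω - lo (Z ω)) ^ 2 ∂P ≤ w ^ 2 * (s ^ 2)⁻¹ := by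
    intro Z hZ hZB hZm
    have m1 : MemLp Z 2 P := memLp_of_abs_le hZ hZB 2
    have m2 : MemLp (fun ω => lo (Z ω)) 2 P :=
      memLp_of_abs_le (hlom.comp hZ) (fun ω => hloT _) 2
    have m3 : MemLp (fun ω => Z ω - lo (Z ω)) 2 P := m1.sub m2
    have i1 := integral_sq_le_of_moment (P := P) hZ hZB hw hε hZm
    refine ⟨m1, m2, m3, i1, ?_, ?_⟩
    · refine (integral_mono m2.integrable_sq m1.integrable_sq fun ω => ?_).trans i1
      exact sq_le_sq.mpr (hlox _)
    · have hmi : Integrable (fun ω => |Z ω| ^ (2 + 2 * ε)) P :=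
        integrable_of_abs_le (A := B ^ (2 + 2 * ε)) (by fun_prop) fun ω => by
          rw [abs_of_nonneg (by positivity)]
          exact Real.rpow_le_rpow (abs_nonneg _) (hZB ω) (by positivity)
      calc ∫ ω, (Z ω - lo (Z ω)) ^ 2 ∂P ≤ ∫ ω, (T ^ (2 * ε))⁻¹ * |Z ω| ^ (2 + 2 * ε) ∂P := by
            refine integral_mono m3.integrable_sq (hmi.const_mul _) fun ω => ?_
            simp only [hlo]; split_ifs with h
            · rw [sub_self, zero_pow two_ne_zero]; positivity
            · rw [sub_zero]; exact sq_le_of_lt_abs hTpos hε.le (not_le.mp h)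
        _ ≤ (T ^ (2 * ε))⁻¹ * w ^ (2 + 2 * ε) := by
            rw [integral_const_mul]; gcongr
        _ = w ^ 2 * (s ^ 2)⁻¹ := by
            rw [hsq, Real.rpow_add hw, show (2 : ℝ) = ((2 : ℕ) : ℝ) by norm_num, Real.rpow_natCast]
            field_simp
  obtain ⟨x1, x2, x3, x4, x5, x6⟩ := key X (hX.mono h𝒜 le_rfl) hXB hXm
  obtain ⟨y1, y2, y3, y4, y5, y6⟩ := key Y (hY.mono hℬ le_rfl) hYB hYm
  -- The three terms contribute 4, 3/2 and 3/2 times w² s⁻¹, whence the constant 7.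
  have hdecomp : cov[X, Y; P] = cov[fun ω => lo (X ω), fun ω => lo (Y ω); P] +
      cov[fun ω => lo (X ω), fun ω => Y ω - lo (Y ω); P] +
      cov[fun ω => X ω - lo (X ω), Y; P] := by
    rw [covariance_fun_sub_right x2 y1 y2, covariance_fun_sub_left x1 x2 y1]; ring
  have b1 := abs_covariance_le_of_bounded (P := P) h𝒜 hℬ hα (X := fun ω => lo (X ω))
    (Y := fun ω => lo (Y ω)) (hlom.comp hX) (fun ω => hloT _) (hlom.comp hY) (fun ω => hloT _)
  have b2 := abs_covariance_le_weighted x2 y3 (inv_pos.mpr hspos)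
  have b3 := abs_covariance_le_weighted x3 y1 hspos
  rw [inv_inv] at b2
  have hsinv : Real.exp (-(ε * c₀ / 4 * m)) = s⁻¹ := by rw [hs, ← Real.exp_neg]
  have e1 : s * (w ^ 2 * (s ^ 2)⁻¹) = w ^ 2 * s⁻¹ := by field_simp
  have c2 : (s⁻¹ * ∫ ω, lo (X ω) ^ 2 ∂P + s * ∫ ω, (Y ω - lo (Y ω)) ^ 2 ∂P) / 2 ≤
      3 / 2 * (w ^ 2 * s⁻¹) := by
    have h1 := mul_le_mul_of_nonneg_left x5 (inv_pos.mpr hspos).le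
    have h2 := mul_le_mul_of_nonneg_left y6 hspos.le
    rw [e1] at h2; linarith
  have c3 : (s * ∫ ω, (X ω - lo (X ω)) ^ 2 ∂P + s⁻¹ * ∫ ω, Y ω ^ 2 ∂P) / 2 ≤
      3 / 2 * (w ^ 2 * s⁻¹) := by
    have h1 := mul_le_mul_of_nonneg_left y4 (inv_pos.mpr hspos).le
    have h2 := mul_le_mul_of_nonneg_left x6 hspos.le
    rw [e1] at h2; linarith
  have c1 : 4 * T * T * Real.exp (-(c₀ * m)) ≤ 4 * (w ^ 2 * s⁻¹) := by
    have : T * T * Real.exp (-(c₀ * m)) = w ^ 2 * Real.exp (-(c₀ / 2 * m)) := by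
      rw [hT, show w * Real.exp (c₀ / 4 * m) * (w * Real.exp (c₀ / 4 * m)) * Real.exp (-(c₀ * m)) =
        w ^ 2 * (Real.exp (c₀ / 4 * m) * Real.exp (c₀ / 4 * m) * Real.exp (-(c₀ * m))) by ring,
        ← Real.exp_add, ← Real.exp_add]
      congr 2; ring
    -- Here ε < 1 is used: the bounded part decays at rate c₀/2, faster than the rate εc₀/4 of the
    -- tails.
    have h2 : Real.exp (-(c₀ / 2 * m)) ≤ s⁻¹ := by
      rw [← hsinv]; apply Real.exp_le_exp.mpr
      nlinarith [mul_nonneg hc hm]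
    have h3 := mul_le_mul_of_nonneg_left h2 (sq_nonneg w)
    nlinarith [this, h3]
  rw [hsinv, hdecomp]
  have t1 := abs_add_le (cov[fun ω => lo (X ω), fun ω => lo (Y ω); P] +
      cov[fun ω => lo (X ω), fun ω => Y ω - lo (Y ω); P]) (cov[fun ω => X ω - lo (X ω), Y; P])
  have t2 := abs_add_le (cov[fun ω => lo (X ω), fun ω => lo (Y ω); P])
      (cov[fun ω => lo (X ω), fun ω => Y ω - lo (Y ω); P])
  linarith

end

/-! ### Covariances of products. -/

section

variable {Ω : Type*} {𝒜 ℬ : MeasurableSpace Ω} [m0 : MeasurableSpace Ω] {P : Measure Ω}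
  [IsProbabilityMeasure P]

theorem integral_sq_mul_le {X Y : Ω → ℝ} {B U : ℝ} (hX : Measurable X) (hXB : ∀ ω, |X ω| ≤ B)
    (hY : Measurable Y) (hYB : ∀ ω, |Y ω| ≤ B) (hXU : ∫ ω, X ω ^ 4 ∂P ≤ U)
    (hYU : ∫ ω, Y ω ^ 4 ∂P ≤ U) : ∫ ω, (X ω * Y ω) ^ 2 ∂P ≤ U := by
  have h4 : ∀ Z : Ω → ℝ, Measurable Z → (∀ ω, |Z ω| ≤ B) → Integrable (fun ω => Z ω ^ 4) P :=
    fun Z hZ hZB => integrable_of_abs_le (A := B ^ 4) (hZ.pow_const 4) fun ω => by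
      rw [abs_pow]; exact pow_le_pow_left₀ (abs_nonneg _) (hZB ω) 4
  have hi : Integrable (fun ω => (X ω * Y ω) ^ 2) P :=
    (memLp_of_abs_le (A := B * B) (hX.mul hY) (fun ω => by
      rw [Pi.mul_apply, abs_mul]
      exact mul_le_mul (hXB ω) (hYB ω) (abs_nonneg _) ((abs_nonneg _).trans (hXB ω))) 2).integrable_sq
  calc ∫ ω, (X ω * Y ω) ^ 2 ∂P ≤ ∫ ω, (X ω ^ 4 + Y ω ^ 4) / 2 ∂P := by
        refine integral_mono hi (((h4 X hX hXB).add (h4 Y hY hYB)).div_const 2) fun ω => ?_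
        simp only
        nlinarith [sq_nonneg (X ω ^ 2 - Y ω ^ 2)]
    _ ≤ U := by
        rw [integral_div, integral_add (h4 X hX hXB) (h4 Y hY hYB)]; linarith

/-- Covariance inequality for products of bounded random variables under strong mixing. -/
theorem abs_covariance_mul_mul_le (h𝒜 : 𝒜 ≤ m0) (hℬ : ℬ ≤ m0) {c₀ m r B U : ℝ}
    (hα : ∀ S T, MeasurableSet[𝒜] S → MeasurableSet[ℬ] T →
      |P.real (S ∩ T) - P.real S * P.real T| ≤ Real.exp (-(c₀ * m)))
    {X X' Y Y' : Ω → ℝ} (hX : Measurable[𝒜] X) (hXB : ∀ ω, |X ω| ≤ B)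
    (hX' : Measurable[𝒜] X') (hXB' : ∀ ω, |X' ω| ≤ B)
    (hY : Measurable[ℬ] Y) (hYB : ∀ ω, |Y ω| ≤ B)
    (hY' : Measurable[ℬ] Y') (hYB' : ∀ ω, |Y' ω| ≤ B)
    (hXU : ∫ ω, X ω ^ 4 ∂P ≤ U) (hXU' : ∫ ω, X' ω ^ 4 ∂P ≤ U)
    (hYU : ∫ ω, Y ω ^ 4 ∂P ≤ U) (hYU' : ∫ ω, Y' ω ^ 4 ∂P ≤ U)
    (hr : 4 * B ^ 4 ≤ U * Real.exp (c₀ * r)) :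
    |cov[fun ω => X ω * X' ω, fun ω => Y ω * Y' ω; P]| ≤
      U * Real.exp (-(c₀ * max (m - r) 0)) := by
  have hb : ∀ {Z Z' : Ω → ℝ}, (∀ ω, |Z ω| ≤ B) → (∀ ω, |Z' ω| ≤ B) →
      ∀ ω, |Z ω * Z' ω| ≤ B * B := fun hZ hZ' ω => by
    rw [abs_mul]
    exact mul_le_mul (hZ ω) (hZ' ω) (abs_nonneg _) ((abs_nonneg _).trans (hZ ω))
  -- Up to lag r only the fourth moments are used. Beyond it the mixing bound 4B⁴ exp(-c₀m) applies,
  -- and `hr` states that at lag r it has fallen to U.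
  rcases le_total (m - r) 0 with h | h
  · rw [max_eq_right h, mul_zero, neg_zero, Real.exp_zero, mul_one]
    have hXm := hX.mono h𝒜 le_rfl
    have hXm' := hX'.mono h𝒜 le_rfl
    have hYm := hY.mono hℬ le_rfl
    have hYm' := hY'.mono hℬ le_rfl
    have h1 := abs_covariance_le_weighted (P := P) (s := 1)
      (memLp_of_abs_le (hXm.mul hXm') (hb hXB hXB') 2)
      (memLp_of_abs_le (hYm.mul hYm') (hb hYB hYB') 2) one_pos
    have h2 := integral_sq_mul_le hXm hXB hXm' hXB' hXU hXU'
    have h3 := integral_sq_mul_le hYm hYB hYm' hYB' hYU hYU'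
    refine h1.trans ?_
    simp only [Pi.mul_apply, inv_one, one_mul]
    linarith
  · rw [max_eq_left h]
    have h1 := abs_covariance_le_of_bounded (P := P) h𝒜 hℬ hα (X := fun ω => X ω * X' ω)
      (Y := fun ω => Y ω * Y' ω) (hX.mul hX') (hb hXB hXB') (hY.mul hY') (hb hYB hYB')
    refine h1.trans ?_
    have e : Real.exp (-(c₀ * (m - r))) = Real.exp (c₀ * r) * Real.exp (-(c₀ * m)) := by
      rw [← Real.exp_add]; congr 1; ring
    rw [e, ← mul_assoc U]
    refine mul_le_mul_of_nonneg_right (le_trans (le_of_eq ?_) hr) (Real.exp_pos _).le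
    ring

/-! ### Truncation errors -/

theorem trunc_eq_max_min {τ : ℝ} (hτ : 0 < τ) (x : ℝ) : trunc τ x = max (-τ) (min x τ) := by
  unfold trunc
  rcases lt_trichotomy x 0 with h | h | h
  · rw [sign_neg h, abs_of_neg h]
    rcases le_total (-x) τ with h' | h'
    · rw [min_eq_left h', min_eq_left (by linarith), max_eq_right (by linarith)]; simp
    · rw [min_eq_right h', min_eq_left (by linarith), max_eq_left (by linarith)]; simp
  · subst h; simp [hτ.le]
  · rw [sign_pos h, abs_of_pos h, max_eq_right (le_min (by linarith) (by linarith))]; simp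

/-- The idiosyncratic part of a truncated observation with common component `χ`. -/
noncomputable def truncErr (τ χ x : ℝ) : ℝ := trunc τ (χ + x) - χ

theorem measurable_truncErr {τ : ℝ} (hτ : 0 < τ) (χ : ℝ) : Measurable (truncErr τ χ) := by
  have : truncErr τ χ = fun x => max (-τ) (min (χ + x) τ) - χ := by
    ext x; rw [truncErr, trunc_eq_max_min hτ]
  rw [this]; fun_prop

/-- Truncation is 1-Lipschitz and leaves χ fixed, since |χ| ≤ τ. The proof checks the cases of the
clipping by hand. -/
theorem abs_truncErr_le_abs {τ χ : ℝ} (hτ : 0 < τ) (hχ : |χ| ≤ τ / 2) (x : ℝ) :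
    |truncErr τ χ x| ≤ |x| := by
  rw [truncErr, trunc_eq_max_min hτ]
  obtain ⟨h1, h2⟩ := abs_le.mp hχ
  rcases max_cases (-τ) (min (χ + x) τ) with ⟨e, h⟩ | ⟨e, h⟩ <;>
  rcases min_cases (χ + x) τ with ⟨e', h'⟩ | ⟨e', h'⟩ <;> rw [e] <;> try rw [e']
  all_goals
    rcases abs_cases x with ⟨ex, hx⟩ | ⟨ex, hx⟩ <;> rw [ex] <;> rw [abs_le] <;>
    constructor <;> linarith

theorem abs_truncErr_le {τ χ : ℝ} (hτ : 0 < τ) (hχ : |χ| ≤ τ / 2) (x : ℝ) :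
    |truncErr τ χ x| ≤ 2 * τ := by
  rw [truncErr, trunc_eq_max_min hτ]
  obtain ⟨h1, h2⟩ := abs_le.mp hχ
  have h3 : -τ ≤ max (-τ) (min (χ + x) τ) := le_max_left _ _
  have h4 : max (-τ) (min (χ + x) τ) ≤ τ := max_le (by linarith) (min_le_right _ _)
  rw [abs_le]; constructor <;> linarith

/-- For |x| ≤ τ/2 the sum χ + x is not truncated and the difference vanishes. For larger x it is at
most |x|, which is then dominated by a higher power of |x|. -/
theorem abs_truncErr_sub_le {τ χ ε : ℝ} (hτ : 0 < τ) (hχ : |χ| ≤ τ / 2) (hε : 0 < ε) (x : ℝ) :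
    |truncErr τ χ x - x| ≤ ((τ / 2) ^ (1 + 2 * ε))⁻¹ * |x| ^ (2 + 2 * ε) := by
  rcases le_or_gt |x| (τ / 2) with h | h
  · have : truncErr τ χ x - x = 0 := by
      rw [truncErr, trunc_eq_max_min hτ]
      obtain ⟨h1, h2⟩ := abs_le.mp hχ
      obtain ⟨h3, h4⟩ := abs_le.mp h
      rw [min_eq_left (by linarith), max_eq_right (by linarith)]; ring
    rw [this, abs_zero]; positivity
  · have hx : 0 < |x| := (by positivity : 0 < τ / 2).trans h
    have h1 : |truncErr τ χ x - x| ≤ |x| := by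
      rw [truncErr, trunc_eq_max_min hτ]
      obtain ⟨h1, h2⟩ := abs_le.mp hχ
      rcases max_cases (-τ) (min (χ + x) τ) with ⟨e, h⟩ | ⟨e, h⟩ <;>
      rcases min_cases (χ + x) τ with ⟨e', h'⟩ | ⟨e', h'⟩ <;> rw [e] <;> try rw [e']
      all_goals
        rcases abs_cases x with ⟨ex, hx⟩ | ⟨ex, hx⟩ <;> rw [ex] <;> rw [abs_le] <;>
        constructor <;> linarith
    refine h1.trans ?_
    rw [show 2 + 2 * ε = 1 + (1 + 2 * ε) by ring, Real.rpow_add hx, Real.rpow_one, inv_mul_eq_div,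
      le_div_iff₀ (by positivity)]
    exact mul_le_mul_of_nonneg_left (Real.rpow_le_rpow (by positivity) h.le (by positivity)) hx.le

theorem moment_of_eLpNorm_le {Q : Measure Ω} {X : Ω → ℝ} {w ε : ℝ} (hX : Measurable X) (hw : 0 < w) (hε : 0 < ε)
    (h : eLpNorm X (ENNReal.ofReal (2 + 2 * ε)) Q ≤ ENNReal.ofReal w) :
    Integrable (fun ω => |X ω| ^ (2 + 2 * ε)) Q ∧
      ∫ ω, |X ω| ^ (2 + 2 * ε) ∂Q ≤ w ^ (2 + 2 * ε) := by
  have hp : 0 < 2 + 2 * ε := by positivity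
  have hp0 : ENNReal.ofReal (2 + 2 * ε) ≠ 0 := by simpa using hp
  have hmem : MemLp X (ENNReal.ofReal (2 + 2 * ε)) Q :=
    ⟨hX.aestronglyMeasurable, h.trans_lt ENNReal.ofReal_lt_top⟩
  have hint := hmem.integrable_norm_rpow hp0 ENNReal.ofReal_ne_top
  rw [ENNReal.toReal_ofReal hp.le] at hint
  simp only [Real.norm_eq_abs] at hint
  refine ⟨hint, ?_⟩
  rw [hmem.eLpNorm_eq_integral_rpow_norm hp0 ENNReal.ofReal_ne_top,
    ENNReal.toReal_ofReal hp.le, ENNReal.ofReal_le_ofReal_iff hw.le] at h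
  have h0 : 0 ≤ ∫ ω, ‖X ω‖ ^ (2 + 2 * ε) ∂Q := integral_nonneg fun ω => by positivity
  have := Real.rpow_le_rpow (by positivity) h hp.le
  rwa [← Real.rpow_mul h0, inv_mul_cancel₀ hp.ne', Real.rpow_one] at this

/-- The moment comes from |e| ≤ |X|. In the fourth moment the surplus power 2 - 2ε is paid for by
|e| ≤ 2τ. The bias uses that X is centred, so that only the event |X| > τ/2 contributes. -/
theorem truncErr_moments {X : Ω → ℝ} {w ε τ χ : ℝ} (hX : Measurable X) (hw : 0 < w) (hε : 0 < ε)
    (hε1 : ε < 1) (h : eLpNorm X (ENNReal.ofReal (2 + 2 * ε)) P ≤ ENNReal.ofReal w)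
    (hX0 : ∫ ω, X ω ∂P = 0) (hτ : 0 < τ) (hχ : |χ| ≤ τ / 2) :
    ∫ ω, |truncErr τ χ (X ω)| ^ (2 + 2 * ε) ∂P ≤ w ^ (2 + 2 * ε) ∧
    ∫ ω, truncErr τ χ (X ω) ^ 4 ∂P ≤ (2 * τ) ^ (2 - 2 * ε) * w ^ (2 + 2 * ε) ∧
    |∫ ω, truncErr τ χ (X ω) ∂P| ≤ ((τ / 2) ^ (1 + 2 * ε))⁻¹ * w ^ (2 + 2 * ε) := by
  obtain ⟨hi, hm⟩ := moment_of_eLpNorm_le hX hw hε h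
  have hZ : Measurable fun ω => truncErr τ χ (X ω) := (measurable_truncErr hτ χ).comp hX
  have hZB : ∀ ω, |truncErr τ χ (X ω)| ≤ 2 * τ := fun ω => abs_truncErr_le hτ hχ _
  have hmi : Integrable (fun ω => |truncErr τ χ (X ω)| ^ (2 + 2 * ε)) P :=
    integrable_of_abs_le (A := (2 * τ) ^ (2 + 2 * ε)) (by fun_prop) fun ω => by
      rw [abs_of_nonneg (by positivity)]
      exact Real.rpow_le_rpow (abs_nonneg _) (hZB ω) (by positivity)
  have m1 : ∫ ω, |truncErr τ χ (X ω)| ^ (2 + 2 * ε) ∂P ≤ w ^ (2 + 2 * ε) := by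
    refine (integral_mono hmi hi fun ω => ?_).trans hm
    exact Real.rpow_le_rpow (abs_nonneg _) (abs_truncErr_le_abs hτ hχ _) (by positivity)
  refine ⟨m1, ?_, ?_⟩
  · have h4i : Integrable (fun ω => truncErr τ χ (X ω) ^ 4) P :=
      integrable_of_abs_le (A := (2 * τ) ^ 4) (hZ.pow_const 4) fun ω => by
        rw [abs_pow]; exact pow_le_pow_left₀ (abs_nonneg _) (hZB ω) 4
    calc ∫ ω, truncErr τ χ (X ω) ^ 4 ∂P
        ≤ ∫ ω, (2 * τ) ^ (2 - 2 * ε) * |truncErr τ χ (X ω)| ^ (2 + 2 * ε) ∂P := by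
          refine integral_mono h4i (hmi.const_mul _) fun ω => ?_
          simp only
          have e : truncErr τ χ (X ω) ^ 4 =
              |truncErr τ χ (X ω)| ^ (2 - 2 * ε) * |truncErr τ χ (X ω)| ^ (2 + 2 * ε) := by
            rw [← Real.rpow_add_of_nonneg (abs_nonneg _) (by linarith) (by positivity)]
            rw [show 2 - 2 * ε + (2 + 2 * ε) = ((4 : ℕ) : ℝ) by push_cast; ring, Real.rpow_natCast]
            exact (Even.pow_abs (by decide) _).symm
          rw [e]
          exact mul_le_mul_of_nonneg_right
            (Real.rpow_le_rpow (abs_nonneg _) (hZB ω) (by linarith)) (by positivity)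
      _ ≤ _ := by
          rw [integral_const_mul]
          exact mul_le_mul_of_nonneg_left m1 (by positivity)
  · have hmem : MemLp X (ENNReal.ofReal (2 + 2 * ε)) P :=
      ⟨hX.aestronglyMeasurable, h.trans_lt ENNReal.ofReal_lt_top⟩
    have hXi : Integrable X P := hmem.integrable (by
      rw [← ENNReal.ofReal_one]; exact ENNReal.ofReal_le_ofReal (by linarith))
    have hZi : Integrable (fun ω => truncErr τ χ (X ω)) P := integrable_of_abs_le hZ hZB
    have e : ∫ ω, truncErr τ χ (X ω) ∂P = ∫ ω, (truncErr τ χ (X ω) - X ω) ∂P := by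
      rw [integral_sub hZi hXi, hX0, sub_zero]
    rw [e]
    refine abs_integral_le_integral_abs.trans ?_
    refine (integral_mono (hZi.sub hXi).abs (hi.const_mul _) fun ω =>
      abs_truncErr_sub_le hτ hχ hε (X ω)).trans ?_
    rw [integral_const_mul]
    exact mul_le_mul_of_nonneg_left hm (by positivity)

end

/-! ### Summation of exponentially decaying terms over lattices. -/

/-- A constant bounding sums of exponentially decaying terms over the natural numbers. -/
noncomputable def expSumConst (γ : ℝ) : ℝ := 1 + (1 - Real.exp (-γ))⁻¹

theorem expSumConst_pos {γ : ℝ} (hγ : 0 < γ) : 0 < expSumConst γ := by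
  have : Real.exp (-γ) < 1 := by rw [← Real.exp_zero]; exact Real.exp_lt_exp.mpr (by linarith)
  have h2 : 0 < (1 - Real.exp (-γ))⁻¹ := inv_pos.mpr (by linarith)
  unfold expSumConst; linarith

theorem sum_range_exp_le {γ r : ℝ} (hγ : 0 < γ) (hr : 0 ≤ r) (D : ℕ) :
    ∑ d ∈ Finset.range D, Real.exp (-(γ * max ((d : ℝ) - r) 0)) ≤ r + expSumConst γ := by
  -- The first R + 1 terms are at most 1 each. From index R + 1 > r on, the terms are dominated by a
  -- geometric series.
  set R := ⌊r⌋₊ with hR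
  have hRr : (R : ℝ) ≤ r := Nat.floor_le hr
  have hrR : r < R + 1 := Nat.lt_floor_add_one r
  have hx : Real.exp (-γ) < 1 := by rw [← Real.exp_zero]; exact Real.exp_lt_exp.mpr (by linarith)
  calc ∑ d ∈ Finset.range D, Real.exp (-(γ * max ((d : ℝ) - r) 0))
      ≤ ∑ d ∈ Finset.range (R + 1 + D), Real.exp (-(γ * max ((d : ℝ) - r) 0)) :=
        Finset.sum_le_sum_of_subset_of_nonneg (Finset.range_mono (by omega))
          fun _ _ _ => (Real.exp_pos _).le
    _ = ∑ d ∈ Finset.range (R + 1), Real.exp (-(γ * max ((d : ℝ) - r) 0)) +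
        ∑ d ∈ Finset.range D, Real.exp (-(γ * max (((R + 1 + d : ℕ) : ℝ) - r) 0)) :=
        Finset.sum_range_add _ _ _
    _ ≤ ∑ _d ∈ Finset.range (R + 1), (1 : ℝ) + ∑ d ∈ Finset.range D, Real.exp (-γ) ^ d := by
        refine add_le_add (Finset.sum_le_sum fun d _ => ?_) (Finset.sum_le_sum fun d _ => ?_)
        · rw [Real.exp_le_one_iff]
          have := mul_nonneg hγ.le (le_max_right ((d : ℝ) - r) 0)
          linarith
        · rw [← Real.exp_nat_mul, Real.exp_le_exp]
          have h1 : (d : ℝ) ≤ max (((R + 1 + d : ℕ) : ℝ) - r) 0 := by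
            refine le_trans ?_ (le_max_left _ _)
            push_cast; linarith
          have := mul_le_mul_of_nonneg_left h1 hγ.le
          linarith
    _ ≤ (R + 1) + (1 - Real.exp (-γ))⁻¹ := by
        refine add_le_add (by simp) ?_
        rw [← tsum_geometric_of_lt_one (Real.exp_pos _).le hx]
        exact (summable_geometric_of_lt_one (Real.exp_pos _).le hx).sum_le_tsum _
          fun _ _ => by positivity
    _ ≤ r + expSumConst γ := by unfold expSumConst; linarith

/-- On either side of a the distance to a is injective, so each half is a sum over distinct natural
numbers. This explains the factor 2. -/
theorem sum_exp_natAbs_le {β : Type*} (s : Finset β) {φ : β → ℤ} (hφ : Set.InjOn φ s) (a : ℤ)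
    {γ r : ℝ} (hγ : 0 < γ) (hr : 0 ≤ r) :
    ∑ x ∈ s, Real.exp (-(γ * max (((a - φ x).natAbs : ℝ) - r) 0)) ≤ 2 * (r + expSumConst γ) := by
  classical
  set f : ℕ → ℝ := fun d => Real.exp (-(γ * max ((d : ℝ) - r) 0)) with hf
  have key : ∀ t : Finset β, t ⊆ s →
      Set.InjOn (fun x => (a - φ x).natAbs) t →
      ∑ x ∈ t, f (a - φ x).natAbs ≤ r + expSumConst γ := by
    intro t _ ht
    rw [← Finset.sum_image (f := f) ht]
    obtain ⟨D, hD⟩ := (t.image fun x => (a - φ x).natAbs).exists_nat_subset_range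
    exact (Finset.sum_le_sum_of_subset_of_nonneg hD fun _ _ _ => (Real.exp_pos _).le).trans
      (sum_range_exp_le hγ hr D)
  rw [← Finset.sum_filter_add_sum_filter_not s (fun x => φ x ≤ a)]
  have k1 := key (s.filter fun x => φ x ≤ a) (Finset.filter_subset _ _) (by
    intro x hx y hy h
    simp only [Finset.coe_filter, Set.mem_ofPred_eq] at hx hy h
    exact hφ hx.1 hy.1 (by omega))
  have k2 := key (s.filter fun x => ¬ φ x ≤ a) (Finset.filter_subset _ _) (by
    intro x hx y hy h
    simp only [Finset.coe_filter, Set.mem_ofPred_eq] at hx hy h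
    exact hφ hx.1 hy.1 (by omega))
  linarith

theorem sum_univ_exp_natAbs_le (m : ℕ) (a : ℤ) {γ r : ℝ} (hγ : 0 < γ) (hr : 0 ≤ r) :
    ∑ x : Fin m, Real.exp (-(γ * max (((a - (x : ℤ)).natAbs : ℝ) - r) 0)) ≤
      2 * (r + expSumConst γ) :=
  sum_exp_natAbs_le Finset.univ (φ := fun x : Fin m => (x : ℤ))
    (fun _ _ _ _ h => Fin.ext (Int.ofNat_inj.mp h)) a hγ hr

theorem sum_Icc_exp_natAbs_le (m : ℕ) (a : ℤ) {γ r : ℝ} (hγ : 0 < γ) (hr : 0 ≤ r) :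
    ∑ x ∈ Finset.Icc 1 m, Real.exp (-(γ * max (((a - (x : ℤ)).natAbs : ℝ) - r) 0)) ≤
      2 * (r + expSumConst γ) :=
  sum_exp_natAbs_le _ (φ := fun x : ℕ => (x : ℤ))
    (fun _ _ _ _ h => Int.ofNat_inj.mp h) a hγ hr

/-- Summation over a lattice box of a function decaying exponentially in the maximum distance. -/
theorem sum_box_exp_le {J : Type*} [Fintype J] [DecidableEq J] (d : J → ℕ) (n : ℕ) (t : ℤ)
    (c : J → ℤ)
    {c₀ r : ℝ} (hc : 0 < c₀) (hr : 0 ≤ r) (dist : ℕ → (∀ j, Fin (d j)) → ℕ)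
    (hdt : ∀ (t' : ℕ) c', (t - (t' : ℤ)).natAbs ≤ dist t' c')
    (hdc : ∀ (t' : ℕ) c' j, (c j - (c' j : ℤ)).natAbs ≤ dist t' c') :
    ∑ z ∈ Finset.Icc 1 n ×ˢ (Finset.univ : Finset (∀ j, Fin (d j))),
      Real.exp (-(c₀ * max ((dist z.1 z.2 : ℝ) - r) 0)) ≤
      (2 * (r + expSumConst (c₀ / (Fintype.card J + 1)))) ^ (Fintype.card J + 1) := by
  set κ : ℝ := (Fintype.card J : ℝ) + 1 with hκ
  have hκ0 : 0 < κ := by positivity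
  set γ := c₀ / κ with hγ
  have hγ0 : 0 < γ := by positivity
  -- The maximum distance exceeds the average of the coordinate distances, so the exponential is
  -- dominated by a product over coordinates, each with the rate c₀ divided by their number. The sum
  -- over the box then factorises.
  have hpt : ∀ z : ℕ × (∀ j, Fin (d j)), Real.exp (-(c₀ * max ((dist z.1 z.2 : ℝ) - r) 0)) ≤
      Real.exp (-(γ * max (((t - (z.1 : ℤ)).natAbs : ℝ) - r) 0)) *
      ∏ j, Real.exp (-(γ * max (((c j - (z.2 j : ℤ)).natAbs : ℝ) - r) 0)) := by
    intro z
    rw [← Real.exp_sum, ← Real.exp_add, Real.exp_le_exp, Finset.sum_neg_distrib, ← Finset.mul_sum]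
    set X := max ((dist z.1 z.2 : ℝ) - r) 0 with hX
    have h1 : max (((t - (z.1 : ℤ)).natAbs : ℝ) - r) 0 ≤ X :=
      max_le_max (sub_le_sub_right (by exact_mod_cast hdt _ _) _) le_rfl
    have h2 : ∑ j, max (((c j - (z.2 j : ℤ)).natAbs : ℝ) - r) 0 ≤ Fintype.card J * X := by
      refine (Finset.sum_le_card_nsmul _ _ X fun j _ => ?_).trans (by simp)
      exact max_le_max (sub_le_sub_right (by exact_mod_cast hdc _ _ _) _) le_rfl
    have h3 : c₀ = γ * κ := by rw [hγ]; field_simp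
    rw [h3, hκ]
    have := mul_le_mul_of_nonneg_left (add_le_add h1 h2) hγ0.le
    linarith
  refine (Finset.sum_le_sum fun z _ => hpt z).trans ?_
  rw [Finset.sum_product, pow_succ']
  simp only
  simp_rw [← Finset.mul_sum]
  rw [← Finset.sum_mul]
  have e : ∑ c' : (∀ j, Fin (d j)), ∏ j, Real.exp (-(γ * max (((c j - (c' j : ℤ)).natAbs : ℝ) - r) 0)) =
      ∏ j, ∑ x : Fin (d j), Real.exp (-(γ * max (((c j - (x : ℤ)).natAbs : ℝ) - r) 0)) := by
    rw [Finset.prod_univ_sum, Fintype.piFinset_univ]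
  rw [e]
  refine mul_le_mul (sum_Icc_exp_natAbs_le n t hγ0 hr) ?_
    (Finset.prod_nonneg fun _ _ => Finset.sum_nonneg fun _ _ => (Real.exp_pos _).le)
    (by have := expSumConst_pos hγ0; positivity)
  refine (Finset.prod_le_prod (fun _ _ => Finset.sum_nonneg fun _ _ => (Real.exp_pos _).le)
    fun j _ => sum_univ_exp_natAbs_le (d j) (c j) hγ0 hr).trans ?_
  simp

/-! ### Second moments of averages and splitting of the perturbation. -/

section VarianceBounds

variable {Ω : Type*} [MeasurableSpace Ω] {P : Measure Ω} [IsProbabilityMeasure P]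

/-- Schur's test for the covariance matrix: a_s a_{s'} is at most (a_s² + a_{s'}²)/2, and by
symmetry both halves give the same row sums. -/
theorem variance_weighted_sum_le {β : Type*} (S : Finset β) {X : β → Ω → ℝ}
    (hX : ∀ s ∈ S, MemLp (X s) 2 P) (a : β → ℝ) {C : ℝ}
    (h : ∀ s ∈ S, ∑ s' ∈ S, |cov[X s, X s'; P]| ≤ C) :
    Var[fun ω => ∑ s ∈ S, a s * X s ω; P] ≤ C * ∑ s ∈ S, a s ^ 2 := by
  rw [variance_fun_sum' fun s hs => (hX s hs).const_mul (a s)]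
  calc ∑ s ∈ S, ∑ s' ∈ S, cov[fun ω => a s * X s ω, fun ω => a s' * X s' ω; P]
      ≤ ∑ s ∈ S, ∑ s' ∈ S, (a s ^ 2 / 2 * |cov[X s, X s'; P]| +
          a s' ^ 2 / 2 * |cov[X s', X s; P]|) := by
        refine Finset.sum_le_sum fun s _ => Finset.sum_le_sum fun s' _ => ?_
        rw [covariance_const_mul_left, covariance_const_mul_right, covariance_comm (X s'),
          ← add_mul, ← mul_assoc]
        refine (le_abs_self _).trans ?_
        rw [abs_mul]
        refine mul_le_mul_of_nonneg_right ?_ (abs_nonneg _)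
        rw [abs_le]
        constructor <;> nlinarith [sq_nonneg (a s - a s'), sq_nonneg (a s + a s')]
    _ = ∑ s ∈ S, a s ^ 2 * ∑ s' ∈ S, |cov[X s, X s'; P]| := by
        simp_rw [Finset.sum_add_distrib]
        rw [Finset.sum_comm (f := fun s s' => a s' ^ 2 / 2 * |cov[X s', X s; P]|),
          ← Finset.sum_add_distrib]
        refine Finset.sum_congr rfl fun s _ => ?_
        rw [← Finset.mul_sum]; ring
    _ ≤ ∑ s ∈ S, a s ^ 2 * C :=
        Finset.sum_le_sum fun s hs => mul_le_mul_of_nonneg_left (h s hs) (sq_nonneg _)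
    _ = _ := by rw [← Finset.sum_mul, mul_comm]

theorem variance_mean_le {β : Type*} (S : Finset β) {X : β → Ω → ℝ} {N : ℝ}
    (hN : N = S.card) (hN0 : 0 < N) (hX : ∀ s ∈ S, MemLp (X s) 2 P) {C : ℝ}
    (h : ∀ s ∈ S, ∑ s' ∈ S, |cov[X s, X s'; P]| ≤ C) :
    Var[fun ω => N⁻¹ * ∑ s ∈ S, X s ω; P] ≤ C / N := by
  have := variance_weighted_sum_le S hX (fun _ => N⁻¹) h
  simp_rw [← Finset.mul_sum] at this
  refine this.trans (le_of_eq ?_)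
  rw [Finset.sum_const, nsmul_eq_mul, ← hN]
  field_simp

/-- Variance plus squared mean, the latter by Cauchy–Schwarz. It is applied to the cross terms of
signal and error, where the weights are the signal and B bounds the truncation bias. -/
theorem integral_sq_weighted_mean_le {β : Type*} (S : Finset β) {X : β → Ω → ℝ} {N b C₁ C₃ B : ℝ}
    (hN : N = S.card) (hN0 : 0 < N) (hX : ∀ s ∈ S, Measurable (X s))
    (hXb : ∀ s ∈ S, ∀ ω, |X s ω| ≤ b) (hC₁ : 0 ≤ C₁)
    (h : ∀ s ∈ S, ∑ s' ∈ S, |cov[X s, X s'; P]| ≤ C₁) (a : β → ℝ)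
    (ha : ∑ s ∈ S, a s ^ 2 ≤ C₃ * N) (hB : ∀ s ∈ S, |∫ ω, X s ω ∂P| ≤ B) :
    MemLp (fun ω => N⁻¹ * ∑ s ∈ S, X s ω * a s) 2 P ∧
    ∫ ω, (N⁻¹ * ∑ s ∈ S, X s ω * a s) ^ 2 ∂P ≤ C₁ * C₃ / N + B ^ 2 * C₃ := by
  have hL : ∀ s ∈ S, MemLp (X s) 2 P := fun s hs => memLp_of_abs_le (hX s hs) (hXb s hs) 2
  have hL1 : ∀ s ∈ S, Integrable (X s) P := fun s hs => integrable_of_abs_le (hX s hs) (hXb s hs)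
  have e : (fun ω => N⁻¹ * ∑ s ∈ S, X s ω * a s) = fun ω => ∑ s ∈ S, (N⁻¹ * a s) * X s ω := by
    ext ω; rw [Finset.mul_sum]; exact Finset.sum_congr rfl fun s _ => by ring
  have hmem : MemLp (fun ω => N⁻¹ * ∑ s ∈ S, X s ω * a s) 2 P := by
    rw [e]; exact memLp_finsetSum S fun s hs => (hL s hs).const_mul _
  refine ⟨hmem, ?_⟩
  have hv := variance_eq_sub hmem
  simp only [Pi.pow_apply] at hv
  have h1 : Var[fun ω => N⁻¹ * ∑ s ∈ S, X s ω * a s; P] ≤ C₁ * C₃ / N := by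
    rw [e]
    refine (variance_weighted_sum_le S hL _ h).trans ?_
    simp_rw [mul_pow]
    rw [← Finset.mul_sum]
    calc C₁ * (N⁻¹ ^ 2 * ∑ s ∈ S, a s ^ 2) ≤ C₁ * (N⁻¹ ^ 2 * (C₃ * N)) := by gcongr
      _ = _ := by field_simp
  have h2 : (∫ ω, N⁻¹ * ∑ s ∈ S, X s ω * a s ∂P) ^ 2 ≤ B ^ 2 * C₃ := by
    rw [e, integral_finsetSum S fun s hs => (hL1 s hs).const_mul _]
    simp_rw [integral_const_mul]
    refine (Finset.sum_mul_sq_le_sq_mul_sq S (fun s => N⁻¹ * a s) _).trans ?_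
    have e1 : ∑ s ∈ S, (N⁻¹ * a s) ^ 2 ≤ N⁻¹ ^ 2 * (C₃ * N) := by
      simp_rw [mul_pow]; rw [← Finset.mul_sum]; gcongr
    have e2 : ∑ s ∈ S, (∫ ω, X s ω ∂P) ^ 2 ≤ N * B ^ 2 := by
      rw [hN, ← nsmul_eq_mul]
      refine Finset.sum_le_card_nsmul _ _ _ fun s hs => ?_
      rw [← sq_abs]; exact pow_le_pow_left₀ (abs_nonneg _) (hB s hs) 2
    have e3 : 0 ≤ N⁻¹ ^ 2 * (C₃ * N) := le_trans (Finset.sum_nonneg fun _ _ => sq_nonneg _) e1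
    calc _ ≤ N⁻¹ ^ 2 * (C₃ * N) * (N * B ^ 2) :=
          mul_le_mul e1 e2 (Finset.sum_nonneg fun _ _ => sq_nonneg _) e3
      _ = _ := by field_simp
  linarith

/-- The perturbation of a signal Gram matrix by weakly dependent errors `e` is the sum of a random
matrix that is small in mean square and a deterministic matrix with bounded row sums. -/
theorem exists_bilinBound_perturbation {q : ℕ} {β : Type*} (S : Finset β) {e : Fin q → β → Ω → ℝ}
    {χ : Fin q → β → ℝ} {N b C₁ C₃ B V D : ℝ} (hN : N = S.card) (hN0 : 0 < N)
    (he : ∀ i, ∀ s ∈ S, Measurable (e i s)) (heb : ∀ i, ∀ s ∈ S, ∀ ω, |e i s ω| ≤ b)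
    (hC₁ : 0 ≤ C₁) (h₁ : ∀ i, ∀ s ∈ S, ∑ s' ∈ S, |cov[e i s, e i s'; P]| ≤ C₁)
    (hχ : ∀ j, ∑ s ∈ S, χ j s ^ 2 ≤ C₃ * N)
    (hB : ∀ i, ∀ s ∈ S, |∫ ω, e i s ω ∂P| ≤ B)
    (hD0 : 0 ≤ D) (hD : ∀ i, ∑ j, |N⁻¹ * ∑ s ∈ S, ∫ ω, e i s ω * e j s ω ∂P| ≤ D)
    (hV : ∑ i, ∑ j, Var[fun ω => N⁻¹ * ∑ s ∈ S, e i s ω * e j s ω; P] ≤ V) :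
    ∃ W : Ω → ℝ, Integrable W P ∧ (∀ ω, 0 ≤ W ω) ∧
      ∫ ω, W ω ∂P ≤ 3 * (2 * q ^ 2 * (C₁ * C₃ / N + B ^ 2 * C₃) + V) ∧
      ∀ ω, BilinBound (Matrix.of fun i j =>
        N⁻¹ * ∑ s ∈ S, (e i s ω * χ j s + χ i s * e j s ω + e i s ω * e j s ω)) (√(W ω) + D) := by
  set A : Fin q → Fin q → Ω → ℝ := fun i j ω => N⁻¹ * ∑ s ∈ S, e i s ω * χ j s with hA
  set Y : Fin q → Fin q → Ω → ℝ := fun i j ω => N⁻¹ * ∑ s ∈ S, e i s ω * e j s ω with hY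
  set M : Matrix (Fin q) (Fin q) ℝ :=
    Matrix.of fun i j => N⁻¹ * ∑ s ∈ S, ∫ ω, e i s ω * e j s ω ∂P with hM
  have hprod : ∀ i j, ∀ s ∈ S, MemLp (fun ω => e i s ω * e j s ω) 2 P := fun i j s hs =>
    memLp_of_abs_le (A := b * b) ((he i s hs).mul (he j s hs)) (fun ω => by
      rw [Pi.mul_apply, abs_mul]
      exact mul_le_mul (heb i s hs ω) (heb j s hs ω) (abs_nonneg _)
        ((abs_nonneg _).trans (heb i s hs ω))) 2
  have hYL : ∀ i j, MemLp (Y i j) 2 P := fun i j =>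
    (memLp_finsetSum S (hprod i j)).const_mul _
  have hYM : ∀ i j, ∫ ω, Y i j ω ∂P = M i j := fun i j => by
    simp only [hY, hM, Matrix.of_apply]
    rw [integral_const_mul, integral_finsetSum S fun s hs =>
      (hprod i j s hs).integrable one_le_two]
  have hAA := fun i j => integral_sq_weighted_mean_le S hN hN0 (he i) (heb i) hC₁ (h₁ i) (χ j)
    (hχ j) (hB i)
  have hYML : ∀ i j, MemLp (fun ω => Y i j ω - M i j) 2 P := fun i j =>
    (hYL i j).sub (memLp_const _)
  have hYvar : ∀ i j, ∫ ω, (Y i j ω - M i j) ^ 2 ∂P = Var[Y i j; P] := fun i j => by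
    rw [variance_eq_integral (hYL i j).aemeasurable, hYM]
  -- The squared Frobenius norm of the cross terms together with the centred error products. The
  -- mean M is kept apart and treated by its row sums.
  set W : Ω → ℝ := fun ω => ∑ i, ∑ j, (A i j ω + A j i ω + (Y i j ω - M i j)) ^ 2 with hW
  have hZL : ∀ i j, MemLp (fun ω => A i j ω + A j i ω + (Y i j ω - M i j)) 2 P := fun i j =>
    ((hAA i j).1.add (hAA j i).1).add (hYML i j)
  refine ⟨W, ?_, fun ω => by positivity, ?_, fun ω => ?_⟩
  · exact integrable_finsetSum _ fun i _ => integrable_finsetSum _ fun j _ =>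
      (hZL i j).integrable_sq
  · simp only [hW]
    rw [integral_finsetSum _ fun i _ => integrable_finsetSum _ fun j _ =>
      (hZL i j).integrable_sq]
    simp_rw [integral_finsetSum _ fun j _ => (hZL _ j).integrable_sq]
    have hterm : ∀ i j, ∫ ω, (A i j ω + A j i ω + (Y i j ω - M i j)) ^ 2 ∂P ≤
        3 * (2 * (C₁ * C₃ / N + B ^ 2 * C₃)) + 3 * Var[Y i j; P] := by
      intro i j
      calc ∫ ω, (A i j ω + A j i ω + (Y i j ω - M i j)) ^ 2 ∂P
          ≤ ∫ ω, (3 * (A i j ω ^ 2 + A j i ω ^ 2) + 3 * (Y i j ω - M i j) ^ 2) ∂P := by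
            refine integral_mono (hZL i j).integrable_sq ((((hAA i j).1.integrable_sq.add
              (hAA j i).1.integrable_sq).const_mul 3).add
              ((hYML i j).integrable_sq.const_mul 3)) fun ω => ?_
            simp only
            nlinarith [sq_nonneg (A i j ω - A j i ω), sq_nonneg (A i j ω - (Y i j ω - M i j)),
              sq_nonneg (A j i ω - (Y i j ω - M i j))]
        _ = 3 * (∫ ω, A i j ω ^ 2 ∂P + ∫ ω, A j i ω ^ 2 ∂P) + 3 * Var[Y i j; P] := by
            have i1 : Integrable (fun ω => A i j ω ^ 2) P := (hAA i j).1.integrable_sq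
            have i2 : Integrable (fun ω => A j i ω ^ 2) P := (hAA j i).1.integrable_sq
            have i3 : Integrable (fun ω => 3 * (A i j ω ^ 2 + A j i ω ^ 2)) P :=
              (i1.add i2).const_mul 3
            have i4 : Integrable (fun ω => 3 * (Y i j ω - M i j) ^ 2) P :=
              (hYML i j).integrable_sq.const_mul 3
            rw [integral_add i3 i4, integral_const_mul, integral_const_mul, integral_add i1 i2,
              hYvar]
        _ ≤ _ := by
            have := (hAA i j).2
            have := (hAA j i).2
            linarith
    calc _ ≤ ∑ i : Fin q, ∑ j : Fin q,
          (3 * (2 * (C₁ * C₃ / N + B ^ 2 * C₃)) + 3 * Var[Y i j; P]) :=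
          Finset.sum_le_sum fun i _ => Finset.sum_le_sum fun j _ => hterm i j
      _ = 3 * (2 * q ^ 2 * (C₁ * C₃ / N + B ^ 2 * C₃)) + 3 * ∑ i, ∑ j, Var[Y i j; P] := by
          simp_rw [Finset.sum_add_distrib, ← Finset.mul_sum]
          simp; ring
      _ ≤ _ := by linarith
  · have hsplit : (Matrix.of fun i j =>
        N⁻¹ * ∑ s ∈ S, (e i s ω * χ j s + χ i s * e j s ω + e i s ω * e j s ω)) =
        (Matrix.of fun i j => A i j ω + A j i ω + (Y i j ω - M i j)) + M := by
      ext i j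
      simp only [Matrix.of_apply, Matrix.add_apply, hA, hY]
      rw [Finset.sum_add_distrib, Finset.sum_add_distrib]
      simp_rw [mul_comm (χ i _)]
      ring
    rw [hsplit]
    refine (bilinBound_of_sum_sq _).add (bilinBound_of_row_col_sums M hD0 hD fun j => ?_)
    -- M is symmetric, so its column sums are its row sums.
    convert hD j using 4 with i
    simp only [hM, Matrix.of_apply, mul_comm]

end VarianceBounds

/-! ### Unfoldings of Tucker products and the signal-plus-perturbation identity. -/

section Unfolding

variable {K : ℕ}

/-- The index of a tensor entry with mode-`k` index `i` and remaining indices `c`. -/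
def fullIdx {p : Fin K → ℕ} (k : Fin K) (i : Fin (p k)) (c : ∀ j : {j : Fin K // j ≠ k}, Fin (p j)) :
    ∀ j, Fin (p j) :=
  (Equiv.piSplitAt k fun j => Fin (p j)).symm (i, c)

theorem fullIdx_self {p : Fin K → ℕ} (k : Fin K) (i : Fin (p k))
    (c : ∀ j : {j : Fin K // j ≠ k}, Fin (p j)) : fullIdx k i c k = i := by
  simp [fullIdx, Equiv.piSplitAt]

theorem fullIdx_of_ne {p : Fin K → ℕ} (k : Fin K) (i : Fin (p k))
    (c : ∀ j : {j : Fin K // j ≠ k}, Fin (p j)) (j : {j : Fin K // j ≠ k}) :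
    fullIdx k i c j = c j := by
  simp [fullIdx, Equiv.piSplitAt, j.2]

theorem fullIdx_inj {p : Fin K → ℕ} (k : Fin K) {i i' : Fin (p k)}
    {c c' : ∀ j : {j : Fin K // j ≠ k}, Fin (p j)} :
    fullIdx k i c = fullIdx k i' c' ↔ i = i' ∧ c = c' := by
  rw [fullIdx, fullIdx, Equiv.apply_eq_iff_eq, Prod.mk.injEq]

theorem mat_apply {d : Fin K → ℕ} (k : Fin K) (X : Tensor d) (i : Fin (d k))
    (c : ∀ j : {j : Fin K // j ≠ k}, Fin (d j)) : mat k X i c = X (fullIdx k i c) := rfl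

/-- The Kronecker product of the loading matrices of all modes but the `k`-th. -/
def loadingProd {r p : Fin K → ℕ} (Λ : ∀ k, Matrix (Fin (p k)) (Fin (r k)) ℝ) (k : Fin K) :
    Matrix (∀ j : {j : Fin K // j ≠ k}, Fin (p j)) (∀ j : {j : Fin K // j ≠ k}, Fin (r j)) ℝ :=
  Matrix.of fun c d => ∏ j : {j : Fin K // j ≠ k}, Λ j (c j) (d j)

theorem mat_tucker {r p : Fin K → ℕ} (F : Tensor r) (Λ : ∀ k, Matrix (Fin (p k)) (Fin (r k)) ℝ)
    (k : Fin K) : mat k (tucker F Λ) = Λ k * mat k F * (loadingProd Λ k).transpose := by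
  ext i c
  rw [mat_apply, tucker, ← (Equiv.piSplitAt k fun j => Fin (r j)).symm.sum_comp,
    Fintype.sum_prod_type_right, Matrix.mul_apply]
  refine Finset.sum_congr rfl fun d _ => ?_
  rw [Matrix.mul_apply, Finset.sum_mul]
  refine Finset.sum_congr rfl fun a _ => ?_
  rw [mat_apply, Fintype.prod_eq_mul_prod_subtype_ne _ k, Matrix.transpose_apply, loadingProd,
    Matrix.of_apply]
  change F (fullIdx k a d) * (Λ k (fullIdx k i c k) (fullIdx k a d k) *
    ∏ j : {j : Fin K // j ≠ k}, Λ j (fullIdx k i c j) (fullIdx k a d j)) = _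
  simp_rw [fullIdx_self, fullIdx_of_ne]
  ring

theorem dimExcept_eq_prod_subtype (p : Fin K → ℕ) (k : Fin K) :
    dimExcept p k = ∏ j : {j : Fin K // j ≠ k}, p j := by
  rw [dimExcept]
  exact Finset.prod_subtype _ (by simp) _

theorem card_columns (p : Fin K → ℕ) (k : Fin K) :
    Fintype.card (∀ j : {j : Fin K // j ≠ k}, Fin (p j)) = dimExcept p k := by
  rw [Fintype.card_pi, dimExcept_eq_prod_subtype]; simp

/-- The sum over column multi-indices of a product factorises over the modes, and a single mode
where d and d' differ makes the product vanish. -/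
theorem loadingProd_transpose_mul_self {r p : Fin K → ℕ}
    (Λ : ∀ k, Matrix (Fin (p k)) (Fin (r k)) ℝ)
    (hΛ : ∀ k, (Λ k).transpose * Λ k = (p k : ℝ) • (1 : Matrix (Fin (r k)) (Fin (r k)) ℝ))
    (k : Fin K) : (loadingProd Λ k).transpose * loadingProd Λ k = (dimExcept p k : ℝ) • 1 := by
  ext d d'
  rw [Matrix.mul_apply]
  simp only [Matrix.transpose_apply, loadingProd, Matrix.of_apply, ← Finset.prod_mul_distrib]
  have e := Finset.prod_univ_sum (fun _ : {j : Fin K // j ≠ k} => Finset.univ)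
    (fun (j : {j : Fin K // j ≠ k}) (x : Fin (p j)) => Λ j x (d j) * Λ j x (d' j))
  rw [Fintype.piFinset_univ] at e
  rw [← e]
  have h : ∀ j : {j : Fin K // j ≠ k}, ∑ x : Fin (p j), Λ j x (d j) * Λ j x (d' j) =
      (p j : ℝ) * (if d j = d' j then 1 else 0) := fun j => by
    have := congrFun (congrFun (hΛ j) (d j)) (d' j)
    rw [Matrix.mul_apply] at this
    simpa [Matrix.one_apply] using this
  simp_rw [h]
  rw [Finset.prod_mul_distrib, dimExcept_eq_prod_subtype, Matrix.smul_apply, Matrix.one_apply,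
    smul_eq_mul]
  push_cast
  congr 1
  by_cases hd : d = d'
  · subst hd; simp
  · rw [if_neg hd]
    obtain ⟨j, hj⟩ := Function.ne_iff.mp hd
    exact Finset.prod_eq_zero (Finset.mem_univ j) (by rw [if_neg hj])

/-- Sites of the columns of all unfolded observations. -/
def columnSites (n : ℕ) (p : Fin K → ℕ) (k : Fin K) :
    Finset (ℕ × (∀ j : {j : Fin K // j ≠ k}, Fin (p j))) :=
  Finset.Icc 1 n ×ˢ Finset.univ

theorem card_columnSites (n : ℕ) (p : Fin K → ℕ) (k : Fin K) :
    ((columnSites n p k).card : ℝ) = n * dimExcept p k := by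
  rw [columnSites, Finset.card_product, Nat.card_Icc, Finset.card_univ, card_columns]
  push_cast; simp

/-- The common component at a column site. -/
def signal {r p : Fin K → ℕ} (F : ℕ → Tensor r) (Λ : ∀ k, Matrix (Fin (p k)) (Fin (r k)) ℝ)
    (k : Fin K) (i : Fin (p k)) (s : ℕ × (∀ j : {j : Fin K // j ≠ k}, Fin (p j))) : ℝ :=
  tucker (F s.1) Λ (fullIdx k i s.2)

/-- Expanding (χ + e)(χ + e)ᵀ. The signal part is exactly ΛGΛᵀ, since the Kronecker product of the
other loadings has Gram matrix p_{-k} times the identity. -/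
theorem truncGram_obs_eq {r p : Fin K → ℕ} (n : ℕ) (F : ℕ → Tensor r)
    (Λ : ∀ k, Matrix (Fin (p k)) (Fin (r k)) ℝ)
    (hΛ : ∀ k, (Λ k).transpose * Λ k = (p k : ℝ) • (1 : Matrix (Fin (r k)) (Fin (r k)) ℝ))
    (x : (Fin K → ℕ) → ℤ → ℝ) (τ : ℝ) (k : Fin K) (hd : 0 < dimExcept p k) :
    truncGram n (fun t => obs (F t) Λ fun i => x i t) τ k =
      Λ k * factorGram n F k * (Λ k).transpose + Matrix.of fun i j =>
        ((n : ℝ) * dimExcept p k)⁻¹ * ∑ s ∈ columnSites n p k,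
          (truncErr τ (signal F Λ k i s) (x (pos (fullIdx k i s.2)) s.1) * signal F Λ k j s +
            signal F Λ k i s * truncErr τ (signal F Λ k j s) (x (pos (fullIdx k j s.2)) s.1) +
            truncErr τ (signal F Λ k i s) (x (pos (fullIdx k i s.2)) s.1) *
              truncErr τ (signal F Λ k j s) (x (pos (fullIdx k j s.2)) s.1)) := by
  have hd' : (dimExcept p k : ℝ) ≠ 0 := by exact_mod_cast hd.ne'
  have hsig : Λ k * factorGram n F k * (Λ k).transpose = ((n : ℝ) * dimExcept p k)⁻¹ •
      ∑ t ∈ Finset.Icc 1 n, mat k (tucker (F t) Λ) * (mat k (tucker (F t) Λ)).transpose := by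
    have : ∀ t, mat k (tucker (F t) Λ) * (mat k (tucker (F t) Λ)).transpose =
        (dimExcept p k : ℝ) • (Λ k * (mat k (F t) * (mat k (F t)).transpose) *
          (Λ k).transpose) := by
      intro t
      rw [mat_tucker, Matrix.transpose_mul, Matrix.transpose_mul, Matrix.transpose_transpose]
      calc _ = Λ k * (mat k (F t) * ((loadingProd Λ k).transpose * loadingProd Λ k) *
            (mat k (F t)).transpose) * (Λ k).transpose := by simp only [Matrix.mul_assoc]
        _ = _ := by
          rw [loadingProd_transpose_mul_self Λ hΛ]
          simp
    simp_rw [this]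
    rw [← Finset.smul_sum, smul_smul, factorGram, Matrix.mul_smul, Matrix.smul_mul,
      Matrix.mul_sum, Matrix.sum_mul, mul_inv, mul_assoc, inv_mul_cancel₀ hd', mul_one]
  rw [hsig]
  ext i j
  rw [truncGram, Matrix.add_apply, Matrix.of_apply, Matrix.smul_apply, Matrix.smul_apply,
    smul_eq_mul, smul_eq_mul, ← mul_add, Matrix.sum_apply, Matrix.sum_apply, columnSites,
    Finset.sum_product, ← Finset.sum_add_distrib]
  congr 1
  refine Finset.sum_congr rfl fun t _ => ?_
  rw [Matrix.mul_apply, Matrix.mul_apply, ← Finset.sum_add_distrib]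
  refine Finset.sum_congr rfl fun c _ => ?_
  simp only [Matrix.transpose_apply, mat_apply, obs, signal, truncErr]
  ring

/-- Cauchy–Schwarz over the entries of F. The absolute value of L is taken because L may be negative
when there are no entries to bound. -/
theorem abs_tucker_le {r p : Fin K → ℕ} (F : Tensor r)
    (Λ : ∀ k, Matrix (Fin (p k)) (Fin (r k)) ℝ) {L : ℝ} (hL : ∀ k i j, |Λ k i j| ≤ L)
    (i : ∀ k, Fin (p k)) :
    |tucker F Λ i| ≤ |L| ^ K * √(Fintype.card (∀ k, Fin (r k))) * tnorm F := by
  calc |tucker F Λ i| ≤ ∑ j : (∀ k, Fin (r k)), |F j| * |L| ^ K := by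
        refine (Finset.abs_sum_le_sum_abs _ _).trans (Finset.sum_le_sum fun j _ => ?_)
        rw [abs_mul, Finset.abs_prod]
        refine mul_le_mul_of_nonneg_left ?_ (abs_nonneg _)
        refine (Finset.prod_le_prod (fun _ _ => abs_nonneg _) fun k _ =>
          (hL k _ _).trans (le_abs_self L)).trans ?_
        simp
    _ = |L| ^ K * ∑ j, 1 * |F j| := by rw [← Finset.sum_mul, mul_comm]; simp
    _ ≤ |L| ^ K * (√(Fintype.card (∀ k, Fin (r k))) * tnorm F) := by
        refine mul_le_mul_of_nonneg_left ?_ (by positivity)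
        have h := Real.sum_mul_le_sqrt_mul_sqrt Finset.univ (fun _ => (1 : ℝ)) (fun j => |F j|)
        simpa [tnorm] using h
    _ = _ := by ring

theorem sum_signal_sq_le {r p : Fin K → ℕ} (n : ℕ) (F : ℕ → Tensor r)
    (Λ : ∀ k, Matrix (Fin (p k)) (Fin (r k)) ℝ) {L w : ℝ} (hn : 0 < n)
    (hL : ∀ t i, |tucker (F t) Λ i| ≤ L * tnorm (F t))
    (hF : (n : ℝ)⁻¹ * ∑ t ∈ Finset.Icc 1 n, tnorm (F t) ^ (2 : ℝ) ≤ w ^ (2 : ℝ)) (k : Fin K)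
    (i : Fin (p k)) :
    ∑ s ∈ columnSites n p k, signal F Λ k i s ^ 2 ≤ L ^ 2 * w ^ 2 * (n * dimExcept p k) := by
  have hn' : (0 : ℝ) < n := by exact_mod_cast hn
  simp only [Real.rpow_two] at hF
  rw [inv_mul_le_iff₀ hn'] at hF
  rw [columnSites, Finset.sum_product]
  calc _ ≤ ∑ t ∈ Finset.Icc 1 n, ∑ _c : (∀ j : {j : Fin K // j ≠ k}, Fin (p j)),
        L ^ 2 * tnorm (F t) ^ 2 := by
        refine Finset.sum_le_sum fun t _ => Finset.sum_le_sum fun c _ => ?_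
        rw [← sq_abs, ← mul_pow]
        exact pow_le_pow_left₀ (abs_nonneg _) (hL t _) 2
    _ = dimExcept p k * L ^ 2 * ∑ t ∈ Finset.Icc 1 n, tnorm (F t) ^ 2 := by
        simp only [Finset.sum_const, Finset.card_univ, card_columns, nsmul_eq_mul]
        rw [Finset.mul_sum]
        exact Finset.sum_congr rfl fun t _ => by ring
    _ ≤ dimExcept p k * L ^ 2 * (n * w ^ 2) := by gcongr
    _ = _ := by ring

end Unfolding

/-! ### From mixing coefficients to inequalities for events. -/

section Mixing

variable {Ω : Type*} {𝒜 ℬ : MeasurableSpace Ω} [m0 : MeasurableSpace Ω] {P : Measure Ω}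
  [IsProbabilityMeasure P]

theorem abs_real_inter_sub_le_one (S T : Set Ω) :
    |P.real (S ∩ T) - P.real S * P.real T| ≤ 1 := by
  have h1 : P.real (S ∩ T) ≤ 1 := measureReal_le_one
  have h2 : P.real S ≤ 1 := measureReal_le_one
  have h3 : P.real T ≤ 1 := measureReal_le_one
  have h4 : 0 ≤ P.real (S ∩ T) := measureReal_nonneg
  have h5 : 0 ≤ P.real S := measureReal_nonneg
  have h6 : 0 ≤ P.real T := measureReal_nonneg
  have h7 : P.real S * P.real T ≤ 1 := mul_le_one₀ h2 h6 h3
  have h8 := mul_nonneg h5 h6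
  rw [abs_le]; constructor <;> linarith

theorem alphaMix_le_one : alphaMix P 𝒜 ℬ ≤ 1 := by
  refine Real.sSup_le ?_ zero_le_one
  rintro x ⟨S, T, -, -, rfl⟩
  exact abs_real_inter_sub_le_one (P := P) S T

theorem le_alphaMix {S T : Set Ω} (hS : MeasurableSet[𝒜] S)
    (hT : MeasurableSet[ℬ] T) :
    |P.real (S ∩ T) - P.real S * P.real T| ≤ alphaMix P 𝒜 ℬ := by
  refine le_csSup ⟨1, ?_⟩ ⟨S, T, hS, hT, rfl⟩
  rintro x ⟨S, T, -, -, rfl⟩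
  exact abs_real_inter_sub_le_one (P := P) S T

/-- The earlier of the two times belongs to the past and the later one to the future at gap |t - u|.
The estimate is symmetric in the two events, so the order of t and u is immaterial. -/
theorem abs_real_inter_sub_le_of_seriesAlpha {Y : ℤ → Ω → ℝ} {c₀ : ℝ}
    (h : ∀ m : ℕ, seriesAlpha P Y m ≤ Real.exp (-(c₀ * m))) (t u : ℤ) {S T : Set Ω}
    (hS : MeasurableSet[MeasurableSpace.comap (Y t) inferInstance] S)
    (hT : MeasurableSet[MeasurableSpace.comap (Y u) inferInstance] T) :
    |P.real (S ∩ T) - P.real S * P.real T| ≤ Real.exp (-(c₀ * (t - u).natAbs)) := by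
  have key : ∀ (t u : ℤ) (S T : Set Ω), t ≤ u →
      MeasurableSet[MeasurableSpace.comap (Y t) inferInstance] S →
      MeasurableSet[MeasurableSpace.comap (Y u) inferInstance] T →
      |P.real (S ∩ T) - P.real S * P.real T| ≤ Real.exp (-(c₀ * (t - u).natAbs)) := by
    intro t u S T htu hS hT
    obtain ⟨m, hm⟩ : ∃ m, m = (t - u).natAbs := ⟨_, rfl⟩
    rw [← hm]
    refine le_trans ?_ (h m)
    refine (le_alphaMix (P := P) (𝒜 := ⨆ v : {v : ℤ // v ≤ t}, MeasurableSpace.comap (Y v)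
      inferInstance) (ℬ := ⨆ v : {v : ℤ // t + (m : ℕ) ≤ v},
        MeasurableSpace.comap (Y v) inferInstance) ?_ ?_).trans
      (le_ciSup (f := fun t : ℤ => alphaMix P
        (⨆ v : {v : ℤ // v ≤ t}, MeasurableSpace.comap (Y v) inferInstance)
        (⨆ v : {v : ℤ // t + (m : ℕ) ≤ v},
          MeasurableSpace.comap (Y v) inferInstance)) ⟨1, ?_⟩ t)
    · exact le_iSup (fun v : {v : ℤ // v ≤ t} => MeasurableSpace.comap (Y v) inferInstance)
        ⟨t, le_rfl⟩ S hS
    · exact le_iSup (fun v : {v : ℤ // t + (m : ℕ) ≤ v} =>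
        MeasurableSpace.comap (Y v) inferInstance) ⟨u, by omega⟩ T hT
    · rintro x ⟨t, rfl⟩
      exact alphaMix_le_one
  rcases le_total t u with htu | htu
  · exact key t u S T htu hS hT
  · have := key u t T S htu hT hS
    rwa [Set.inter_comm, mul_comm, show (u - t).natAbs = (t - u).natAbs by omega] at this

theorem abs_real_inter_sub_le_of_fieldAlpha {K : ℕ} {ξ : (Fin K → ℕ) → ℤ → Ω → ℝ} {c₀ : ℝ}
    (h : ∀ m : ℕ, fieldAlpha P ξ m ⊤ ⊤ ≤ Real.exp (-(c₀ * m)))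
    {E₁ E₂ : Set ((Fin K → ℕ) × ℤ)} {m : ℕ} (hm : ∀ a ∈ E₁, ∀ b ∈ E₂, m ≤ siteDist a b)
    {S T : Set Ω} (hS : MeasurableSet[fieldSigma ξ E₁] S) (hT : MeasurableSet[fieldSigma ξ E₂] T) :
    |P.real (S ∩ T) - P.real S * P.real T| ≤ Real.exp (-(c₀ * m)) := by
  refine (le_alphaMix (P := P) hS hT).trans (le_trans ?_ (h m))
  refine le_csSup ⟨1, ?_⟩ ⟨E₁, E₂, le_top, le_top, ?_, rfl⟩
  · rintro x ⟨E₁, E₂, -, -, -, rfl⟩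
    exact alphaMix_le_one
  · exact le_iInf₂ fun a ha => le_iInf₂ fun b hb => by exact_mod_cast hm a ha b hb

end Mixing

/-! ### Perturbation bound for a mixing random field, at fixed dimensions. -/

section SingleModel

variable {Ω : Type*} {K : ℕ} {r p : Fin K → ℕ}

/-- The idiosyncratic part of the truncated data at a column site. -/
noncomputable def noiseErr (τ : ℝ) (F : ℕ → Tensor r) (Λ : ∀ k, Matrix (Fin (p k)) (Fin (r k)) ℝ)
    (ξ : (Fin K → ℕ) → ℤ → Ω → ℝ) (k : Fin K) (i : Fin (p k))
    (s : ℕ × (∀ j : {j : Fin K // j ≠ k}, Fin (p j))) : Ω → ℝ :=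
  fun ω => truncErr τ (signal F Λ k i s) (ξ (pos (fullIdx k i s.2)) s.1 ω)

theorem measurable_noiseErr_comap {τ : ℝ} {F : ℕ → Tensor r}
    {Λ : ∀ k, Matrix (Fin (p k)) (Fin (r k)) ℝ} {ξ : (Fin K → ℕ) → ℤ → Ω → ℝ} {k : Fin K}
    (hτ : 0 < τ) (i : Fin (p k)) (s : ℕ × (∀ j : {j : Fin K // j ≠ k}, Fin (p j))) :
    Measurable[MeasurableSpace.comap (ξ (pos (fullIdx k i s.2)) s.1) inferInstance]
      (noiseErr τ F Λ ξ k i s) :=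
  (measurable_truncErr hτ _).comp (comap_measurable _)

/-- The perturbation of the truncated Gram matrix caused by the noise. -/
noncomputable def perturbation (n : ℕ) (τ : ℝ) (F : ℕ → Tensor r)
    (Λ : ∀ k, Matrix (Fin (p k)) (Fin (r k)) ℝ) (ξ : (Fin K → ℕ) → ℤ → Ω → ℝ) (k : Fin K) (ω : Ω) :
    Matrix (Fin (p k)) (Fin (p k)) ℝ :=
  Matrix.of fun i j => ((n : ℝ) * dimExcept p k)⁻¹ * ∑ s ∈ columnSites n p k,
    (noiseErr τ F Λ ξ k i s ω * signal F Λ k j s + signal F Λ k i s * noiseErr τ F Λ ξ k j s ω +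
      noiseErr τ F Λ ξ k i s ω * noiseErr τ F Λ ξ k j s ω)

/-- Row sums of the mean matrix are averages over sites, so it suffices to bound the row sum at each
single site. -/
theorem sum_mean_le {q : ℕ} {β : Type*} (S : Finset β) {N : ℝ} (hN : N = S.card) (hN0 : 0 < N)
    (f : Fin q → β → ℝ) {D : ℝ} (h : ∀ s ∈ S, ∑ j, |f j s| ≤ D) :
    ∑ j, |N⁻¹ * ∑ s ∈ S, f j s| ≤ D := by
  calc ∑ j, |N⁻¹ * ∑ s ∈ S, f j s| ≤ ∑ j, N⁻¹ * ∑ s ∈ S, |f j s| := by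
        refine Finset.sum_le_sum fun j _ => ?_
        rw [abs_mul, abs_of_pos (inv_pos.mpr hN0)]
        exact mul_le_mul_of_nonneg_left (Finset.abs_sum_le_sum_abs _ _) (inv_pos.mpr hN0).le
    _ = N⁻¹ * ∑ s ∈ S, ∑ j, |f j s| := by rw [← Finset.mul_sum, Finset.sum_comm]
    _ ≤ N⁻¹ * (N * D) := by
        refine mul_le_mul_of_nonneg_left ?_ (inv_pos.mpr hN0).le
        rw [hN, ← nsmul_eq_mul]
        exact Finset.sum_le_card_nsmul _ _ _ h
    _ = D := by field_simp

variable [m0 : MeasurableSpace Ω] {P : Measure Ω}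

/-- Moment bounds for the idiosyncratic part of the truncated data. -/
structure ErrBounds (P : Measure Ω) (τ w ε U B : ℝ) (e : Ω → ℝ) : Prop where
  measurable : Measurable e
  abs_le : ∀ ω, |e ω| ≤ 2 * τ
  moment : ∫ ω, |e ω| ^ (2 + 2 * ε) ∂P ≤ w ^ (2 + 2 * ε)
  fourth : ∫ ω, e ω ^ 4 ∂P ≤ U
  mean : |∫ ω, e ω ∂P| ≤ B

theorem ErrBounds.abs_mul_le {τ w ε U B : ℝ} {e e' : Ω → ℝ} (h : ErrBounds P τ w ε U B e)
    (h' : ErrBounds P τ w ε U B e') (ω : Ω) : |e ω * e' ω| ≤ (2 * τ) * (2 * τ) := by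
  rw [abs_mul]
  exact mul_le_mul (h.abs_le ω) (h'.abs_le ω) (abs_nonneg _) ((abs_nonneg _).trans (h.abs_le ω))

theorem ErrBounds.abs_integral_mul_integral_le {τ w ε U B : ℝ} {e e' : Ω → ℝ}
    (h : ErrBounds P τ w ε U B e) (h' : ErrBounds P τ w ε U B e') :
    |(∫ ω, e ω ∂P) * ∫ ω, e' ω ∂P| ≤ B ^ 2 := by
  rw [abs_mul, sq]
  exact mul_le_mul h.mean h'.mean (abs_nonneg _) ((abs_nonneg _).trans h.mean)

variable [IsProbabilityMeasure P]

theorem errBounds_noiseErr {τ w ε : ℝ} {F : ℕ → Tensor r}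
    {Λ : ∀ k, Matrix (Fin (p k)) (Fin (r k)) ℝ} {ξ : (Fin K → ℕ) → ℤ → Ω → ℝ} {k : Fin K}
    (hτ : 0 < τ) (hw : 0 < w) (hε : 0 < ε) (hε1 : ε < 1)
    (hξ : ∀ i t, Measurable (ξ i t))
    (hξ0 : ∀ (i : ∀ k, Fin (p k)) t, ∫ ω, ξ (pos i) t ω ∂P = 0)
    (hm : ∀ (i : ∀ k, Fin (p k)) t,
      eLpNorm (ξ (pos i) t) (ENNReal.ofReal (2 + 2 * ε)) P ≤ ENNReal.ofReal w)
    {i : Fin (p k)} {s : ℕ × (∀ j : {j : Fin K // j ≠ k}, Fin (p j))}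
    (hs : |signal F Λ k i s| ≤ τ / 2) :
    ErrBounds P τ w ε ((2 * τ) ^ (2 - 2 * ε) * w ^ (2 + 2 * ε))
      (((τ / 2) ^ (1 + 2 * ε))⁻¹ * w ^ (2 + 2 * ε)) (noiseErr τ F Λ ξ k i s) := by
  obtain ⟨h1, h2, h3⟩ := truncErr_moments (P := P) (hξ (pos (fullIdx k i s.2)) s.1) hw hε hε1
    (hm _ _) (hξ0 _ _) hτ hs
  exact ⟨(measurable_truncErr hτ _).comp (hξ _ _), fun ω => abs_truncErr_le hτ hs _, h1, h2, h3⟩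

theorem ErrBounds.memLp {τ w ε U B : ℝ} {e : Ω → ℝ} (h : ErrBounds P τ w ε U B e) :
    MemLp e 2 P := memLp_of_abs_le h.measurable h.abs_le 2

theorem ErrBounds.memLp_mul {τ w ε U B : ℝ} {e e' : Ω → ℝ} (h : ErrBounds P τ w ε U B e)
    (h' : ErrBounds P τ w ε U B e') : MemLp (fun ω => e ω * e' ω) 2 P :=
  memLp_of_abs_le (h.measurable.mul h'.measurable) (h.abs_mul_le h') 2

theorem ErrBounds.integral_mul_eq {τ w ε U B : ℝ} {e e' : Ω → ℝ} (h : ErrBounds P τ w ε U B e)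
    (h' : ErrBounds P τ w ε U B e') :
    ∫ ω, e ω * e' ω ∂P = cov[e, e'; P] + (∫ ω, e ω ∂P) * ∫ ω, e' ω ∂P := by
  rw [covariance_eq_sub h.memLp h'.memLp]; simp

/-- A squared mean is at most the second moment. A bound free of τ is what the off-diagonal
covariances under independence require. -/
theorem ErrBounds.abs_integral_mul_integral_le_moment {τ w ε U B : ℝ} {e e' : Ω → ℝ}
    (h : ErrBounds P τ w ε U B e) (h' : ErrBounds P τ w ε U B e') (hw : 0 < w) (hε : 0 < ε) :
    |(∫ ω, e ω ∂P) * ∫ ω, e' ω ∂P| ≤ 2 * w ^ 2 := by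
  have key : ∀ f : Ω → ℝ, ErrBounds P τ w ε U B f → (∫ ω, f ω ∂P) ^ 2 ≤ 2 * w ^ 2 := by
    intro f hf
    have h1 := variance_nonneg f P
    rw [variance_eq_sub hf.memLp] at h1
    have h2 := integral_sq_le_of_moment (P := P) hf.measurable hf.abs_le hw hε hf.moment
    simp only [Pi.pow_apply] at h1
    linarith
  have h1 := key e h
  have h2 := key e' h'
  rw [_root_.abs_le]
  constructor <;> nlinarith [sq_nonneg ((∫ ω, e ω ∂P) - ∫ ω, e' ω ∂P),
    sq_nonneg ((∫ ω, e ω ∂P) + ∫ ω, e' ω ∂P)]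

/-- Single errors have covariances summable over the lattice, which handles the cross terms and,
within one column, the row sums of the mean matrix. Error products have covariances at most U up to
lag ρ, so each entry has variance of order U ρ^K / N, and there are p_k² entries. -/
theorem exists_bilinBound_field {n : ℕ} {τ w ε c₀ U B C₃ ρ : ℝ} {F : ℕ → Tensor r}
    {Λ : ∀ k, Matrix (Fin (p k)) (Fin (r k)) ℝ} {ξ : (Fin K → ℕ) → ℤ → Ω → ℝ} {k : Fin K}
    (hN0 : 0 < (n : ℝ) * dimExcept p k) (hτ : 0 < τ) (hw : 0 < w) (hε : 0 < ε) (hε1 : ε < 1)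
    (hc : 0 < c₀) (hρ : 0 ≤ ρ) (hξ : ∀ i t, Measurable (ξ i t))
    (hmix : ∀ m : ℕ, fieldAlpha P ξ m ⊤ ⊤ ≤ Real.exp (-(c₀ * m)))
    (he : ∀ i, ∀ s ∈ columnSites n p k, ErrBounds P τ w ε U B (noiseErr τ F Λ ξ k i s))
    (hr : 4 * (2 * τ) ^ 4 ≤ U * Real.exp (c₀ * ρ)) (hU : 0 ≤ U)
    (hχ : ∀ j, ∑ s ∈ columnSites n p k, signal F Λ k j s ^ 2 ≤ C₃ * (n * dimExcept p k)) :
    ∃ W : Ω → ℝ, Integrable W P ∧ (∀ ω, 0 ≤ W ω) ∧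
      ∫ ω, W ω ∂P ≤ 3 * (2 * p k ^ 2 * (7 * w ^ 2 * (2 * (expSumConst (ε * c₀ / 4 / K))) ^ K * C₃ /
        (n * dimExcept p k) + B ^ 2 * C₃) +
        p k ^ 2 * (U * (2 * (ρ + expSumConst (c₀ / K))) ^ K / (n * dimExcept p k))) ∧
      ∀ ω, BilinBound (perturbation n τ F Λ ξ k ω)
        (√(W ω) + (7 * w ^ 2 * (2 * expSumConst (ε * c₀ / 4)) + p k * B ^ 2)) := by
  set S := columnSites n p k with hS
  set e := noiseErr τ F Λ ξ k with he'
  set N : ℝ := (n : ℝ) * dimExcept p k with hN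
  set γ : ℝ := ε * c₀ / 4 with hγ
  have hγ0 : 0 < γ := by positivity
  have hNS : N = S.card := (card_columnSites n p k).symm
  have hK : Fintype.card {j : Fin K // j ≠ k} + 1 = K := by
    have := Fintype.card_subtype_compl (fun j : Fin K => j = k)
    have h2 := k.pos
    simp only [Fintype.card_subtype_eq, Fintype.card_fin] at this
    have h3 : Fintype.card {j : Fin K // j ≠ k} = K - 1 := this
    omega
  have hK' : (Fintype.card {j : Fin K // j ≠ k} : ℝ) + 1 = K := by exact_mod_cast hK
  have hK0 : (0 : ℝ) < K := by exact_mod_cast k.pos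
  set site : Fin (p k) → ℕ × (∀ j : {j : Fin K // j ≠ k}, Fin (p j)) → (Fin K → ℕ) × ℤ :=
    fun i s => (pos (fullIdx k i s.2), (s.1 : ℤ)) with hsite
  -- Distance of column sites, ignoring mode k. It bounds the site distance from below whatever the
  -- two rows are, so it separates the two-point sets generating the products at s and s'.
  set dist : ℕ × (∀ j : {j : Fin K // j ≠ k}, Fin (p j)) →
      ℕ × (∀ j : {j : Fin K // j ≠ k}, Fin (p j)) → ℕ := fun s s' =>
    max (Finset.univ.sup fun j => ((s.2 j : ℤ) - (s'.2 j : ℤ)).natAbs)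
      ((s.1 : ℤ) - (s'.1 : ℤ)).natAbs with hdist
  have hcoord : ∀ i j s s' l, ((((site i s).1 l : ℕ) : ℤ) - ((site j s').1 l : ℕ)).natAbs ≤
      siteDist (site i s) (site j s') := fun i j s s' l =>
    le_max_of_le_left (Finset.le_sup
      (f := fun l => ((((site i s).1 l : ℕ) : ℤ) - ((site j s').1 l : ℕ)).natAbs)
      (Finset.mem_univ l))
  have hdist_le : ∀ i j s s', dist s s' ≤ siteDist (site i s) (site j s') := by
    intro i j s s'
    refine max_le (Finset.sup_le fun l _ => ?_) (le_max_right _ _)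
    have := hcoord i j s s' l
    simpa only [hsite, pos, fullIdx_of_ne] using this
  have hrow_le : ∀ (i j : Fin (p k)) s, ((i : ℤ) - (j : ℤ)).natAbs ≤
      siteDist (site i s) (site j s) := by
    intro i j s
    have := hcoord i j s s k
    simpa only [hsite, pos, fullIdx_self] using this
  have hσ : ∀ E : Set ((Fin K → ℕ) × ℤ), fieldSigma ξ E ≤ m0 := fun E =>
    iSup_le fun a => (hξ _ _).comap_le
  have hemeas : ∀ (E : Set ((Fin K → ℕ) × ℤ)) i s, site i s ∈ E →
      Measurable[fieldSigma ξ E] (e i s) := fun E i s hE =>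
    (measurable_noiseErr_comap hτ i s).mono
      (le_iSup (fun a : E => MeasurableSpace.comap (ξ a.1.1 a.1.2) inferInstance) ⟨_, hE⟩) le_rfl
  have hcov : ∀ i j, ∀ s ∈ S, ∀ s' ∈ S, ∀ m : ℕ, m ≤ siteDist (site i s) (site j s') →
      |cov[e i s, e j s'; P]| ≤ 7 * w ^ 2 * Real.exp (-(γ * m)) := by
    intro i j s hs s' hs' m hm
    exact abs_covariance_le_of_moment (P := P) (hσ {site i s}) (hσ {site j s'}) hc.le
      (Nat.cast_nonneg m)
      (fun A A' hA hA' => abs_real_inter_sub_le_of_fieldAlpha hmix (by simpa using hm) hA hA')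
      (hemeas _ i s rfl) (he i s hs).abs_le (hemeas _ j s' rfl) (he j s' hs').abs_le hw hε hε1
      (he i s hs).moment (he j s' hs').moment
  -- Mixing is applied to the pairs of sites in rows i and j, at column s on one side and s' on the
  -- other.
  have hcov2 : ∀ i j, ∀ s ∈ S, ∀ s' ∈ S,
      |cov[fun ω => e i s ω * e j s ω, fun ω => e i s' ω * e j s' ω; P]| ≤
        U * Real.exp (-(c₀ * max ((dist s s' : ℝ) - ρ) 0)) := by
    intro i j s hs s' hs'
    refine abs_covariance_mul_mul_le (P := P) (hσ {site i s, site j s})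
      (hσ {site i s', site j s'}) (fun A A' hA hA' =>
        abs_real_inter_sub_le_of_fieldAlpha hmix (m := dist s s') ?_ hA hA')
      (hemeas _ i s (Or.inl rfl)) (he i s hs).abs_le (hemeas _ j s (Or.inr rfl)) (he j s hs).abs_le
      (hemeas _ i s' (Or.inl rfl)) (he i s' hs').abs_le (hemeas _ j s' (Or.inr rfl))
      (he j s' hs').abs_le (he i s hs).fourth (he j s hs).fourth (he i s' hs').fourth
      (he j s' hs').fourth hr
    rintro a (rfl | rfl) b (rfl | rfl) <;> exact hdist_le _ _ _ _
  have hbox : ∀ (c r' : ℝ), 0 < c → 0 ≤ r' → ∀ s,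
      ∑ s' ∈ S, Real.exp (-(c * max ((dist s s' : ℝ) - r') 0)) ≤
        (2 * (r' + expSumConst (c / K))) ^ K := by
    intro c r' hc' hr' s
    have := sum_box_exp_le (fun j : {j : Fin K // j ≠ k} => p j) n (s.1 : ℤ)
      (fun j => (s.2 j : ℤ)) hc' hr' (fun t' c' => dist s (t', c')) (fun t' c' => le_max_right _ _)
      (fun t' c' j => le_max_of_le_left (Finset.le_sup
        (f := fun j => ((s.2 j : ℤ) - (c' j : ℤ)).natAbs) (Finset.mem_univ j)))
    rwa [hK', hK] at this
  refine exists_bilinBound_perturbation S hNS hN0 (fun i s hs => (he i s hs).measurable)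
    (fun i s hs => (he i s hs).abs_le) ?_ ?_ hχ (fun i s hs => (he i s hs).mean) ?_ ?_ ?_
  · have := expSumConst_pos (γ := γ / K) (by positivity)
    positivity
  · intro i s hs
    calc ∑ s' ∈ S, |cov[e i s, e i s'; P]|
        ≤ ∑ s' ∈ S, 7 * w ^ 2 * Real.exp (-(γ * max ((dist s s' : ℝ) - 0) 0)) := by
          refine Finset.sum_le_sum fun s' hs' => ?_
          rw [sub_zero, max_eq_left (Nat.cast_nonneg _)]
          exact hcov i i s hs s' hs' _ (hdist_le _ _ _ _)
      _ ≤ 7 * w ^ 2 * (2 * (expSumConst (γ / K))) ^ K := by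
          rw [← Finset.mul_sum]
          refine mul_le_mul_of_nonneg_left ?_ (by positivity)
          simpa using hbox γ 0 hγ0 le_rfl s
  · have := expSumConst_pos hγ0
    positivity
  · intro i
    refine sum_mean_le S hNS hN0 _ fun s hs => ?_
    calc ∑ j, |∫ ω, e i s ω * e j s ω ∂P|
        ≤ ∑ j : Fin (p k), (7 * w ^ 2 *
          Real.exp (-(γ * max ((((i : ℤ) - (j : ℤ)).natAbs : ℝ) - 0) 0)) + B ^ 2) := by
          refine Finset.sum_le_sum fun j _ => ?_
          rw [(he i s hs).integral_mul_eq (he j s hs), sub_zero, max_eq_left (Nat.cast_nonneg _)]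
          exact (abs_add_le _ _).trans (add_le_add (hcov i j s hs s hs _ (hrow_le i j s))
            ((he i s hs).abs_integral_mul_integral_le (he j s hs)))
      _ ≤ _ := by
          rw [Finset.sum_add_distrib, ← Finset.mul_sum]
          refine add_le_add (mul_le_mul_of_nonneg_left ?_ (by positivity)) (by simp)
          simpa using sum_univ_exp_natAbs_le (p k) (i : ℤ) hγ0 (le_refl (0 : ℝ))
  · have hvar : ∀ i j, Var[fun ω => N⁻¹ * ∑ s ∈ S, e i s ω * e j s ω; P] ≤
        U * (2 * (ρ + expSumConst (c₀ / K))) ^ K / N := by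
      intro i j
      refine variance_mean_le S hNS hN0 (fun s hs => (he i s hs).memLp_mul (he j s hs))
        fun s hs => ?_
      refine (Finset.sum_le_sum fun s' hs' => hcov2 i j s hs s' hs').trans ?_
      rw [← Finset.mul_sum]
      exact mul_le_mul_of_nonneg_left (hbox c₀ ρ hc hρ s) hU
    calc _ ≤ ∑ _i : Fin (p k), ∑ _j : Fin (p k), U * (2 * (ρ + expSumConst (c₀ / K))) ^ K / N :=
          Finset.sum_le_sum fun i _ => Finset.sum_le_sum fun j _ => hvar i j
      _ = _ := by simp; ring

end SingleModel

/-! ### Perturbation bound under cross-sectional independence, at fixed dimensions. -/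

section CrossSectionalIndependence

variable {Ω : Type*} [m0 : MeasurableSpace Ω] {P : Measure Ω} [IsProbabilityMeasure P]
  {K : ℕ} {r p : Fin K → ℕ}

/-- Used for covariances, which vanish between different columns by independence, so that only sums
over time remain. -/
theorem sum_columnSites_eq_sum_time {n : ℕ} {k : Fin K} (f : ℕ ×
    (∀ j : {j : Fin K // j ≠ k}, Fin (p j)) → ℝ) (c : ∀ j : {j : Fin K // j ≠ k}, Fin (p j))
    (hf : ∀ s ∈ columnSites n p k, s.2 ≠ c → f s = 0) :
    ∑ s ∈ columnSites n p k, f s = ∑ t ∈ Finset.Icc 1 n, f (t, c) := by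
  classical
  rw [columnSites, Finset.sum_product]
  refine Finset.sum_congr rfl fun t ht => ?_
  exact Finset.sum_eq_single c (fun c' _ hc' => hf (t, c')
    (Finset.mem_product.mpr ⟨ht, Finset.mem_univ _⟩) hc') (by simp)

theorem indepFun_mul_mul_of_iIndepFun {Q : Measure Ω} {ι E : Type*} [MeasurableSpace E] {f : ι → Ω → E}
    (h : iIndepFun f Q) (hf : ∀ i, Measurable (f i)) {a b c d : ι} (hac : a ≠ c) (had : a ≠ d)
    (hbc : b ≠ c) (hbd : b ≠ d) {φ₁ φ₂ φ₃ φ₄ : E → ℝ} (h₁ : Measurable φ₁) (h₂ : Measurable φ₂)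
    (h₃ : Measurable φ₃) (h₄ : Measurable φ₄) :
    IndepFun (fun ω => φ₁ (f a ω) * φ₂ (f b ω)) (fun ω => φ₃ (f c ω) * φ₄ (f d ω)) Q := by
  have m₁ : Measurable fun z : E × E => φ₁ z.1 * φ₂ z.2 := by fun_prop
  have m₂ : Measurable fun z : E × E => φ₃ z.1 * φ₄ z.2 := by fun_prop
  exact (h.indepFun_prodMk_prodMk hf a b c d hac had hbc hbd).comp m₁ m₂

theorem indepFun_mul_mul_of_indepFun {Q : Measure Ω} {E : Type*} [MeasurableSpace E] {f g : Ω → E}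
    (h : IndepFun f g Q) {φ₁ φ₂ φ₃ φ₄ : E → ℝ} (h₁ : Measurable φ₁) (h₂ : Measurable φ₂)
    (h₃ : Measurable φ₃) (h₄ : Measurable φ₄) :
    IndepFun (fun ω => φ₁ (f ω) * φ₂ (f ω)) (fun ω => φ₃ (g ω) * φ₄ (g ω)) Q := by
  have m₁ : Measurable fun z : E => φ₁ z * φ₂ z := by fun_prop
  have m₂ : Measurable fun z : E => φ₃ z * φ₄ z := by fun_prop
  exact h.comp m₁ m₂

/-- Only the p_k diagonal entries involve squares of errors, whose variance is governed by the large
fourth moment bound U. Off the diagonal the two factors are independent and second-order covariances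
suffice, giving a variance O(1/N) that does not grow with τ. -/
theorem exists_bilinBound_indep {n : ℕ} {τ w ε c₀ U B C₃ ρ : ℝ} {F : ℕ → Tensor r}
    {Λ : ∀ k, Matrix (Fin (p k)) (Fin (r k)) ℝ} {ξ : (Fin K → ℕ) → ℤ → Ω → ℝ} {k : Fin K}
    (hN0 : 0 < (n : ℝ) * dimExcept p k) (hτ : 0 < τ) (hw : 0 < w) (hε : 0 < ε) (hε1 : ε < 1)
    (hc : 0 < c₀) (hρ : 0 ≤ ρ) (hξ : ∀ i t, Measurable (ξ i t))
    (hind : iIndepFun (fun (i : ∀ k, Fin (p k)) (ω : Ω) (t : ℤ) => ξ (pos i) t ω) P)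
    (hmix : ∀ (i : ∀ k, Fin (p k)) (m : ℕ), seriesAlpha P (ξ (pos i)) m ≤ Real.exp (-(c₀ * m)))
    (he : ∀ i, ∀ s ∈ columnSites n p k, ErrBounds P τ w ε U B (noiseErr τ F Λ ξ k i s))
    (hr : 4 * (2 * τ) ^ 4 ≤ U * Real.exp (c₀ * ρ)) (hU : 0 ≤ U)
    (hχ : ∀ j, ∑ s ∈ columnSites n p k, signal F Λ k j s ^ 2 ≤ C₃ * (n * dimExcept p k)) :
    ∃ W : Ω → ℝ, Integrable W P ∧ (∀ ω, 0 ≤ W ω) ∧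
      ∫ ω, W ω ∂P ≤ 3 * (2 * p k ^ 2 * (7 * w ^ 2 * (2 * expSumConst (ε * c₀ / 4)) * C₃ /
        (n * dimExcept p k) + B ^ 2 * C₃) +
        (p k * (U * (2 * (ρ + expSumConst c₀)) / (n * dimExcept p k)) +
          p k ^ 2 * (77 * w ^ 4 * (2 * expSumConst (ε * c₀ / 4)) / (n * dimExcept p k)))) ∧
      ∀ ω, BilinBound (perturbation n τ F Λ ξ k ω) (√(W ω) + (2 * w ^ 2 + p k * B ^ 2)) := by
  classical
  set S := columnSites n p k with hS
  set e := noiseErr τ F Λ ξ k with he'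
  set N : ℝ := (n : ℝ) * dimExcept p k with hN
  set γ : ℝ := ε * c₀ / 4 with hγ
  have hγ0 : 0 < γ := by positivity
  have hNS : N = S.card := (card_columnSites n p k).symm
  have hE := expSumConst_pos hγ0
  have hE' := expSumConst_pos hc
  set path : (∀ k, Fin (p k)) → Ω → ℤ → ℝ := fun i ω t => ξ (pos i) t ω with hpath
  have hpathm : ∀ i, Measurable (path i) := fun i => measurable_pi_lambda _ fun t => hξ _ _
  -- Each error is a measurable function of the whole path at its position, which is the object
  -- assumed independent across positions.
  set φ : Fin (p k) → ℕ × (∀ j : {j : Fin K // j ≠ k}, Fin (p j)) → (ℤ → ℝ) → ℝ :=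
    fun i s y => truncErr τ (signal F Λ k i s) (y s.1) with hφ
  have hφm : ∀ i s, Measurable (φ i s) := fun i s =>
    (measurable_truncErr hτ _).comp (measurable_pi_apply _)
  have heφ : ∀ i s, e i s = φ i s ∘ path (fullIdx k i s.2) := fun i s => rfl
  have hindep : ∀ i j s s', fullIdx k i s.2 ≠ fullIdx k j s'.2 → IndepFun (e i s) (e j s') P :=
    fun i j s s' h => (hind.indepFun h).comp (hφm i s) (hφm j s')
  have hindep2 : ∀ i j (s s' : ℕ × (∀ j : {j : Fin K // j ≠ k}, Fin (p j))), s.2 ≠ s'.2 →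
      IndepFun (fun ω => e i s ω * e j s ω) (fun ω => e i s' ω * e j s' ω) P := by
    intro i j s s' h
    have hne : ∀ a b : Fin (p k), fullIdx k a s.2 ≠ fullIdx k b s'.2 := fun a b hab =>
      h ((fullIdx_inj k).mp hab).2
    exact indepFun_mul_mul_of_iIndepFun hind hpathm (hne i i) (hne i j) (hne j i) (hne j j)
      (hφm i s) (hφm j s) (hφm i s') (hφm j s')
  have hindep3 : ∀ i j (s s' : ℕ × (∀ j : {j : Fin K // j ≠ k}, Fin (p j))), i ≠ j →
      s.2 = s'.2 →
      IndepFun (fun ω => e i s ω * e i s' ω) (fun ω => e j s ω * e j s' ω) P := by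
    intro i j s s' hij hs
    have h : fullIdx k i s.2 ≠ fullIdx k j s.2 := fun hab => hij ((fullIdx_inj k).mp hab).1
    have := indepFun_mul_mul_of_indepFun (hind.indepFun h) (hφm i s) (hφm i s') (hφm j s)
      (hφm j s')
    simp only [heφ, Function.comp_apply, ← hs]
    exact this
  have hα : ∀ i (t u : ℕ) (c : ∀ j : {j : Fin K // j ≠ k}, Fin (p j)) (A A' : Set Ω),
      MeasurableSet[MeasurableSpace.comap (ξ (pos (fullIdx k i c)) t) inferInstance] A →
      MeasurableSet[MeasurableSpace.comap (ξ (pos (fullIdx k i c)) u) inferInstance] A' →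
      |P.real (A ∩ A') - P.real A * P.real A'| ≤
        Real.exp (-(c₀ * (((t : ℤ) - (u : ℤ)).natAbs : ℝ))) := fun i t u c A A' hA hA' =>
    abs_real_inter_sub_le_of_seriesAlpha (hmix _) t u hA hA'
  have hcov : ∀ i (t u : ℕ) c, (t, c) ∈ S → (u, c) ∈ S → |cov[e i (t, c), e i (u, c); P]| ≤
      7 * w ^ 2 * Real.exp (-(γ * max ((((t : ℤ) - (u : ℤ)).natAbs : ℝ) - 0) 0)) := by
    intro i t u c hs hs'
    rw [sub_zero, max_eq_left (Nat.cast_nonneg _)]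
    exact abs_covariance_le_of_moment (P := P) (hξ _ _).comap_le (hξ _ _).comap_le hc.le
      (Nat.cast_nonneg _) (hα i t u c) (measurable_noiseErr_comap hτ i (t, c)) (he i _ hs).abs_le
      (measurable_noiseErr_comap hτ i (u, c)) (he i _ hs').abs_le hw hε hε1 (he i _ hs).moment
      (he i _ hs').moment
  have hcovsq : ∀ i (t u : ℕ) c, (t, c) ∈ S → (u, c) ∈ S →
      |cov[fun ω => e i (t, c) ω * e i (t, c) ω, fun ω => e i (u, c) ω * e i (u, c) ω; P]| ≤
      U * Real.exp (-(c₀ * max ((((t : ℤ) - (u : ℤ)).natAbs : ℝ) - ρ) 0)) := by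
    intro i t u c hs hs'
    have m1 := measurable_noiseErr_comap (F := F) (Λ := Λ) (ξ := ξ) hτ i (t, c)
    have m2 := measurable_noiseErr_comap (F := F) (Λ := Λ) (ξ := ξ) hτ i (u, c)
    exact abs_covariance_mul_mul_le (P := P) (hξ _ _).comap_le (hξ _ _).comap_le (hα i t u c)
      m1 (he i _ hs).abs_le m1 (he i _ hs).abs_le m2 (he i _ hs').abs_le m2 (he i _ hs').abs_le
      (he i _ hs).fourth (he i _ hs).fourth (he i _ hs').fourth (he i _ hs').fourth hr
  have hcovne : ∀ i j (t u : ℕ) c, i ≠ j → (t, c) ∈ S → (u, c) ∈ S →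
      |cov[fun ω => e i (t, c) ω * e j (t, c) ω, fun ω => e i (u, c) ω * e j (u, c) ω; P]| ≤
      77 * w ^ 4 * Real.exp (-(γ * max ((((t : ℤ) - (u : ℤ)).natAbs : ℝ) - 0) 0)) := by
    intro i j t u c hij hs hs'
    have hd : ∀ t u : ℕ, fullIdx k i ((t, c) : ℕ × (∀ j : {j : Fin K // j ≠ k}, Fin (p j))).2 ≠
        fullIdx k j ((u, c) : ℕ × (∀ j : {j : Fin K // j ≠ k}, Fin (p j))).2 := fun t u hab =>
      hij ((fullIdx_inj k).mp hab).1
    have i1 := (hindep i j (t, c) (t, c) (hd t t)).integral_fun_mul_eq_mul_integral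
      (he i _ hs).measurable.aestronglyMeasurable (he j _ hs).measurable.aestronglyMeasurable
    have i2 := (hindep i j (u, c) (u, c) (hd u u)).integral_fun_mul_eq_mul_integral
      (he i _ hs').measurable.aestronglyMeasurable (he j _ hs').measurable.aestronglyMeasurable
    have i3 := (hindep3 i j (t, c) (u, c) hij rfl).integral_fun_mul_eq_mul_integral
      ((he i _ hs).memLp_mul (he i _ hs')).aestronglyMeasurable
      ((he j _ hs).memLp_mul (he j _ hs')).aestronglyMeasurable
    rw [(he i _ hs).integral_mul_eq (he i _ hs'), (he j _ hs).integral_mul_eq (he j _ hs')] at i3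
    have x1 := hcov i t u c hs hs'
    have x2 := hcov j t u c hs hs'
    have y1 := (he i _ hs).abs_integral_mul_integral_le_moment (he i _ hs') hw hε
    have y2 := (he j _ hs).abs_integral_mul_integral_le_moment (he j _ hs') hw hε
    rw [covariance_eq_sub ((he i _ hs).memLp_mul (he j _ hs))
      ((he i _ hs').memLp_mul (he j _ hs')), i1, i2]
    have e0 : ∫ ω, ((fun ω => e i (t, c) ω * e j (t, c) ω) *
        fun ω => e i (u, c) ω * e j (u, c) ω) ω ∂P =
        ∫ ω, e i (t, c) ω * e i (u, c) ω * (e j (t, c) ω * e j (u, c) ω) ∂P :=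
      integral_congr_ae (ae_of_all _ fun ω => by simp only [Pi.mul_apply]; ring)
    rw [e0, i3]
    set E := Real.exp (-(γ * max ((((t : ℤ) - (u : ℤ)).natAbs : ℝ) - 0) 0)) with hEdef
    set x := cov[e i (t, c), e i (u, c); P] with hx
    set y := cov[e j (t, c), e j (u, c); P] with hy
    set a := (∫ ω, e i (t, c) ω ∂P) * ∫ ω, e i (u, c) ω ∂P with ha
    set b := (∫ ω, e j (t, c) ω ∂P) * ∫ ω, e j (u, c) ω ∂P with hb
    have hE1 : E ≤ 1 := by
      rw [hEdef, Real.exp_le_one_iff]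
      have := mul_nonneg hγ0.le (le_max_right ((((t : ℤ) - (u : ℤ)).natAbs : ℝ) - 0) 0)
      linarith
    have hE0 : 0 < E := Real.exp_pos _
    -- Independence of rows i and j turns the mixed moment into (x + a)(y + b), with x, y the time
    -- covariances and a, b the products of means. Subtracting ab leaves terms containing x or y,
    -- bounded by 49 + 14 + 14 = 77 times w⁴ E.
    have hsplit : (x + a) * (y + b) - (∫ ω, e i (t, c) ω ∂P) * (∫ ω, e j (t, c) ω ∂P) *
        ((∫ ω, e i (u, c) ω ∂P) * ∫ ω, e j (u, c) ω ∂P) = x * y + x * b + a * y := by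
      rw [ha, hb]; ring
    rw [hsplit]
    have hx7 : |y| ≤ 7 * w ^ 2 := x2.trans (mul_le_of_le_one_right (by positivity) hE1)
    have z1 : |x * y| ≤ 7 * w ^ 2 * E * (7 * w ^ 2) := by
      rw [abs_mul]; exact mul_le_mul x1 hx7 (abs_nonneg _) (by positivity)
    have z2 : |x * b| ≤ 7 * w ^ 2 * E * (2 * w ^ 2) := by
      rw [abs_mul]; exact mul_le_mul x1 y2 (abs_nonneg _) (by positivity)
    have z3 : |a * y| ≤ 2 * w ^ 2 * (7 * w ^ 2 * E) := by
      rw [abs_mul]; exact mul_le_mul y1 x2 (abs_nonneg _) (by positivity)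
    have t1 := abs_add_le (x * y + x * b) (a * y)
    have t2 := abs_add_le (x * y) (x * b)
    nlinarith
  have hmemS : ∀ {t : ℕ} {c : ∀ j : {j : Fin K // j ≠ k}, Fin (p j)}, t ∈ Finset.Icc 1 n → (t, c) ∈ S :=
    fun ht => Finset.mem_product.mpr ⟨ht, Finset.mem_univ _⟩
  have htime : ∀ (i j : Fin (p k)) (C c r' : ℝ), 0 ≤ C → 0 < c → 0 ≤ r' →
      (∀ (t u : ℕ) c', (t, c') ∈ S → (u, c') ∈ S →
        |cov[fun ω => e i (t, c') ω * e j (t, c') ω, fun ω => e i (u, c') ω * e j (u, c') ω; P]| ≤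
        C * Real.exp (-(c * max ((((t : ℤ) - (u : ℤ)).natAbs : ℝ) - r') 0))) →
      Var[fun ω => N⁻¹ * ∑ s ∈ S, e i s ω * e j s ω; P] ≤ C * (2 * (r' + expSumConst c)) / N := by
    intro i j C c r' hC hc' hr' h
    refine variance_mean_le S hNS hN0 (fun s hs => (he i s hs).memLp_mul (he j s hs))
      fun s hs => ?_
    rw [sum_columnSites_eq_sum_time _ s.2 fun s' hs' hne => by
      rw [(hindep2 i j s s' hne.symm).covariance_eq_zero ((he i s hs).memLp_mul (he j s hs))
        ((he i s' hs').memLp_mul (he j s' hs')), abs_zero]]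
    refine (Finset.sum_le_sum fun u hu => h s.1 u s.2 hs (hmemS hu)).trans ?_
    rw [← Finset.mul_sum]
    exact mul_le_mul_of_nonneg_left (sum_Icc_exp_natAbs_le n _ hc' hr') hC
  refine exists_bilinBound_perturbation S hNS hN0 (fun i s hs => (he i s hs).measurable)
    (fun i s hs => (he i s hs).abs_le) (by positivity) ?_ hχ (fun i s hs => (he i s hs).mean)
    (by positivity) ?_ ?_
  · intro i s hs
    rw [sum_columnSites_eq_sum_time _ s.2 fun s' hs' hne => by
      rw [(hindep i i s s' fun h => hne ((fullIdx_inj k).mp h).2.symm).covariance_eq_zero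
        (he i s hs).memLp (he i s' hs').memLp, abs_zero]]
    refine (Finset.sum_le_sum fun u hu => hcov i s.1 u s.2 hs (hmemS hu)).trans ?_
    rw [← Finset.mul_sum]
    refine mul_le_mul_of_nonneg_left ?_ (by positivity)
    simpa using sum_Icc_exp_natAbs_le n (s.1 : ℤ) hγ0 (le_refl (0 : ℝ))
  · intro i
    refine sum_mean_le S hNS hN0 _ fun s hs => ?_
    calc ∑ j, |∫ ω, e i s ω * e j s ω ∂P|
        -- Different rows are independent, so off the diagonal only the product of the two biases
        -- remains.
        ≤ ∑ j : Fin (p k), ((if j = i then 2 * w ^ 2 else 0) + B ^ 2) := by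
          refine Finset.sum_le_sum fun j _ => ?_
          by_cases hij : j = i
          · subst hij
            have h1 := integral_sq_le_of_moment (P := P) (he j s hs).measurable
              (he j s hs).abs_le hw hε (he j s hs).moment
            simp only [← sq, if_true]
            rw [abs_of_nonneg (integral_nonneg fun ω => sq_nonneg _)]
            nlinarith [sq_nonneg B]
          · rw [if_neg hij, zero_add, (hindep i j s s fun h =>
              hij ((fullIdx_inj k).mp h).1.symm).integral_fun_mul_eq_mul_integral
              (he i s hs).measurable.aestronglyMeasurable
              (he j s hs).measurable.aestronglyMeasurable]
            exact (he i s hs).abs_integral_mul_integral_le (he j s hs)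
      _ = _ := by rw [Finset.sum_add_distrib]; simp
  · have hdiag : ∀ i, Var[fun ω => N⁻¹ * ∑ s ∈ S, e i s ω * e i s ω; P] ≤
        U * (2 * (ρ + expSumConst c₀)) / N := fun i =>
      htime i i U c₀ ρ hU hc hρ (hcovsq i)
    have hoff : ∀ i j, i ≠ j → Var[fun ω => N⁻¹ * ∑ s ∈ S, e i s ω * e j s ω; P] ≤
        77 * w ^ 4 * (2 * expSumConst γ) / N := fun i j hij => by
      have := htime i j (77 * w ^ 4) γ 0 (by positivity) hγ0 le_rfl
        (fun t u c hs hs' => hcovne i j t u c hij hs hs')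
      rwa [zero_add] at this
    calc _ ≤ ∑ i : Fin (p k), ∑ j : Fin (p k), ((if j = i then U * (2 * (ρ + expSumConst c₀)) / N
          else 0) + 77 * w ^ 4 * (2 * expSumConst γ) / N) := by
          refine Finset.sum_le_sum fun i _ => Finset.sum_le_sum fun j _ => ?_
          by_cases hij : j = i
          · subst hij
            rw [if_pos rfl]
            have : 0 ≤ 77 * w ^ 4 * (2 * expSumConst γ) / N := by positivity
            linarith [hdiag j]
          · rw [if_neg hij, zero_add]
            exact hoff i j (Ne.symm hij)
      _ = _ := by
          simp_rw [Finset.sum_add_distrib, Finset.sum_ite_eq' Finset.univ]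
          simp; ring

end CrossSectionalIndependence

/-! ### Calibration of the truncation level. -/

/-- Bounds on lag, fourth moments and bias for a truncation level of order `w / y`, where
`y ^ (2 + 2ε) = L ^ κ / N`. -/
theorem exists_truncation_constants {ε w c C c₀ E : ℝ} (κ : ℕ) (hε : 0 < ε) (hε1 : ε < 1)
    (hw : 0 < w) (hc : 0 < c) (hC : 0 < C) (hc₀ : 0 < c₀) (hE : 0 ≤ E) :
    ∃ D : ℝ, 0 < D ∧ ∀ N L y τ : ℝ, 1 ≤ N → 1 ≤ L → Real.log N ≤ L → 0 < y →
      y ^ (2 + 2 * ε) = L ^ κ / N → c * (w / y) ≤ τ → τ ≤ C * (w / y) →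
      ∃ ρ : ℝ, 0 ≤ ρ ∧
        4 * (2 * τ) ^ 4 ≤ (2 * τ) ^ (2 - 2 * ε) * w ^ (2 + 2 * ε) * Real.exp (c₀ * ρ) ∧
        (2 * τ) ^ (2 - 2 * ε) * w ^ (2 + 2 * ε) * (2 * (ρ + E)) ^ κ / N ≤ D * y ^ (4 * ε) ∧
        (((τ / 2) ^ (1 + 2 * ε))⁻¹ * w ^ (2 + 2 * ε)) ^ 2 ≤ D * y ^ (2 + 4 * ε) := by
  -- C4 is chosen so that exp(c₀ρ) = C4 N dominates 4(2τ)^{2+2ε} / w^{2+2ε}, as τ^{2+2ε} is at most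
  -- a constant times w^{2+2ε} N. The maximum with 1 keeps the logarithm nonnegative.
  set C4 : ℝ := max 1 (4 * (2 * C) ^ (2 + 2 * ε)) with hC4
  have hC41 : 1 ≤ C4 := le_max_left _ _
  have hlogC4 : 0 ≤ Real.log C4 := Real.log_nonneg hC41
  set C5 : ℝ := 2 * ((Real.log C4 + 1) / c₀ + E) with hC5
  have hC50 : 0 < C5 := by positivity
  set D1 : ℝ := (2 * C) ^ (2 - 2 * ε) * w ^ (2 - 2 * ε) * w ^ (2 + 2 * ε) * C5 ^ κ with hD1
  set D2 : ℝ := ((c * w / 2) ^ (1 + 2 * ε))⁻¹ * w ^ (2 + 2 * ε) with hD2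
  have hD1' : 0 < D1 := by positivity
  refine ⟨D1 + D2 ^ 2, by positivity, fun N L y τ hN hL hLN hy hyx hτ1 hτ2 => ?_⟩
  have hN0 : 0 < N := by linarith
  have hL0 : 0 < L := by linarith
  have hτ : 0 < τ := lt_of_lt_of_le (by positivity) hτ1
  have hCN : 1 ≤ C4 * N := one_le_mul_of_one_le_of_one_le hC41 hN
  have hC40 : 0 < C4 := by linarith
  -- The lag is logarithmic in N, hence 2(ρ + E) ≤ C5 L. This is what turns ρ^κ / N into the factor
  -- L^κ / N = y^{2+2ε}, and y^{-(2-2ε)} y^{2+2ε} = y^{4ε}.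
  refine ⟨Real.log (C4 * N) / c₀, div_nonneg (Real.log_nonneg hCN) hc₀.le, ?_, ?_, ?_⟩
  · rw [mul_div_cancel₀ _ hc₀.ne', Real.exp_log (by positivity)]
    have e4 : (2 * τ) ^ 4 = (2 * τ) ^ (2 - 2 * ε) * (2 * τ) ^ (2 + 2 * ε) := by
      rw [← Real.rpow_add (by positivity), show 2 - 2 * ε + (2 + 2 * ε) = ((4 : ℕ) : ℝ) by
        push_cast; ring, Real.rpow_natCast]
    have h1 : (2 * τ) ^ (2 + 2 * ε) ≤ (2 * C) ^ (2 + 2 * ε) * w ^ (2 + 2 * ε) * N := by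
      calc (2 * τ) ^ (2 + 2 * ε) ≤ (2 * C * w / y) ^ (2 + 2 * ε) := by
            refine Real.rpow_le_rpow (by positivity) ?_ (by positivity)
            calc 2 * τ ≤ 2 * (C * (w / y)) := by linarith
              _ = _ := by ring
        _ = (2 * C) ^ (2 + 2 * ε) * w ^ (2 + 2 * ε) * (N / L ^ κ) := by
            rw [Real.div_rpow (by positivity) hy.le, hyx, Real.mul_rpow (by positivity) hw.le]
            field_simp
        _ ≤ _ := by
            refine mul_le_mul_of_nonneg_left ?_ (by positivity)
            exact div_le_self hN0.le (one_le_pow₀ hL)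
    rw [e4]
    have h2 : 4 * (2 * C) ^ (2 + 2 * ε) ≤ C4 := le_max_right _ _
    calc 4 * ((2 * τ) ^ (2 - 2 * ε) * (2 * τ) ^ (2 + 2 * ε))
        ≤ 4 * ((2 * τ) ^ (2 - 2 * ε) * ((2 * C) ^ (2 + 2 * ε) * w ^ (2 + 2 * ε) * N)) := by
          gcongr
      _ = (2 * τ) ^ (2 - 2 * ε) * w ^ (2 + 2 * ε) * (4 * (2 * C) ^ (2 + 2 * ε) * N) := by ring
      _ ≤ _ := by gcongr
  · have h1 : (2 * τ) ^ (2 - 2 * ε) ≤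
        (2 * C) ^ (2 - 2 * ε) * w ^ (2 - 2 * ε) * (y ^ (2 - 2 * ε))⁻¹ := by
      calc (2 * τ) ^ (2 - 2 * ε) ≤ (2 * C * w / y) ^ (2 - 2 * ε) := by
            refine Real.rpow_le_rpow (by positivity) ?_ (by linarith)
            calc 2 * τ ≤ 2 * (C * (w / y)) := by linarith
              _ = _ := by ring
        _ = _ := by
            rw [Real.div_rpow (by positivity) hy.le, Real.mul_rpow (by positivity) hw.le,
              div_eq_mul_inv]
    have h2 : 2 * (Real.log (C4 * N) / c₀ + E) ≤ C5 * L := by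
      rw [Real.log_mul hC40.ne' hN0.ne', hC5]
      have e1 : (Real.log C4 + Real.log N) / c₀ ≤ (Real.log C4 + 1) / c₀ * L := by
        rw [div_mul_eq_mul_div]
        refine div_le_div_of_nonneg_right ?_ hc₀.le
        nlinarith
      have e2 : E ≤ E * L := le_mul_of_one_le_right hE hL
      nlinarith
    have h3 : (2 * (Real.log (C4 * N) / c₀ + E)) ^ κ ≤ C5 ^ κ * L ^ κ := by
      rw [← mul_pow]
      have h0 : 0 ≤ Real.log (C4 * N) / c₀ := div_nonneg (Real.log_nonneg hCN) hc₀.le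
      exact pow_le_pow_left₀ (by positivity) h2 κ
    have h0 : 0 ≤ Real.log (C4 * N) / c₀ := div_nonneg (Real.log_nonneg hCN) hc₀.le
    have hyy : (y ^ (2 - 2 * ε))⁻¹ * y ^ (2 + 2 * ε) = y ^ (4 * ε) := by
      rw [← Real.rpow_neg hy.le, ← Real.rpow_add hy]; congr 1; ring
    calc (2 * τ) ^ (2 - 2 * ε) * w ^ (2 + 2 * ε) * (2 * (Real.log (C4 * N) / c₀ + E)) ^ κ / N
        ≤ ((2 * C) ^ (2 - 2 * ε) * w ^ (2 - 2 * ε) * (y ^ (2 - 2 * ε))⁻¹) * w ^ (2 + 2 * ε) *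
            (C5 ^ κ * L ^ κ) / N := by gcongr
      _ = D1 * ((y ^ (2 - 2 * ε))⁻¹ * (L ^ κ / N)) := by rw [hD1]; ring
      _ = D1 * y ^ (4 * ε) := by rw [← hyx, hyy]
      _ ≤ _ := by
          refine mul_le_mul_of_nonneg_right ?_ (by positivity)
          nlinarith [sq_nonneg D2]
  · have h1 : ((τ / 2) ^ (1 + 2 * ε))⁻¹ * w ^ (2 + 2 * ε) ≤ D2 * y ^ (1 + 2 * ε) := by
      have h2 : (c * w / 2 / y) ^ (1 + 2 * ε) ≤ (τ / 2) ^ (1 + 2 * ε) := by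
        refine Real.rpow_le_rpow (by positivity) ?_ (by positivity)
        calc c * w / 2 / y = c * (w / y) / 2 := by ring
          _ ≤ τ / 2 := by linarith
      have h3 := inv_anti₀ (by positivity) h2
      calc ((τ / 2) ^ (1 + 2 * ε))⁻¹ * w ^ (2 + 2 * ε) ≤
            ((c * w / 2 / y) ^ (1 + 2 * ε))⁻¹ * w ^ (2 + 2 * ε) := by gcongr
        _ = _ := by
            rw [Real.div_rpow (by positivity) hy.le, hD2]; field_simp
    have h4 : y ^ (2 + 4 * ε) = (y ^ (1 + 2 * ε)) ^ 2 := by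
      rw [← Real.rpow_natCast, ← Real.rpow_mul hy.le]; congr 1; push_cast; ring
    rw [h4]
    calc _ ≤ (D2 * y ^ (1 + 2 * ε)) ^ 2 := pow_le_pow_left₀ (by positivity) h1 2
      _ = D2 ^ 2 * (y ^ (1 + 2 * ε)) ^ 2 := mul_pow _ _ _
      _ ≤ _ := by
          refine mul_le_mul_of_nonneg_right ?_ (by positivity)
          linarith

/-! ### From perturbation bounds to rates in probability. -/

section Conclusion

variable {Ω : Type*} [MeasurableSpace Ω] {P : Measure Ω} [IsProbabilityMeasure P]

/-- Markov's inequality for the square root of a random variable. -/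
theorem measure_lt_sqrt_le {W : Ω → ℝ} (hW : Integrable W P) (hW0 : ∀ ω, 0 ≤ W ω) {x T : ℝ}
    (hx : 0 < x) (hT : 0 < T) (hWx : ∫ ω, W ω ∂P ≤ x ^ 2) :
    P {ω | T * x < √(W ω)} ≤ ENNReal.ofReal (1 / T ^ 2) := by
  have h1 := mul_meas_ge_le_integral_of_nonneg (ae_of_all P hW0) hW ((T * x) ^ 2)
  have h2 : P.real {ω | (T * x) ^ 2 ≤ W ω} ≤ 1 / T ^ 2 := by
    rw [le_div_iff₀ (by positivity)]
    refine le_of_mul_le_mul_right ?_ (by positivity : 0 < x ^ 2)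
    calc P.real {ω | (T * x) ^ 2 ≤ W ω} * T ^ 2 * x ^ 2
        = (T * x) ^ 2 * P.real {ω | (T * x) ^ 2 ≤ W ω} := by ring
      _ ≤ 1 * x ^ 2 := by rw [one_mul]; exact h1.trans hWx
  calc P {ω | T * x < √(W ω)} ≤ P {ω | (T * x) ^ 2 ≤ W ω} := by
        refine measure_mono fun ω hω => ?_
        have h3 : T * x < √(W ω) := hω
        exact ((Real.lt_sqrt (by positivity)).mp h3).le
    _ = ENNReal.ofReal (P.real {ω | (T * x) ^ 2 ≤ W ω}) :=
        (ENNReal.ofReal_toReal (measure_ne_top _ _)).symm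
    _ ≤ _ := ENNReal.ofReal_le_ofReal h2

/-- From a bound in probability on the perturbation of the second moment matrix to the rate of the
loading estimator. -/
theorem exists_rotation_of_perturbation {ι : Type*} {l : Filter ι} {s : ℕ} {q : ι → ℕ}
    {Γ R : ∀ ν, Ω → Matrix (Fin (q ν)) (Fin (q ν)) ℝ}
    {Λ : ∀ ν, Matrix (Fin (q ν)) (Fin s) ℝ} {Λhat : ∀ ν, Ω → Matrix (Fin (q ν)) (Fin s) ℝ}
    {G : ι → Matrix (Fin s) (Fin s) ℝ} {a : ℝ} {ρ rate : ι → ℝ} (hs : ∀ᶠ ν in l, s ≤ q ν)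
    (hq : ∀ᶠ ν in l, 0 < q ν) (ha0 : 0 < a)
    (hΛ : ∀ ν, (Λ ν).transpose * Λ ν = (q ν : ℝ) • (1 : Matrix (Fin s) (Fin s) ℝ))
    (hG : ∀ ν, (G ν).IsDiag) (ha : ∀ ν j, a ≤ G ν j j)
    (hΓ : ∀ᶠ ν in l, ∀ ω, Γ ν ω = Λ ν * G ν * (Λ ν).transpose + R ν ω)
    (hhat : ∀ ν ω, IsPCLoading (Γ ν ω) (Λhat ν ω))
    (hρ0 : ∀ᶠ ν in l, 0 < ρ ν) (hρ : Tendsto ρ l (𝓝 0))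
    (hrate : ∃ C, 0 < C ∧ ∀ᶠ ν in l, ρ ν ≤ C * rate ν)
    (hR : ∀ᶠ ν in l, ∃ (W : Ω → ℝ) (d : ℝ), Integrable W P ∧ (∀ ω, 0 ≤ W ω) ∧
      ∫ ω, W ω ∂P ≤ (q ν * ρ ν) ^ 2 ∧ 0 ≤ d ∧ d ≤ q ν * ρ ν ∧
      ∀ ω, BilinBound (R ν ω) (√(W ω) + d)) :
    ∃ H : ι → Ω → Matrix (Fin s) (Fin s) ℝ,
      (∀ ν, (∀ i j, Measurable fun ω => Λhat ν ω i j) → ∀ i j, Measurable fun ω => H ν ω i j) ∧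
      (∀ i j, TendstoInMeasure P (fun ν ω => ((H ν ω).transpose * H ν ω) i j) l
        (fun _ => (1 : Matrix (Fin s) (Fin s) ℝ) i j)) ∧
      IsBigOP P l (fun ν ω => 1 / √(q ν : ℝ) * specNorm (Λhat ν ω - Λ ν * H ν ω)) rate := by
  set H : ι → Ω → Matrix (Fin s) (Fin s) ℝ := fun ν ω =>
    (q ν : ℝ)⁻¹ • ((Λ ν).transpose * Λhat ν ω) with hH
  -- A single exceptional set serves both conclusions. It is defined through W alone, so no
  -- measurability of the estimator is needed. Outside it √W ≤ T qρ, and the deterministic part adds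
  -- one more qρ, giving T + 1.
  have key : ∀ T : ℝ, 0 < T → ∀ᶠ ν in l, ∃ A : Set Ω, P A ≤ ENNReal.ofReal (1 / T ^ 2) ∧
      ∀ ω, ω ∉ A →
        1 / √(q ν : ℝ) * specNorm (Λhat ν ω - Λ ν * H ν ω) ≤ 2 / a * ((T + 1) * ρ ν) ∧
        ∀ i j, |((H ν ω).transpose * H ν ω) i j - (1 : Matrix (Fin s) (Fin s) ℝ) i j| ≤
          2 / a * ((T + 1) * ρ ν) := by
    intro T hT
    filter_upwards [hs, hq, hΓ, hρ0, hR] with ν hs hq hΓ hρ0 ⟨W, d, hWi, hW0, hWx, hd0, hd, hB⟩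
    have hq' : (0 : ℝ) < q ν := by exact_mod_cast hq
    refine ⟨{ω | T * (q ν * ρ ν) < √(W ω)}, measure_lt_sqrt_le hWi hW0 (by positivity) hT hWx,
      fun ω hω => ?_⟩
    have hω' : √(W ω) ≤ T * (q ν * ρ ν) := not_lt.mp hω
    exact pcLoading_error hs hq (by positivity) ha0 (hΛ ν) (hG ν) (ha ν) (hΓ ω)
      ((hB ω).mono (by nlinarith)) (hhat ν ω)
  have hTδ : ∀ δ : ℝ, 0 < δ → ∃ T : ℝ, 0 < T ∧ 1 / T ^ 2 = δ := fun δ hδ =>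
    ⟨(√δ)⁻¹, by positivity, by rw [inv_pow, Real.sq_sqrt hδ.le, one_div, inv_inv]⟩
  refine ⟨H, fun ν hm i j => ?_, fun i j => ?_, fun δ hδ => ?_⟩
  · simp only [hH, Matrix.smul_apply, Matrix.mul_apply, smul_eq_mul]
    exact (Finset.measurable_fun_sum _ fun b _ => (hm b j).const_mul _).const_mul _
  · rw [tendstoInMeasure_iff_dist]
    intro η hη
    rw [ENNReal.tendsto_nhds_zero]
    intro δ hδ
    rcases eq_or_ne δ ⊤ with rfl | hδt
    · exact Eventually.of_forall fun _ => le_top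
    have hδ' : 0 < δ.toReal := ENNReal.toReal_pos hδ.ne' hδt
    obtain ⟨T, hT, hTe⟩ := hTδ δ.toReal hδ'
    have hsmall : ∀ᶠ ν in l, 2 / a * ((T + 1) * ρ ν) < η := by
      have : Tendsto (fun ν => 2 / a * ((T + 1) * ρ ν)) l (𝓝 0) := by
        simpa using (hρ.const_mul (T + 1)).const_mul (2 / a)
      exact this.eventually (gt_mem_nhds hη)
    filter_upwards [key T hT, hsmall] with ν ⟨A, hA, hA'⟩ hsmall
    rw [hTe, ENNReal.ofReal_toReal hδt] at hA
    refine (measure_mono fun ω hω => ?_).trans hA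
    by_contra hωA
    have h1 := (hA' ω hωA).2 i j
    rw [← Real.dist_eq] at h1
    exact absurd (lt_of_le_of_lt h1 hsmall) (not_lt.mpr hω)
  · obtain ⟨T, hT, hTe⟩ := hTδ δ hδ
    obtain ⟨C, hC, hCr⟩ := hrate
    refine ⟨2 / a * ((T + 1) * C), by positivity, ?_⟩
    filter_upwards [key T hT, hCr] with ν ⟨A, hA, hA'⟩ hCr
    rw [hTe] at hA
    refine (measure_mono fun ω hω => ?_).trans hA
    by_contra hωA
    have h1 := (hA' ω hωA).1
    have h2 : 0 ≤ 1 / √(q ν : ℝ) * specNorm (Λhat ν ω - Λ ν * H ν ω) :=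
      mul_nonneg (by positivity) (norm_nonneg _)
    have h3 : 2 / a * ((T + 1) * C) * rate ν <
        |1 / √(q ν : ℝ) * specNorm (Λhat ν ω - Λ ν * H ν ω)| := hω
    rw [abs_of_nonneg h2] at h3
    have h4 : 2 / a * ((T + 1) * ρ ν) ≤ 2 / a * ((T + 1) * (C * rate ν)) := by gcongr
    linarith

end Conclusion

theorem sq_add_sq_le_sq_add_add {x y z : ℝ} (hx : 0 ≤ x) (hy : 0 ≤ y) (hz : 0 ≤ z) :
    x ^ 2 + y ^ 2 ≤ (x + y + z) ^ 2 := by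
  nlinarith [mul_nonneg hx hy, mul_nonneg hx hz, mul_nonneg hy hz, sq_nonneg z]

/-- For x = log^κ / N and y = x^{1/(2+2ε)}, these express the truncation level as w / y and ψ as w²
y^{2ε}, so that all rates become powers of y. -/
theorem rpow_truncation_identities {x ε : ℝ} (hx : 0 < x) (hε : 0 < ε) :
    0 < x ^ (1 / (2 + 2 * ε)) ∧ (x ^ (1 / (2 + 2 * ε))) ^ (2 + 2 * ε) = x ∧
      x ^ (ε / (1 + ε)) = (x ^ (1 / (2 + 2 * ε))) ^ (2 * ε) ∧
      (x⁻¹) ^ (1 / (2 + 2 * ε)) = (x ^ (1 / (2 + 2 * ε)))⁻¹ := by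
  refine ⟨by positivity, ?_, ?_, Real.inv_rpow hx.le _⟩
  · rw [← Real.rpow_mul hx.le, one_div, inv_mul_cancel₀ (by positivity), Real.rpow_one]
  · rw [← Real.rpow_mul hx.le]; congr 1; field_simp

/-! ### Consequences of the asymptotic regime and the growth condition. -/

section Regime

variable {ι : Type*} {l : Filter ι} {K : ℕ} {n : ι → ℕ} {p : ι → Fin K → ℕ}

theorem dimAll_eq_mul_dimExcept (d : Fin K → ℕ) (k : Fin K) : dimAll d = d k * dimExcept d k :=
  (Finset.mul_prod_erase _ _ (Finset.mem_univ k)).symm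

theorem eventually_dimensions (hn : Tendsto n l atTop) (hp : ∀ k, Tendsto (fun ν => p ν k) l atTop)
    (k : Fin K) (s : ℕ) :
    ∀ᶠ ν in l, s ≤ p ν k ∧ 0 < p ν k ∧ 0 < n ν ∧ 0 < dimExcept (p ν) k ∧
      1 ≤ (n ν : ℝ) * dimExcept (p ν) k ∧
      1 ≤ Real.log ((n ν : ℝ) * dimExcept (p ν) k) ∧
      Real.log ((n ν : ℝ) * dimExcept (p ν) k) ≤ Real.log ((n ν : ℝ) * dimAll (p ν)) := by
  have h1 : ∀ᶠ ν in l, ∀ j, 0 < p ν j := eventually_all.mpr fun j => (hp j).eventually_gt_atTop 0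
  -- The threshold 3 exceeds e, which makes log(n p_{-k}) at least 1.
  filter_upwards [hn.eventually_ge_atTop 3, (hp k).eventually_ge_atTop s, h1] with ν hn hs hpos
  have hd : 0 < dimExcept (p ν) k := Finset.prod_pos fun j _ => hpos j
  have hN3 : (3 : ℝ) ≤ (n ν : ℝ) * dimExcept (p ν) k := by
    have : 3 * 1 ≤ n ν * dimExcept (p ν) k := Nat.mul_le_mul hn hd
    exact_mod_cast this
  refine ⟨hs, hpos k, by omega, hd, by linarith, ?_, ?_⟩
  · rw [Real.le_log_iff_exp_le (by linarith)]
    have := Real.exp_one_lt_d9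
    linarith
  · refine Real.log_le_log (by linarith) ?_
    refine mul_le_mul_of_nonneg_left ?_ (Nat.cast_nonneg _)
    rw [dimAll_eq_mul_dimExcept _ k]
    exact_mod_cast Nat.le_mul_of_pos_left _ (hpos k)

theorem tendsto_scale_of_growth {ε w : ℝ} {M y : ι → ℝ} {τlev : ι → Fin K → ℝ} {k : Fin K}
    (hw : 0 < w) (hM0 : ∀ ν, 0 < M ν)
    (hgrowth : GrowthCondition l n p ε M τlev)
    (hlog : ∀ᶠ ν in l, 1 ≤ Real.log ((n ν : ℝ) * dimExcept (p ν) k))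
    (hy : ∀ᶠ ν in l, 0 < y ν ∧ τlev ν k = w / y ν) :
    Tendsto (fun ν => M ν * y ν * Real.log ((n ν : ℝ) * dimExcept (p ν) k) ^ (1 / (2 * ε))) l
      (𝓝 0) := by
  have h := hgrowth.const_mul w
  rw [mul_zero] at h
  refine squeeze_zero' ?_ ?_ h
  · filter_upwards [hlog, hy] with ν hlog hy
    have := hM0 ν
    have := hy.1
    positivity
  · filter_upwards [hy] with ν hy
    have h1 := le_ciSup (f := fun k : Fin K => (τlev ν k)⁻¹ *
      Real.log ((n ν : ℝ) * dimExcept (p ν) k) ^ (1 / (2 * ε))) (Set.finite_range _).bddAbove k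
    have h2 := mul_le_mul_of_nonneg_left h1 (mul_pos hw (hM0 ν)).le
    refine le_trans (le_of_eq ?_) (h2.trans (le_of_eq (by ring)))
    rw [hy.2]
    have := hy.1
    field_simp

theorem eventually_truncation_regime {ε w Lc : ℝ} {M y τ : ι → ℝ} {τlev : ι → Fin K → ℝ}
    {k : Fin K} (hw : 0 < w) (hε : 0 < ε) (hLc : 0 ≤ Lc) (hM0 : ∀ ν, 0 < M ν) (hwM : ∀ ν, w ≤ M ν)
    (hτ0 : ∀ ν, 0 < τ ν) (hgrowth : GrowthCondition l n p ε M τlev)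
    (hlog : ∀ᶠ ν in l, 1 ≤ Real.log ((n ν : ℝ) * dimExcept (p ν) k))
    (hy : ∀ᶠ ν in l, 0 < y ν ∧ τlev ν k = w / y ν) (hτ : τ =Θ[l] fun ν => τlev ν k) :
    ∃ c C : ℝ, 0 < c ∧ 0 < C ∧ Tendsto y l (𝓝 0) ∧ ∀ᶠ ν in l, 0 < y ν ∧ y ν ≤ 1 ∧
      c * (w / y ν) ≤ τ ν ∧ τ ν ≤ C * (w / y ν) ∧ Lc * M ν ≤ τ ν / 2 ∧
      Real.log ((n ν : ℝ) * dimExcept (p ν) k) * y ν ^ (2 * ε) ≤ 1 := by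
  have hg := tendsto_scale_of_growth hw hM0 hgrowth hlog hy
  obtain ⟨C, hC, hC'⟩ := hτ.1.exists_pos
  obtain ⟨c, hc, hc'⟩ := hτ.2.exists_pos
  have hMy : Tendsto (fun ν => M ν * y ν) l (𝓝 0) := by
    refine squeeze_zero' ?_ ?_ hg
    · filter_upwards [hy] with ν hy using (mul_pos (hM0 ν) hy.1).le
    · filter_upwards [hlog, hy] with ν hlog hy
      exact le_mul_of_one_le_right (mul_pos (hM0 ν) hy.1).le
        (Real.one_le_rpow hlog (by positivity))
  have hy0 : Tendsto y l (𝓝 0) := by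
    have h := hMy.const_mul w⁻¹
    rw [mul_zero] at h
    refine squeeze_zero' ?_ ?_ h
    · filter_upwards [hy] with ν hy using hy.1.le
    · filter_upwards [hy] with ν hy
      rw [← mul_assoc]
      refine le_mul_of_one_le_left hy.1.le ?_
      rw [inv_mul_eq_div, one_le_div hw]
      exact hwM ν
  refine ⟨c⁻¹, C, inv_pos.mpr hc, hC, hy0, ?_⟩
  -- The threshold for M y makes Lc M at most τ/2, so the signal stays below half the truncation
  -- level. Using Lc + 1 avoids division by zero.
  filter_upwards [hlog, hy, hC'.bound, hc'.bound, hy0.eventually (gt_mem_nhds one_pos),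
    hMy.eventually (gt_mem_nhds (by positivity : 0 < c⁻¹ * w / (2 * (Lc + 1)))),
    hg.eventually (gt_mem_nhds hw)] with ν hlog hy hC' hc' hy1 hMy hg
  obtain ⟨hypos, hylev⟩ := hy
  have hwy : 0 < w / y ν := by positivity
  rw [hylev, Real.norm_of_nonneg (hτ0 ν).le, Real.norm_of_nonneg hwy.le] at hC' hc'
  have h1 : c⁻¹ * (w / y ν) ≤ τ ν := by rwa [inv_mul_le_iff₀ hc]
  refine ⟨hypos, hy1.le, h1, hC', ?_, ?_⟩
  · rw [lt_div_iff₀ (by positivity)] at hMy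
    have h2 : Lc * M ν ≤ c⁻¹ * (w / y ν) / 2 := by
      rw [show c⁻¹ * (w / y ν) / 2 = c⁻¹ * w / 2 / y ν by ring, le_div_iff₀ hypos]
      nlinarith [mul_pos (hM0 ν) hypos]
    linarith
  · set Lg := Real.log ((n ν : ℝ) * dimExcept (p ν) k) with hLg
    have hLg0 : 0 < Lg := by linarith
    -- The exponent 1/(2ε) in the growth condition serves this purpose: raised to the power 2ε, the
    -- inequality becomes log(N) y^{2ε} ≤ 1.
    have h2 : y ν * Lg ^ (1 / (2 * ε)) ≤ 1 := by
      have h3 : w * (y ν * Lg ^ (1 / (2 * ε))) ≤ M ν * y ν * Lg ^ (1 / (2 * ε)) := by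
        rw [mul_assoc]
        exact mul_le_mul_of_nonneg_right (hwM ν) (by positivity)
      have h4 : w * (y ν * Lg ^ (1 / (2 * ε))) ≤ w * 1 := by linarith
      exact le_of_mul_le_mul_left h4 hw
    have h5 := Real.rpow_le_rpow (by positivity) h2 (by positivity : 0 ≤ 2 * ε)
    rw [Real.one_rpow, Real.mul_rpow hypos.le (by positivity), ← Real.rpow_mul hLg0.le, one_div,
      inv_mul_cancel₀ (by positivity), Real.rpow_one] at h5
    linarith

end Regime

/-! ### Assembly in the two dependence settings. -/

section Model

variable {Ω : Type*} [MeasurableSpace Ω] {P : Measure Ω} {K : ℕ} {r : Fin K → ℕ} {ι : Type*}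
  {n : ι → ℕ} {p : ι → Fin K → ℕ}

theorem LoadingAssumption.transpose_mul_self {Λ : ∀ ν k, Matrix (Fin (p ν k)) (Fin (r k)) ℝ}
    (h : LoadingAssumption Λ) (ν : ι) (k : Fin K) :
    (Λ ν k).transpose * Λ ν k = (p ν k : ℝ) • (1 : Matrix (Fin (r k)) (Fin (r k)) ℝ) := by
  have h1 := h.orthonormal ν k
  by_cases h0 : (p ν k : ℝ) = 0
  · rw [h0, inv_zero, zero_smul] at h1
    rw [h0, zero_smul, ← Matrix.mul_one ((Λ ν k).transpose * Λ ν k), ← h1, Matrix.mul_zero]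
  · rw [← h1, smul_smul, mul_inv_cancel₀ h0, one_smul]

theorem FactorAssumption.exists_lower_bound {F : ι → ℕ → Tensor r} (h : FactorAssumption n F)
    (k : Fin K) : ∃ a : ℝ, 0 < a ∧ ∀ ν, (factorGram (n ν) (F ν) k).IsDiag ∧
      ∀ j, a ≤ factorGram (n ν) (F ν) k j j := by
  obtain ⟨a, b, ha, -, h⟩ := h
  rcases isEmpty_or_nonempty (Fin (r k)) with hE | hE
  · exact ⟨1, one_pos, fun ν => ⟨(h ν k).1, fun j => hE.elim j⟩⟩
  · obtain ⟨j₀, hj₀⟩ := Finite.exists_min (a k)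
    exact ⟨a k j₀, ha k j₀, fun ν => ⟨(h ν k).1, fun j => (hj₀ j).trans ((h ν k).2 j).1⟩⟩

theorem LoadingAssumption.exists_tucker_bound {Λ : ∀ ν k, Matrix (Fin (p ν k)) (Fin (r k)) ℝ}
    (h : LoadingAssumption Λ) : ∃ L : ℝ, 0 ≤ L ∧ ∀ ν (X : Tensor r) i,
      |tucker X (Λ ν) i| ≤ L * tnorm X := by
  obtain ⟨lam, hlam⟩ := h.bounded
  exact ⟨|lam| ^ K * √(Fintype.card (∀ k, Fin (r k))), by positivity,
    fun ν X i => abs_tucker_le X (Λ ν) (hlam ν) i⟩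

variable [IsProbabilityMeasure P]

theorem errBounds_of_assumptions {Λ : ∀ ν k, Matrix (Fin (p ν k)) (Fin (r k)) ℝ}
    {F : ι → ℕ → Tensor r} {ξ : ι → (Fin K → ℕ) → ℤ → Ω → ℝ} {ε w : ℝ} {M : ι → ℝ}
    (hξ : NoiseAssumption P p ξ) (hT : TailAssumption P n p F ξ ε w M) {L : ℝ} (hL0 : 0 ≤ L)
    (hL : ∀ ν (X : Tensor r) i, |tucker X (Λ ν) i| ≤ L * tnorm X) {ν : ι} {τ : ℝ} (hτ0 : 0 < τ)
    (hτ : L * M ν ≤ τ / 2) (k : Fin K) (i : Fin (p ν k))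
    (s : ℕ × (∀ j : {j : Fin K // j ≠ k}, Fin (p ν j))) (hs : s ∈ columnSites (n ν) (p ν) k) :
    ErrBounds P τ w ε ((2 * τ) ^ (2 - 2 * ε) * w ^ (2 + 2 * ε))
      (((τ / 2) ^ (1 + 2 * ε))⁻¹ * w ^ (2 + 2 * ε)) (noiseErr τ (F ν) (Λ ν) (ξ ν) k i s) := by
  refine errBounds_noiseErr hτ0 hT.w_pos hT.eps_pos hT.eps_lt_one (hξ.measurable ν) (hξ.centred ν)
    (hT.noise ν) ?_
  refine (hL ν _ _).trans (le_trans ?_ hτ)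
  exact mul_le_mul_of_nonneg_left (hT.factor_le_M ν s.1 (Finset.mem_product.mp hs).1) hL0

set_option maxHeartbeats 400000 in
/-- The loading estimator for mixing random fields. -/
theorem exists_rotation_field {l : Filter ι} (hn : Tendsto n l atTop)
    (hp : ∀ k, Tendsto (fun ν => p ν k) l atTop)
    (Λ : ∀ ν k, Matrix (Fin (p ν k)) (Fin (r k)) ℝ)
    (F : ι → ℕ → Tensor r) (ξ : ι → (Fin K → ℕ) → ℤ → Ω → ℝ) (ε w : ℝ) (M : ι → ℝ)
    (hΛ : LoadingAssumption Λ) (hF : FactorAssumption n F) (hξ : NoiseAssumption P p ξ)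
    (hT : TailAssumption P n p F ξ ε w M) (hfield : FieldAssumption P n p F ξ ε w)
    (hgrowth : GrowthCondition l n p ε M (fun ν => tauField (n ν) (p ν) ε w))
    (k : Fin K) (τ : ι → ℝ) (hτ0 : ∀ ν, 0 < τ ν)
    (hτ : τ =Θ[l] fun ν => tauField (n ν) (p ν) ε w k)
    (Λhat : ∀ ν, Ω → Matrix (Fin (p ν k)) (Fin (r k)) ℝ)
    (hhat : ∀ ν ω, IsPCLoading
      (truncGram (n ν) (fun t => obs (F ν t) (Λ ν) fun i => ξ ν i t ω) (τ ν) k) (Λhat ν ω)) :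
    ∃ H : ι → Ω → Matrix (Fin (r k)) (Fin (r k)) ℝ,
      (∀ ν, (∀ i j, Measurable fun ω => Λhat ν ω i j) → ∀ i j, Measurable fun ω => H ν ω i j) ∧
      (∀ i j, TendstoInMeasure P (fun ν ω => ((H ν ω).transpose * H ν ω) i j) l
        (fun _ => (1 : Matrix (Fin (r k)) (Fin (r k)) ℝ) i j)) ∧
      IsBigOP P l (fun ν ω => 1 / √(p ν k : ℝ) * specNorm (Λhat ν ω - Λ ν k * H ν ω))
        (fun ν => max (psiField (n ν) (p ν) ε w k) (1 / (p ν k : ℝ))) := by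
  have hε := hT.eps_pos
  have hε1 := hT.eps_lt_one
  have hw := hT.w_pos
  obtain ⟨c₀, cε, hc₀, -, hfield⟩ := hfield
  obtain ⟨a, ha0, ha⟩ := hF.exists_lower_bound k
  obtain ⟨Lc, hLc0, hLc⟩ := hΛ.exists_tucker_bound
  have hK0 : (0 : ℝ) < K := by exact_mod_cast k.pos
  set N : ι → ℝ := fun ν => (n ν : ℝ) * dimExcept (p ν) k with hN
  set Lg : ι → ℝ := fun ν => Real.log ((n ν : ℝ) * dimAll (p ν)) with hLg
  set y : ι → ℝ := fun ν => (Lg ν ^ K / N ν) ^ (1 / (2 + 2 * ε)) with hy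
  have hdim := eventually_dimensions hn hp k (r k)
  have hyx : ∀ᶠ ν in l, 0 < y ν ∧ y ν ^ (2 + 2 * ε) = Lg ν ^ K / N ν ∧
      tauField (n ν) (p ν) ε w k = w / y ν ∧
      psiField (n ν) (p ν) ε w k = w ^ 2 * y ν ^ (2 * ε) := by
    filter_upwards [hdim] with ν ⟨_, _, _, _, h1, h2, h3⟩
    have hL1 : 0 < Lg ν := by simp only [hLg]; linarith
    have hN1 : 0 < N ν := by simp only [hN]; linarith
    obtain ⟨e1, e2, e3, e4⟩ := rpow_truncation_identities (x := Lg ν ^ K / N ν) (by positivity) hε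
    refine ⟨e1, e2, ?_, ?_⟩
    · rw [inv_div] at e4
      rw [tauField, div_eq_mul_inv w]
      exact congrArg (w * ·) e4
    · rw [psiField]
      exact congrArg (w ^ 2 * ·) e3
  obtain ⟨c, C, hc, hC, hy0, hreg⟩ := eventually_truncation_regime hw hε hLc0 hT.M_pos hT.w_le_M
    hτ0 hgrowth (hdim.mono fun ν h => h.2.2.2.2.2.1) (hyx.mono fun ν h => ⟨h.1, h.2.2.1⟩) hτ
  set E := expSumConst (c₀ / K) with hE
  have hE0 : 0 < E := expSumConst_pos (by positivity)
  obtain ⟨D, hD0, hD⟩ := exists_truncation_constants K hε hε1 hw hc hC hc₀ hE0.le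
  set C₃ := Lc ^ 2 * w ^ 2 with hC₃
  set A₁ := 7 * w ^ 2 * (2 * expSumConst (ε * c₀ / 4 / K)) ^ K with hA₁
  set A₂ := 7 * w ^ 2 * (2 * expSumConst (ε * c₀ / 4)) with hA₂
  have hA₁0 : 0 ≤ A₁ := by
    have := expSumConst_pos (γ := ε * c₀ / 4 / K) (by positivity); positivity
  have hA₂0 : 0 ≤ A₂ := by
    have := expSumConst_pos (γ := ε * c₀ / 4) (by positivity); positivity
  have hC₃0 : 0 ≤ C₃ := by positivity
  set D₃ := 3 * (2 * (A₁ * C₃ + D * C₃) + D) with hD₃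
  have hD₃0 : 0 ≤ D₃ := by positivity
  set D₄ := D₃ + A₂ + D + 1 with hD₄
  have hD₄1 : 1 ≤ D₄ := by rw [hD₄]; linarith
  have hD₄0 : 0 < D₄ := by linarith
  have hD₃₄ : D₃ ≤ D₄ ^ 2 :=
    (by rw [hD₄]; linarith : D₃ ≤ D₄).trans (le_self_pow₀ hD₄1 two_ne_zero)
  have hDD₄ : D ≤ D₄ := by rw [hD₄]; linarith
  have hq0 : Tendsto (fun ν => 1 / (p ν k : ℝ)) l (𝓝 0) :=
    tendsto_const_nhds.div_atTop (tendsto_natCast_atTop_atTop.comp (hp k))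
  have hy2 : Tendsto (fun ν => y ν ^ (2 * ε)) l (𝓝 0) := by
    have := hy0.rpow_const (p := 2 * ε) (Or.inr (by positivity))
    rwa [Real.zero_rpow (by positivity)] at this
  -- Here y^{2ε} = ψ/w² comes from the mean square of the random part, and 1/p_k from the bounded
  -- row sums of the mean matrix divided by p_k. The constant D₄ dominates all others.
  refine exists_rotation_of_perturbation (R := fun ν ω =>
      perturbation (n ν) (τ ν) (F ν) (Λ ν) (ξ ν) k ω) (G := fun ν => factorGram (n ν) (F ν) k)
    (a := a) (ρ := fun ν => D₄ * (y ν ^ (2 * ε) + 1 / (p ν k : ℝ)))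
    (hdim.mono fun ν h => h.1) (hdim.mono fun ν h => h.2.1) ha0
    (fun ν => hΛ.transpose_mul_self ν k) (fun ν => (ha ν).1) (fun ν => (ha ν).2) ?_ hhat ?_ ?_ ?_ ?_
  · filter_upwards [hdim] with ν ⟨_, _, _, h1, _⟩ ω
    exact truncGram_obs_eq (n ν) (F ν) (Λ ν) (hΛ.transpose_mul_self ν) (fun i t => ξ ν i t ω) (τ ν)
      k h1
  · filter_upwards [hyx] with ν ⟨h, _⟩
    positivity
  · simpa using (hy2.add hq0).const_mul D₄
  · refine ⟨D₄ * ((w ^ 2)⁻¹ + 1), by positivity, ?_⟩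
    filter_upwards [hyx] with ν ⟨_, _, _, h⟩
    rw [h, mul_assoc]
    refine mul_le_mul_of_nonneg_left ?_ hD₄0.le
    set m := max (w ^ 2 * y ν ^ (2 * ε)) (1 / (p ν k : ℝ)) with hm
    have h1 : w ^ 2 * y ν ^ (2 * ε) ≤ m := le_max_left _ _
    have h2 : 1 / (p ν k : ℝ) ≤ m := le_max_right _ _
    have h3 : y ν ^ (2 * ε) ≤ (w ^ 2)⁻¹ * m := by
      rw [le_inv_mul_iff₀ (by positivity)]; exact h1
    linarith
  · filter_upwards [hdim, hyx, hreg] with ν ⟨_, hqpos, hnpos, hdpos, hN1, hlog1, hlog2⟩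
      ⟨_, hyx, _, _⟩ ⟨hypos, hy1, hτ1, hτ2, hτM, _⟩
    have hq' : (0 : ℝ) < p ν k := by exact_mod_cast hqpos
    have hN0 : 0 < (n ν : ℝ) * dimExcept (p ν) k := by linarith
    obtain ⟨ρ, hρ0, hρ1, hρ2, hρ3⟩ := hD (N ν) (Lg ν) (y ν) (τ ν) hN1 (hlog1.trans hlog2) hlog2
      hypos hyx hτ1 hτ2
    obtain ⟨W, hWi, hW0, hWx, hWB⟩ := exists_bilinBound_field (P := P) (C₃ := C₃) hN0 (hτ0 ν) hw hε
      hε1 hc₀ hρ0 (hξ.measurable ν) (hfield ν).1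
      (fun i s hs => errBounds_of_assumptions hξ hT hLc0 hLc (hτ0 ν) hτM k i s hs)
      hρ1 (by have := hτ0 ν; positivity)
      (sum_signal_sq_le (n ν) (F ν) (Λ ν) hnpos (fun t i => hLc ν _ _)
        (hT.factor ν 2 (by simp)) k)
    set B := ((τ ν / 2) ^ (1 + 2 * ε))⁻¹ * w ^ (2 + 2 * ε) with hB
    set U := (2 * τ ν) ^ (2 - 2 * ε) * w ^ (2 + 2 * ε) with hU
    set Y := y ν ^ (2 * ε) with hY
    have hY0 : 0 < Y := by positivity
    have hY1 : Y ≤ 1 := Real.rpow_le_one hypos.le hy1 (by positivity)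
    have hY4 : y ν ^ (4 * ε) = Y ^ 2 := by
      rw [hY, ← Real.rpow_natCast, ← Real.rpow_mul hypos.le]; congr 1; push_cast; ring
    -- Since y ≤ 1, the squared bias of order y^{2+4ε} is absorbed by ψ², of order y^{4ε}.
    have hB2 : B ^ 2 ≤ D * Y ^ 2 := by
      refine hρ3.trans (mul_le_mul_of_nonneg_left ?_ hD0.le)
      rw [← hY4]
      exact Real.rpow_le_rpow_of_exponent_ge hypos hy1 (by linarith)
    have hNinv : 1 / N ν ≤ Y ^ 2 := by
      calc 1 / N ν ≤ Lg ν ^ K / N ν :=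
            div_le_div_of_nonneg_right (one_le_pow₀ (hlog1.trans hlog2)) hN0.le
        _ = y ν ^ (2 + 2 * ε) := hyx.symm
        _ ≤ y ν ^ (4 * ε) := Real.rpow_le_rpow_of_exponent_ge hypos hy1 (by linarith)
        _ = Y ^ 2 := hY4
    have hdq : A₂ + p ν k * B ^ 2 ≤ p ν k * (D₄ * (Y + 1 / (p ν k : ℝ))) := by
      have e1 : (p ν k : ℝ) * (D₄ * (Y + 1 / (p ν k : ℝ))) = p ν k * (D₄ * Y) + D₄ := by
        field_simp
      have e2 : B ^ 2 ≤ D₄ * Y := by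
        refine hB2.trans ?_
        have : Y ^ 2 ≤ Y := by rw [sq]; exact mul_le_of_le_one_left hY0.le hY1
        exact mul_le_mul hDD₄ this (sq_nonneg Y) hD₄0.le
      rw [e1]
      have := mul_le_mul_of_nonneg_left e2 hq'.le
      linarith
    refine ⟨W, A₂ + p ν k * B ^ 2, hWi, hW0, ?_, by positivity, hdq, hWB⟩
    rw [hY4] at hρ2
    have e1 : A₁ * C₃ / N ν ≤ A₁ * C₃ * Y ^ 2 := by
      rw [div_eq_mul_one_div]
      exact mul_le_mul_of_nonneg_left hNinv (by positivity)
    have e2 : B ^ 2 * C₃ ≤ D * Y ^ 2 * C₃ := mul_le_mul_of_nonneg_right hB2 hC₃0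
    calc ∫ ω, W ω ∂P ≤ 3 * (2 * p ν k ^ 2 * (A₁ * C₃ / N ν + B ^ 2 * C₃) +
          p ν k ^ 2 * (U * (2 * (ρ + E)) ^ K / N ν)) := hWx
      _ ≤ 3 * (2 * p ν k ^ 2 * (A₁ * C₃ * Y ^ 2 + D * Y ^ 2 * C₃) +
          p ν k ^ 2 * (D * Y ^ 2)) := by gcongr
      _ = (p ν k) ^ 2 * (D₃ * Y ^ 2) := by rw [hD₃]; ring
      _ ≤ (p ν k) ^ 2 * (D₄ ^ 2 * Y ^ 2) := by
          gcongr
      _ = (p ν k * (D₄ * Y)) ^ 2 := by ring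
      _ ≤ _ := by
          have : 0 ≤ 1 / (p ν k : ℝ) := by positivity
          gcongr
          linarith

set_option maxHeartbeats 400000 in
/-- The loading estimator under cross-sectional independence. -/
theorem exists_rotation_indep {l : Filter ι} (hn : Tendsto n l atTop)
    (hp : ∀ k, Tendsto (fun ν => p ν k) l atTop)
    (Λ : ∀ ν k, Matrix (Fin (p ν k)) (Fin (r k)) ℝ)
    (F : ι → ℕ → Tensor r) (ξ : ι → (Fin K → ℕ) → ℤ → Ω → ℝ) (ε w : ℝ) (M : ι → ℝ)
    (hΛ : LoadingAssumption Λ) (hF : FactorAssumption n F) (hξ : NoiseAssumption P p ξ)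
    (hT : TailAssumption P n p F ξ ε w M) (hindep : IndepAssumption P n p F ξ ε w)
    (hgrowth : GrowthCondition l n p ε M (fun ν => tauIndep (n ν) (p ν) ε w))
    (k : Fin K) (τ : ι → ℝ) (hτ0 : ∀ ν, 0 < τ ν)
    (hτ : τ =Θ[l] fun ν => tauIndep (n ν) (p ν) ε w k)
    (Λhat : ∀ ν, Ω → Matrix (Fin (p ν k)) (Fin (r k)) ℝ)
    (hhat : ∀ ν ω, IsPCLoading
      (truncGram (n ν) (fun t => obs (F ν t) (Λ ν) fun i => ξ ν i t ω) (τ ν) k) (Λhat ν ω)) :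
    ∃ H : ι → Ω → Matrix (Fin (r k)) (Fin (r k)) ℝ,
      (∀ ν, (∀ i j, Measurable fun ω => Λhat ν ω i j) → ∀ i j, Measurable fun ω => H ν ω i j) ∧
      (∀ i j, TendstoInMeasure P (fun ν ω => ((H ν ω).transpose * H ν ω) i j) l
        (fun _ => (1 : Matrix (Fin (r k)) (Fin (r k)) ℝ) i j)) ∧
      IsBigOP P l (fun ν ω => 1 / √(p ν k : ℝ) * specNorm (Λhat ν ω - Λ ν k * H ν ω))
        (fun ν => max (max (M ν ^ (1 - ε) / √((n ν : ℝ) * dimExcept (p ν) k)) (1 / (p ν k : ℝ)))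
          (psiIndep (n ν) (p ν) ε w k / √(p ν k : ℝ))) := by
  have hε := hT.eps_pos
  have hε1 := hT.eps_lt_one
  have hw := hT.w_pos
  obtain ⟨c₀, cε, hc₀, -, hindep⟩ := hindep
  obtain ⟨a, ha0, ha⟩ := hF.exists_lower_bound k
  obtain ⟨Lc, hLc0, hLc⟩ := hΛ.exists_tucker_bound
  set N : ι → ℝ := fun ν => (n ν : ℝ) * dimExcept (p ν) k with hN
  set y : ι → ℝ := fun ν => (Real.log (N ν) / N ν) ^ (1 / (2 + 2 * ε)) with hy
  have hdim := eventually_dimensions hn hp k (r k)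
  have hyx : ∀ᶠ ν in l, 0 < y ν ∧ y ν ^ (2 + 2 * ε) = Real.log (N ν) / N ν ∧
      tauIndep (n ν) (p ν) ε w k = w / y ν ∧
      psiIndep (n ν) (p ν) ε w k = w ^ 2 * y ν ^ (2 * ε) := by
    filter_upwards [hdim] with ν ⟨_, _, _, _, h1, h2, h3⟩
    have hL1 : 0 < Real.log (N ν) := by simp only [hN]; linarith
    have hN1 : 0 < N ν := by simp only [hN]; linarith
    obtain ⟨e1, e2, e3, e4⟩ :=
      rpow_truncation_identities (x := Real.log (N ν) / N ν) (by positivity) hε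
    refine ⟨e1, e2, ?_, ?_⟩
    · rw [inv_div] at e4
      rw [tauIndep, div_eq_mul_inv w]
      exact congrArg (w * ·) e4
    · rw [psiIndep]
      exact congrArg (w ^ 2 * ·) e3
  obtain ⟨c, C, hc, hC, hy0, hreg⟩ := eventually_truncation_regime hw hε hLc0 hT.M_pos hT.w_le_M
    hτ0 hgrowth (hdim.mono fun ν h => h.2.2.2.2.2.1) (hyx.mono fun ν h => ⟨h.1, h.2.2.1⟩) hτ
  set E := expSumConst c₀ with hE
  have hE0 : 0 < E := expSumConst_pos hc₀
  obtain ⟨D, hD0, hD⟩ := exists_truncation_constants 1 hε hε1 hw hc hC hc₀ hE0.le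
  set C₃ := Lc ^ 2 * w ^ 2 with hC₃
  set A₁ := 7 * w ^ 2 * (2 * expSumConst (ε * c₀ / 4)) with hA₁
  set A₃ := 77 * w ^ 4 * (2 * expSumConst (ε * c₀ / 4)) with hA₃
  have hexp := expSumConst_pos (γ := ε * c₀ / 4) (by positivity)
  have hA₁0 : 0 ≤ A₁ := by positivity
  have hA₃0 : 0 ≤ A₃ := by positivity
  have hC₃0 : 0 ≤ C₃ := by positivity
  set D₃ := 3 * (2 * (A₁ * C₃ + D * C₃) + A₃ + D) with hD₃
  have hD₃0 : 0 ≤ D₃ := by positivity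
  set D₄ := D₃ + 2 * w ^ 2 + D + 1 with hD₄
  have hw2 : 0 < w ^ 2 := by positivity
  have hD₄1 : 1 ≤ D₄ := by rw [hD₄]; linarith
  have hD₄0 : 0 < D₄ := by linarith
  have hD₃₄ : D₃ ≤ D₄ ^ 2 :=
    (by rw [hD₄]; linarith : D₃ ≤ D₄).trans (le_self_pow₀ hD₄1 two_ne_zero)
  have hDD₄ : D ≤ D₄ := by rw [hD₄]; linarith
  have hq0 : Tendsto (fun ν => 1 / (p ν k : ℝ)) l (𝓝 0) :=
    tendsto_const_nhds.div_atTop (tendsto_natCast_atTop_atTop.comp (hp k))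
  have hy2 : Tendsto (fun ν => y ν ^ (2 * ε)) l (𝓝 0) := by
    have := hy0.rpow_const (p := 2 * ε) (Or.inr (by positivity))
    rwa [Real.zero_rpow (by positivity)] at this
  have hNY : ∀ᶠ ν in l, 1 / √(N ν) ≤ y ν ^ (2 * ε) := by
    filter_upwards [hdim, hyx, hreg] with ν ⟨_, _, _, _, hN1, hlog1, _⟩ ⟨hypos, hyx, _⟩ ⟨_, hy1, _⟩
    have hN0 : 0 < N ν := by simp only [hN]; linarith
    rw [one_div, ← Real.sqrt_inv]
    refine Real.sqrt_le_iff.mpr ⟨by positivity, ?_⟩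
    calc (N ν)⁻¹ ≤ Real.log (N ν) / N ν := by
          rw [inv_eq_one_div]; exact div_le_div_of_nonneg_right hlog1 hN0.le
      _ = y ν ^ (2 + 2 * ε) := hyx.symm
      _ ≤ y ν ^ (2 * ε * (2 : ℕ)) :=
          Real.rpow_le_rpow_of_exponent_ge hypos hy1 (by push_cast; linarith)
      _ = (y ν ^ (2 * ε)) ^ 2 := by rw [Real.rpow_mul hypos.le, Real.rpow_natCast]
  -- The three terms come from the cross terms and off-diagonal variances, from the p_k diagonal
  -- variances averaged over p_k² entries, and from the row sums of the mean matrix.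
  refine exists_rotation_of_perturbation (R := fun ν ω =>
      perturbation (n ν) (τ ν) (F ν) (Λ ν) (ξ ν) k ω) (G := fun ν => factorGram (n ν) (F ν) k)
    (a := a) (ρ := fun ν => D₄ * (1 / √(N ν) + y ν ^ (2 * ε) / √(p ν k : ℝ) + 1 / (p ν k : ℝ)))
    (hdim.mono fun ν h => h.1) (hdim.mono fun ν h => h.2.1) ha0
    (fun ν => hΛ.transpose_mul_self ν k) (fun ν => (ha ν).1) (fun ν => (ha ν).2) ?_ hhat ?_ ?_ ?_ ?_
  · filter_upwards [hdim] with ν ⟨_, _, _, h1, _⟩ ω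
    exact truncGram_obs_eq (n ν) (F ν) (Λ ν) (hΛ.transpose_mul_self ν) (fun i t => ξ ν i t ω) (τ ν)
      k h1
  · filter_upwards [hyx, hdim] with ν ⟨h, _⟩ ⟨_, _, _, _, hN1, _⟩
    have hN0 : 0 < N ν := by simp only [hN]; linarith
    positivity
  · have hbig : Tendsto (fun ν => D₄ * (2 * y ν ^ (2 * ε) + 1 / (p ν k : ℝ))) l (𝓝 0) := by
      simpa using ((hy2.const_mul 2).add hq0).const_mul D₄
    refine squeeze_zero' ?_ ?_ hbig
    · filter_upwards [hyx] with ν ⟨h, _⟩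
      positivity
    · filter_upwards [hyx, hNY, hdim] with ν ⟨h, _⟩ hNY ⟨_, hqpos, _⟩
      have h1 : 1 ≤ √(p ν k : ℝ) := Real.one_le_sqrt.mpr (by exact_mod_cast hqpos)
      have h2 : y ν ^ (2 * ε) / √(p ν k : ℝ) ≤ y ν ^ (2 * ε) := div_le_self (by positivity) h1
      refine mul_le_mul_of_nonneg_left ?_ hD₄0.le
      linarith
  -- The bound obtained is 1/√N, which is at most a constant times M^{1-ε}/√N because M ≥ w.
  · refine ⟨D₄ * ((w ^ (1 - ε))⁻¹ + (w ^ 2)⁻¹ + 1), by positivity, ?_⟩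
    filter_upwards [hyx, hdim] with ν ⟨_, _, _, h⟩ ⟨_, hqpos, _, _, hN1, _⟩
    rw [h, mul_assoc]
    refine mul_le_mul_of_nonneg_left ?_ hD₄0.le
    have hN0 : 0 < N ν := by simp only [hN]; linarith
    have hq' : (0 : ℝ) < p ν k := by exact_mod_cast hqpos
    set m := max (max (M ν ^ (1 - ε) / √(N ν)) (1 / (p ν k : ℝ)))
      (w ^ 2 * y ν ^ (2 * ε) / √(p ν k : ℝ)) with hm
    have h1 : M ν ^ (1 - ε) / √(N ν) ≤ m := (le_max_left _ _).trans (le_max_left _ _)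
    have h2 : 1 / (p ν k : ℝ) ≤ m := (le_max_right _ _).trans (le_max_left _ _)
    have h3 : w ^ 2 * y ν ^ (2 * ε) / √(p ν k : ℝ) ≤ m := le_max_right _ _
    have h4 : y ν ^ (2 * ε) / √(p ν k : ℝ) ≤ (w ^ 2)⁻¹ * m := by
      rw [le_inv_mul_iff₀ (by positivity), ← mul_div_assoc]; exact h3
    have h5 : 1 / √(N ν) ≤ (w ^ (1 - ε))⁻¹ * m := by
      rw [le_inv_mul_iff₀ (by positivity), mul_one_div]
      refine le_trans ?_ h1
      exact div_le_div_of_nonneg_right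
        (Real.rpow_le_rpow hw.le (hT.w_le_M ν) (by linarith)) (Real.sqrt_nonneg _)
    linarith
  · filter_upwards [hdim, hyx, hreg] with ν ⟨_, hqpos, hnpos, hdpos, hN1, hlog1, hlog2⟩
      ⟨_, hyx, _, _⟩ ⟨hypos, hy1, hτ1, hτ2, hτM, hlogy⟩
    have hq' : (0 : ℝ) < p ν k := by exact_mod_cast hqpos
    have hN0 : 0 < (n ν : ℝ) * dimExcept (p ν) k := by linarith
    obtain ⟨ρ, hρ0, hρ1, hρ2, hρ3⟩ := hD (N ν) (Real.log (N ν)) (y ν) (τ ν) hN1 hlog1 le_rfl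
      hypos (by rw [pow_one]; exact hyx) hτ1 hτ2
    rw [pow_one] at hρ2
    obtain ⟨W, hWi, hW0, hWx, hWB⟩ := exists_bilinBound_indep (P := P) (C₃ := C₃) hN0 (hτ0 ν) hw hε
      hε1 hc₀ hρ0 (hξ.measurable ν) (hindep ν).1 (hindep ν).2.1
      (fun i s hs => errBounds_of_assumptions hξ hT hLc0 hLc (hτ0 ν) hτM k i s hs)
      hρ1 (by have := hτ0 ν; positivity)
      (sum_signal_sq_le (n ν) (F ν) (Λ ν) hnpos (fun t i => hLc ν _ _)
        (hT.factor ν 2 (by simp)) k)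
    set B := ((τ ν / 2) ^ (1 + 2 * ε))⁻¹ * w ^ (2 + 2 * ε) with hB
    set U := (2 * τ ν) ^ (2 - 2 * ε) * w ^ (2 + 2 * ε) with hU
    set Y := y ν ^ (2 * ε) with hY
    have hY0 : 0 < Y := by positivity
    have hY4 : y ν ^ (4 * ε) = Y ^ 2 := by
      rw [hY, ← Real.rpow_natCast, ← Real.rpow_mul hypos.le]; congr 1; push_cast; ring
    -- The squared bias is of order y^{2+2ε} y^{2ε} = (log N / N) y^{2ε}, and the growth condition
    -- cancels the logarithm through log(N) y^{2ε} ≤ 1.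
    have hB2 : B ^ 2 ≤ D / N ν := by
      refine hρ3.trans ?_
      rw [div_eq_mul_one_div]
      refine mul_le_mul_of_nonneg_left ?_ hD0.le
      rw [show 2 + 4 * ε = (2 + 2 * ε) + 2 * ε by ring, Real.rpow_add hypos, hyx,
        div_mul_eq_mul_div]
      exact div_le_div_of_nonneg_right hlogy hN0.le
    have hsN : 1 ≤ √(N ν) := Real.one_le_sqrt.mpr hN1
    have hsN2 : √(N ν) ^ 2 = N ν := Real.sq_sqrt hN0.le
    have hsq2 : √(p ν k : ℝ) ^ 2 = p ν k := Real.sq_sqrt hq'.le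
    have hsq0 : 0 < √(p ν k : ℝ) := Real.sqrt_pos.mpr hq'
    have hsN0 : 0 < √(N ν) := by linarith
    have hdq : 2 * w ^ 2 + p ν k * B ^ 2 ≤
        p ν k * (D₄ * (1 / √(N ν) + Y / √(p ν k : ℝ) + 1 / (p ν k : ℝ))) := by
      have e1 : (p ν k : ℝ) * (D₄ * (1 / √(N ν) + Y / √(p ν k : ℝ) + 1 / (p ν k : ℝ))) =
          p ν k * (D₄ * (1 / √(N ν))) + p ν k * (D₄ * (Y / √(p ν k : ℝ))) + D₄ := by
        field_simp
      have e2 : B ^ 2 ≤ D₄ * (1 / √(N ν)) := by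
        refine hB2.trans ?_
        rw [div_eq_mul_one_div]
        refine mul_le_mul hDD₄ ?_ (by positivity) hD₄0.le
        refine one_div_le_one_div_of_le hsN0 ?_
        exact (le_self_pow₀ hsN two_ne_zero).trans hsN2.le
      rw [e1]
      have := mul_le_mul_of_nonneg_left e2 hq'.le
      have h0 : 0 ≤ p ν k * (D₄ * (Y / √(p ν k : ℝ))) := by positivity
      linarith
    refine ⟨W, 2 * w ^ 2 + p ν k * B ^ 2, hWi, hW0, ?_, by positivity, hdq, hWB⟩
    rw [hY4] at hρ2
    have e2 : B ^ 2 * C₃ ≤ D / N ν * C₃ := mul_le_mul_of_nonneg_right hB2 hC₃0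
    have hNν : 0 < N ν := hN0
    have e0 : 0 ≤ 2 * (A₁ * C₃ + D * C₃) + A₃ := by positivity
    calc ∫ ω, W ω ∂P ≤ 3 * (2 * p ν k ^ 2 * (A₁ * C₃ / N ν + B ^ 2 * C₃) +
          (p ν k * (U * (2 * (ρ + E)) / N ν) + p ν k ^ 2 * (A₃ / N ν))) := hWx
      _ ≤ 3 * (2 * p ν k ^ 2 * (A₁ * C₃ / N ν + D / N ν * C₃) +
          (p ν k * (D * Y ^ 2) + p ν k ^ 2 * (A₃ / N ν))) := by gcongr
      _ = (3 * (2 * (A₁ * C₃ + D * C₃) + A₃)) * ((p ν k) ^ 2 / N ν) +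
          3 * D * (p ν k * Y ^ 2) := by ring
      _ ≤ D₃ * ((p ν k) ^ 2 / N ν) + D₃ * (p ν k * Y ^ 2) := by
          gcongr
          · rw [hD₃]; linarith
          · rw [hD₃]; linarith
      _ = (p ν k) ^ 2 * (D₃ * (1 / √(N ν) ^ 2 + Y ^ 2 / √(p ν k : ℝ) ^ 2)) := by
          rw [hsN2, hsq2]; field_simp
      _ ≤ (p ν k) ^ 2 * (D₄ ^ 2 * (1 / √(N ν) ^ 2 + Y ^ 2 / √(p ν k : ℝ) ^ 2)) := by
          gcongr
      _ ≤ (p ν k) ^ 2 * (D₄ ^ 2 * (1 / √(N ν) + Y / √(p ν k : ℝ) + 1 / (p ν k : ℝ)) ^ 2) := by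
          have z1 : 0 ≤ 1 / √(N ν) := by positivity
          have z2 : 0 ≤ Y / √(p ν k : ℝ) := by positivity
          have z3 : 0 ≤ 1 / (p ν k : ℝ) := by positivity
          refine mul_le_mul_of_nonneg_left (mul_le_mul_of_nonneg_left ?_ (by positivity))
            (by positivity)
          rw [show 1 / √(N ν) ^ 2 = (1 / √(N ν)) ^ 2 by rw [div_pow, one_pow], ← div_pow]
          exact sq_add_sq_le_sq_add_add z1 z2 z3
      _ = _ := by ring

end Model

end TensorFactor

theorem theorem1 {Ω : Type*} [MeasurableSpace Ω] (P : Measure Ω) [IsProbabilityMeasure P]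
    {K : ℕ} (r : Fin K → ℕ) {ι : Type*} (l : Filter ι)
    (n : ι → ℕ) (p : ι → Fin K → ℕ)
    (hn : Tendsto n l atTop) (hp : ∀ k, Tendsto (fun ν => p ν k) l atTop)
    (Λ : ∀ ν k, Matrix (Fin (p ν k)) (Fin (r k)) ℝ)
    (F : ι → ℕ → Tensor r)
    (ξ : ι → (Fin K → ℕ) → ℤ → Ω → ℝ)
    (ε w : ℝ) (M : ι → ℝ)
    (hΛ : LoadingAssumption Λ)
    (hF : FactorAssumption n F)
    (hξ : NoiseAssumption P p ξ)
    (hT : TailAssumption P n p F ξ ε w M) :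
    (IndepAssumption P n p F ξ ε w →
      GrowthCondition l n p ε M (fun ν => tauIndep (n ν) (p ν) ε w) →
      ∀ (k : Fin K) (τ : ι → ℝ), (∀ ν, 0 < τ ν) →
      (τ =Θ[l] fun ν => tauIndep (n ν) (p ν) ε w k) →
      ∀ Λhat : ∀ ν, Ω → Matrix (Fin (p ν k)) (Fin (r k)) ℝ,
      (∀ ν ω, IsPCLoading
        (truncGram (n ν) (fun t => obs (F ν t) (Λ ν) fun i => ξ ν i t ω) (τ ν) k) (Λhat ν ω)) →
      ∃ H : ι → Ω → Matrix (Fin (r k)) (Fin (r k)) ℝ,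
        (∀ ν, (∀ i j, Measurable fun ω => Λhat ν ω i j) → ∀ i j, Measurable fun ω => H ν ω i j) ∧
        (∀ i j, TendstoInMeasure P (fun ν ω => ((H ν ω).transpose * H ν ω) i j) l
          (fun _ => (1 : Matrix (Fin (r k)) (Fin (r k)) ℝ) i j)) ∧
        IsBigOP P l (fun ν ω => 1 / √(p ν k : ℝ) * specNorm (Λhat ν ω - Λ ν k * H ν ω))
          (fun ν => max (max (M ν ^ (1 - ε) / √((n ν : ℝ) * dimExcept (p ν) k)) (1 / (p ν k : ℝ)))
            (psiIndep (n ν) (p ν) ε w k / √(p ν k : ℝ)))) ∧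
    (FieldAssumption P n p F ξ ε w →
      GrowthCondition l n p ε M (fun ν => tauField (n ν) (p ν) ε w) →
      ∀ (k : Fin K) (τ : ι → ℝ), (∀ ν, 0 < τ ν) →
      (τ =Θ[l] fun ν => tauField (n ν) (p ν) ε w k) →
      ∀ Λhat : ∀ ν, Ω → Matrix (Fin (p ν k)) (Fin (r k)) ℝ,
      (∀ ν ω, IsPCLoading
        (truncGram (n ν) (fun t => obs (F ν t) (Λ ν) fun i => ξ ν i t ω) (τ ν) k) (Λhat ν ω)) →
      ∃ H : ι → Ω → Matrix (Fin (r k)) (Fin (r k)) ℝ,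
        (∀ ν, (∀ i j, Measurable fun ω => Λhat ν ω i j) → ∀ i j, Measurable fun ω => H ν ω i j) ∧
        (∀ i j, TendstoInMeasure P (fun ν ω => ((H ν ω).transpose * H ν ω) i j) l
          (fun _ => (1 : Matrix (Fin (r k)) (Fin (r k)) ℝ) i j)) ∧
        IsBigOP P l (fun ν ω => 1 / √(p ν k : ℝ) * specNorm (Λhat ν ω - Λ ν k * H ν ω))
          (fun ν => max (psiField (n ν) (p ν) ε w k) (1 / (p ν k : ℝ)))) := by
  exact ⟨fun h hg k τ hτ0 hτ Λhat hhat =>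
      exists_rotation_indep hn hp Λ F ξ ε w M hΛ hF hξ hT h hg k τ hτ0 hτ Λhat hhat,
    fun h hg k τ hτ0 hτ Λhat hhat =>
      exists_rotation_field hn hp Λ F ξ ε w M hΛ hF hξ hT h hg k τ hτ0 hτ Λhat hhat⟩
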